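/- Let $M$ be a closed (compact, connected, without boundary) smooth surface with a smooth hyperbolic metric $\sigma$, that is, a Riemannian metric of constant Gaussian curvature $-1$ (if $M$ is orientable, its genus is then automatically $\ge 2$), and let $A$ be the total area of $(M,\sigma)$. Then there is a positive constant $C=C(\sigma)$, depending only on $\sigma$, such that for every smooth function $u\colon M\to\mathbb{R}$ for which the conformal metric $g=e^{2u}\sigma$ has nonpositive Gaussian curvature and total area $A$, we have $u(x)\le C$ for all $x\in M$. Explicitly, the injectivity radius $\operatorname{inj}(\sigma)$ is positive and one may take $$C=\frac12\log\frac{A}{4\pi\tanh^2\bigl(\operatorname{inj}(\sigma)/2\bigr)}.$$ -/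

import Mathlib

open scoped Manifold ContDiff

noncomputable section

/-- The Euclidean plane, on which surfaces are modelled. -/
abbrev Plane : Type := EuclideanSpace ℝ (Fin 2)

/-- Smooth Riemannian metrics on a smooth surface `M` without boundary. -/
abbrev SurfaceMetric (M : Type*) [TopologicalSpace M] [ChartedSpace Plane M]
    [IsManifold 𝓘(ℝ, Plane) ∞ M] : Type _ :=
  Bundle.ContMDiffRiemannianMetric 𝓘(ℝ, Plane) ∞ Plane
    (fun x : M => TangentSpace 𝓘(ℝ, Plane) x)

/-! ### Tensor calculus in a coordinate domain of the plane

Here `G y` is the matrix `(g_ij)` of a metric at the point `y` of a coordinate domain. -/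

namespace Coord

/-- The coordinate vector field `∂_i`. -/
def basisVec (i : Fin 2) : Plane := EuclideanSpace.single i 1

/-- The partial derivative `∂_i f` at `y`. -/
def partialDeriv (i : Fin 2) (f : Plane → ℝ) (y : Plane) : ℝ := fderiv ℝ f y (basisVec i)

/-- The Christoffel symbol
`Γ^k_ij = 1/2 ∑_l g^kl (∂_i g_jl + ∂_j g_il - ∂_l g_ij)` of the Levi-Civita connection. -/
def christoffel (G : Plane → Matrix (Fin 2) (Fin 2) ℝ) (k i j : Fin 2) (y : Plane) : ℝ :=
  1 / 2 * ∑ l, (G y)⁻¹ k l *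
    (partialDeriv i (fun z => G z j l) y + partialDeriv j (fun z => G z i l) y
      - partialDeriv l (fun z => G z i j) y)

/-- The component along `∂_l` of `R(∂_i, ∂_j) ∂_k = ∇_i ∇_j ∂_k - ∇_j ∇_i ∂_k`. -/
def riemann (G : Plane → Matrix (Fin 2) (Fin 2) ℝ) (l k i j : Fin 2) (y : Plane) : ℝ :=
  partialDeriv i (christoffel G l j k) y - partialDeriv j (christoffel G l i k) y
    + ∑ m, (christoffel G m j k y * christoffel G l i m y
      - christoffel G m i k y * christoffel G l j m y)

/-- The Gaussian curvature `g(R(∂_1, ∂_2) ∂_2, ∂_1) / det(g_ij)`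
(the two coordinates are indexed by `0` and `1`). -/
def gaussianCurvature (G : Plane → Matrix (Fin 2) (Fin 2) ℝ) (y : Plane) : ℝ :=
  (∑ l, G y l 0 * riemann G l 1 0 1 y) / (G y).det

end Coord

namespace SurfaceMetric

variable {M : Type*} [TopologicalSpace M] [ChartedSpace Plane M] [IsManifold 𝓘(ℝ, Plane) ∞ M]

/-- The conformal metric `e^{2u} g`, for a smooth function `u`. -/
def conformal (g : SurfaceMetric M) (u : M → ℝ) (hu : ContMDiff 𝓘(ℝ, Plane) 𝓘(ℝ, ℝ) ∞ u) :
    SurfaceMetric M where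
  inner x := Real.exp (2 * u x) • g.inner x
  symm x v w := by
    simp [g.symm x v w]
  pos x v hv := by
    have := g.pos x v hv
    simp only [smul_apply, smul_eq_mul]
    positivity
  isVonNBounded x := by
    have h := (g.isVonNBounded x).image
      (Real.exp (-u x) • ContinuousLinearMap.id ℝ (TangentSpace 𝓘(ℝ, Plane) x))
    apply h.subset
    intro v hv
    refine ⟨Real.exp (u x) • v, ?_, ?_⟩
    · have h2 : Real.exp (2 * u x) = Real.exp (u x) * Real.exp (u x) := by
        rw [← Real.exp_add]; ring_nf
      simpa [h2, mul_assoc] using hv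
    · simp [smul_smul, ← Real.exp_add]
  contMDiff := by
    have h1 : ContMDiff 𝓘(ℝ, Plane) 𝓘(ℝ, ℝ) ∞ (fun x => Real.exp (2 * u x)) :=
      (Real.contDiff_exp.comp (contDiff_const.mul contDiff_id)).contMDiff.comp hu
    exact h1.smul_section g.contMDiff

/-- The matrix `(g_ij)` of the metric in the chart `e`, at the point `y` of its target: the
coordinate vector fields of the chart are the images of the basis vectors under the differential
of `e⁻¹`. -/
def coordMatrix (g : SurfaceMetric M) (e : OpenPartialHomeomorph M Plane) (y : Plane) :
    Matrix (Fin 2) (Fin 2) ℝ :=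
  Matrix.of fun i j =>
    g.inner (e.symm y)
      (mfderiv 𝓘(ℝ, Plane) 𝓘(ℝ, Plane) e.symm y (Coord.basisVec i))
      (mfderiv 𝓘(ℝ, Plane) 𝓘(ℝ, Plane) e.symm y (Coord.basisVec j))

/-- The Gaussian curvature of `g` at `x`, computed in the chart `e` around `x`. -/
def curvatureIn (g : SurfaceMetric M) (e : OpenPartialHomeomorph M Plane) (x : M) : ℝ :=
  Coord.gaussianCurvature (g.coordMatrix e) (e x)

/-- A metric is hyperbolic if its Gaussian curvature, computed in smooth local coordinates,
is constant equal to `-1`. -/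
def IsHyperbolic (g : SurfaceMetric M) : Prop :=
  ∀ e ∈ IsManifold.maximalAtlas 𝓘(ℝ, Plane) ∞ M, ∀ x ∈ e.source, g.curvatureIn e x = -1

/-- A metric is nonpositively curved if its Gaussian curvature, computed in smooth local
coordinates, is everywhere at most `0`. -/
def IsNonpositivelyCurved (g : SurfaceMetric M) : Prop :=
  ∀ e ∈ IsManifold.maximalAtlas 𝓘(ℝ, Plane) ∞ M, ∀ x ∈ e.source, g.curvatureIn e x ≤ 0

/-- The part of the Riemannian measure carried by the domain of the chart `e`:
the image under `e⁻¹` of the measure `√det(g_ij) dy` on the target of `e`. -/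
def chartMeasure [MeasurableSpace M] (g : SurfaceMetric M) (e : OpenPartialHomeomorph M Plane) :
    MeasureTheory.Measure M :=
  ((MeasureTheory.volume.restrict e.target).withDensity
    fun y => ENNReal.ofReal (Real.sqrt (g.coordMatrix e y).det)).map e.symm

/-- The Riemannian measure `v_g`. The measures `chartMeasure g e` agree on the overlaps of the
chart domains, and `v_g`, the measure which restricts to each of them on the domain of `e`, is
their supremum. -/
def riemannianMeasure [MeasurableSpace M] (g : SurfaceMetric M) : MeasureTheory.Measure M :=
  ⨆ e ∈ IsManifold.maximalAtlas 𝓘(ℝ, Plane) ∞ M, g.chartMeasure e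

/-- The total area of the surface. -/
def area [MeasurableSpace M] (g : SurfaceMetric M) : ENNReal :=
  g.riemannianMeasure Set.univ

/-- The curve `γ` is a smooth geodesic of `g` on the open set `s` of times: in local coordinates
`c'' ^ k + ∑ Γ^k_ij(c) c' ^ i c' ^ j = 0`. -/
def IsGeodesicOn (g : SurfaceMetric M) (γ : ℝ → M) (s : Set ℝ) : Prop :=
  ContMDiffOn 𝓘(ℝ, ℝ) 𝓘(ℝ, Plane) ∞ γ s ∧
  ∀ e ∈ IsManifold.maximalAtlas 𝓘(ℝ, Plane) ∞ M, ∀ t ∈ s, γ t ∈ e.source → ∀ k : Fin 2,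
    deriv (deriv fun τ => e (γ τ)) t k
      + ∑ i, ∑ j, Coord.christoffel (g.coordMatrix e) k i j (e (γ t))
          * deriv (fun τ => e (γ τ)) t i * deriv (fun τ => e (γ τ)) t j = 0

/-- The open ball of radius `r` around the origin of the tangent plane at `p`, for the norm of `g`.
(The tangent planes are copies of `Plane`.) -/
def tangentBall (g : SurfaceMetric M) (p : M) (r : ℝ) : Set Plane :=
  {v : TangentSpace 𝓘(ℝ, Plane) p | Real.sqrt (g.inner p v v) < r}

/-- On the open star-shaped neighbourhood `B` of the origin of the tangent plane at `p`, the map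
`F` is the exponential map of `g` at `p`: for `v` in `B`, the curve `t ↦ F (t v)` is the geodesic
issued from `p` with initial velocity `v`, as long as `t v` stays in `B` (in particular for
`0 ≤ t ≤ 1`). -/
def IsExpOn (g : SurfaceMetric M) (p : M) (B : Set Plane) (F : Plane → M) : Prop :=
  F 0 = p ∧ ∀ v ∈ B,
    g.IsGeodesicOn (fun t : ℝ => F (t • v)) {t : ℝ | t • v ∈ B} ∧
    (mfderiv 𝓘(ℝ, ℝ) 𝓘(ℝ, Plane) (fun t : ℝ => F (t • v)) 0 (1 : ℝ) : Plane) = v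

/-- The exponential map at `p` is defined on the open ball of radius `r` of the tangent plane,
and is a diffeomorphism of this ball onto its (open) image. -/
def HasNormalBall (g : SurfaceMetric M) (p : M) (r : ℝ) : Prop :=
  ∃ F : Plane → M, g.IsExpOn p (g.tangentBall p r) F ∧
    IsLocalDiffeomorphOn 𝓘(ℝ, Plane) 𝓘(ℝ, Plane) ∞ F (g.tangentBall p r) ∧
    Set.InjOn F (g.tangentBall p r)

/-- The injectivity radius of `g`: the supremum of the radii `r > 0` such that, at every point,
the exponential map is a diffeomorphism from the ball of radius `r` onto its image. -/
def injectivityRadius (g : SurfaceMetric M) : ℝ :=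
  sSup {r : ℝ | 0 < r ∧ ∀ p : M, g.HasNormalBall p r}

end SurfaceMetric

end

/-!
A hyperbolic surface is locally isometric to the Poincaré disc, with its metric
`4 |dz|² / (1 - |z|²)²`; a normal ball of radius `r` at a point `x` becomes the Euclidean disc of
radius `ρ = tanh (r / 2)`, with `x` at its centre. In this disc the metric `e^{2u} σ` is
`φ |dz|²` with `φ = 4 e^{2u} / (1 - |z|²)²`, and nonpositive curvature means that `log φ`, and hence
`φ`, is subharmonic. The mean value inequality over the disc gives
`4 π ρ² e^{2u(x)} = π ρ² φ(0) ≤ ∫ φ ≤ A`, and letting `r` tend to the injectivity radius gives the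
bound on `u`. The same comparison for `u = 0`, with the exact area `4 π ρ² / (1 - ρ²)` of the disc,
shows that the injectivity radius is finite and that the bound is positive.

The local isometry is constructed from the equation `Hess f = f g`. On a surface of curvature `-1`
it is a flat linear system for the 1-jet of `f`, so that on a star-shaped coordinate domain it has
a solution with any initial jet (`exists_flatSystem_solution`). Three solutions whose jets at the
origin form a Lorentzian basis are the components of an isometric immersion into the hyperboloid
(`Coord.exists_isHyperboloidMap`), which the stereographic projection carries to the disc. If the
rays of the domain are geodesics, the solutions are known along them
(`Coord.IsHyperboloidMap.apply_of_geodesic`), and the composition is the exponential map of the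
disc, hence a diffeomorphism: so a normal ball of radius `r` is a Poincaré chart of radius `tanh (r / 2)`
(`SurfaceMetric.HasNormalBall.exists_isPoincareChart`).

Conversely, the exponential map at the centre of a Poincaré chart is that of the disc, since the
geodesic equation is the Euler-Lagrange equation of the energy and so is invariant under coordinate
changes (`Coord.geodesic_of_pullback`); this gives normal balls
(`SurfaceMetric.IsPoincareChart.hasNormalBall`). As the automorphisms of the disc move the centre
of a Poincaré chart to any nearby point, compactness makes their radii uniform, and the injectivity
radius is positive (`SurfaceMetric.exists_forall_hasNormalBall`).
-/

noncomputable section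

open Set Filter Topology

/-! ### Linear differential equations and flat linear systems -/

section LinearODE

variable {E : Type*} [NormedAddCommGroup E] [NormedSpace ℝ E]

/-- The radial truncation of the identity at norm `R`. -/
def radialTrunc (R : ℝ) (x : E) : E := (R / max R ‖x‖) • x

lemma radialTrunc_of_le {R : ℝ} (hR : 0 < R) {x : E} (hx : ‖x‖ ≤ R) : radialTrunc R x = x := by
  rw [radialTrunc, max_eq_left hx, div_self hR.ne', one_smul]

lemma norm_radialTrunc_le_norm {R : ℝ} (hR : 0 < R) (x : E) : ‖radialTrunc R x‖ ≤ ‖x‖ := by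
  have h : 0 < max R ‖x‖ := lt_of_lt_of_le hR (le_max_left _ _)
  rw [radialTrunc, norm_smul, Real.norm_of_nonneg (by positivity)]
  exact mul_le_of_le_one_left (norm_nonneg _) ((div_le_one h).2 (le_max_left _ _))

lemma norm_radialTrunc_le {R : ℝ} (hR : 0 < R) (x : E) : ‖radialTrunc R x‖ ≤ R := by
  have h : 0 < max R ‖x‖ := lt_of_lt_of_le hR (le_max_left _ _)
  rw [radialTrunc, norm_smul, Real.norm_of_nonneg (by positivity), div_mul_eq_mul_div,
    div_le_iff₀ h]
  exact mul_le_mul_of_nonneg_left (le_max_right _ _) hR.le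

lemma norm_radialTrunc_sub_le {R : ℝ} (hR : 0 < R) (x y : E) :
    ‖radialTrunc R x - radialTrunc R y‖ ≤ 2 * ‖x - y‖ := by
  set a := max R ‖x‖ with ha
  set b := max R ‖y‖ with hb
  have ha0 : 0 < a := lt_of_lt_of_le hR (le_max_left _ _)
  have hb0 : 0 < b := lt_of_lt_of_le hR (le_max_left _ _)
  have hRa : R ≤ a := le_max_left _ _
  have hyb : ‖y‖ ≤ b := le_max_right _ _
  have hab : |b - a| ≤ ‖x - y‖ := by
    calc |b - a| = |max ‖y‖ R - max ‖x‖ R| := by rw [hb, ha, max_comm R, max_comm R]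
      _ ≤ |‖y‖ - ‖x‖| := abs_max_sub_max_le_abs _ _ _
      _ ≤ ‖x - y‖ := by rw [norm_sub_rev]; exact abs_norm_sub_norm_le _ _
  have e : radialTrunc R x - radialTrunc R y
      = (R / a) • (x - y) + (R / a * ((b - a) / b)) • y := by
    have h1 : R / b = R / a - R / a * ((b - a) / b) := by field_simp; ring
    rw [radialTrunc, radialTrunc, ← ha, ← hb, h1]
    module
  rw [e, two_mul]
  refine (norm_add_le _ _).trans (add_le_add ?_ ?_)
  · rw [norm_smul, Real.norm_of_nonneg (by positivity)]
    exact mul_le_of_le_one_left (norm_nonneg _) ((div_le_one ha0).2 hRa)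
  · rw [norm_smul, norm_mul, Real.norm_of_nonneg (by positivity : 0 ≤ R / a), norm_div,
      Real.norm_eq_abs, Real.norm_of_nonneg hb0.le]
    calc R / a * (|b - a| / b) * ‖y‖ ≤ 1 * (|b - a| / b) * b := by
          gcongr
          exact (div_le_one ha0).2 hRa
      _ = |b - a| := by field_simp
      _ ≤ _ := hab

/-- A linear differential equation with continuous coefficients is solvable on all of `[0, 1]`. -/
theorem exists_linearODE_solution [CompleteSpace E] {B : ℝ → E →L[ℝ] E}
    (hB : ContinuousOn B (Icc 0 1)) (x₀ : E) :
    ∃ Z : ℝ → E, Z 0 = x₀ ∧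
      ∀ t ∈ Icc (0 : ℝ) 1, HasDerivWithinAt Z (B t (Z t)) (Icc 0 1) t := by
  obtain ⟨K, hK⟩ := isCompact_Icc.exists_bound_of_continuousOn hB
  have hK0 : 0 ≤ K := (norm_nonneg _).trans (hK 0 (by simp))
  set R : ℝ := ‖x₀‖ * Real.exp K + 1 with hR
  have hR0 : 0 < R := by positivity
  -- the truncated equation has a bounded Lipschitz right-hand side, hence a solution on `[0, 1]`
  have hPL : IsPicardLindelof (fun t x => B t (radialTrunc R x)) (tmin := 0) (tmax := 1)
      ⟨0, by simp⟩ x₀ (K * R).toNNReal 0 (K * R).toNNReal (K * 2).toNNReal := by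
    refine ⟨fun t ht => ?_, fun x _ => ?_, fun t ht x _ => ?_, ?_⟩
    · refine LipschitzOnWith.of_dist_le_mul fun x _ y _ => ?_
      rw [dist_eq_norm, dist_eq_norm, ← map_sub, Real.coe_toNNReal _ (by positivity), mul_assoc]
      exact (B t).le_of_opNorm_le_of_le (hK t ht) (norm_radialTrunc_sub_le hR0 _ _)
    · exact hB.clm_apply continuousOn_const
    · rw [Real.coe_toNNReal _ (by positivity)]
      exact (B t).le_of_opNorm_le_of_le (hK t ht) (norm_radialTrunc_le hR0 _)
    · simp
  obtain ⟨Z, hZ0, hZ⟩ := hPL.exists_eq_forall_mem_Icc_hasDerivWithinAt₀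
  have hZ0 : Z 0 = x₀ := hZ0
  refine ⟨Z, hZ0, fun t ht => ?_⟩
  have hbound : ‖Z t‖ ≤ R := by
    have h := norm_le_gronwallBound_of_norm_deriv_right_le (f := Z)
      (f' := fun t => B t (radialTrunc R (Z t))) (δ := ‖x₀‖) (K := K) (ε := 0) (a := 0) (b := 1)
      (fun s hs => (hZ s hs).continuousWithinAt)
      (fun s hs => (hZ s ⟨hs.1, hs.2.le⟩).mono_of_mem_nhdsWithin (Icc_mem_nhdsGE_of_mem hs))
      (by rw [hZ0])
      (fun s hs => by
        rw [add_zero]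
        exact (B s).le_of_opNorm_le_of_le (hK s ⟨hs.1, hs.2.le⟩) (norm_radialTrunc_le_norm hR0 _))
      t ht
    rw [gronwallBound_ε0, sub_zero] at h
    refine h.trans ?_
    have : Real.exp (K * t) ≤ Real.exp K := Real.exp_le_exp.2 (mul_le_of_le_one_right hK0 ht.2)
    have := mul_le_mul_of_nonneg_left this (norm_nonneg x₀)
    linarith
  simpa only [radialTrunc_of_le hR0 hbound] using hZ t ht

/-- A solution on `[0, 1]` of a homogeneous linear differential equation which starts at `0`
vanishes. -/
theorem linearODE_eq_zero {B : ℝ → E →L[ℝ] E} (hB : ContinuousOn B (Icc 0 1)) {Z : ℝ → E}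
    (hZ : ∀ t ∈ Icc (0 : ℝ) 1, HasDerivWithinAt Z (B t (Z t)) (Icc 0 1) t) (h0 : Z 0 = 0) :
    ∀ t ∈ Icc (0 : ℝ) 1, Z t = 0 := by
  obtain ⟨K, hK⟩ := isCompact_Icc.exists_bound_of_continuousOn hB
  intro t ht
  have h := norm_le_gronwallBound_of_norm_deriv_right_le (f := Z)
    (f' := fun t => B t (Z t)) (δ := 0) (K := K) (ε := 0) (a := 0) (b := 1)
    (fun s hs => (hZ s hs).continuousWithinAt)
    (fun s hs => (hZ s ⟨hs.1, hs.2.le⟩).mono_of_mem_nhdsWithin (Icc_mem_nhdsGE_of_mem hs))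
    (by rw [h0, norm_zero])
    (fun s hs => by
      rw [add_zero]; exact (B s).le_of_opNorm_le (hK s ⟨hs.1, hs.2.le⟩) _) t ht
  rw [gronwallBound_ε0_δ0] at h
  exact norm_le_zero_iff.1 h

end LinearODE

section FlatSystem

set_option maxSynthPendingDepth 3

variable {V E F : Type*} [NormedAddCommGroup V] [NormedSpace ℝ V]
  [NormedAddCommGroup E] [NormedSpace ℝ E] [NormedAddCommGroup F] [NormedSpace ℝ F]

/-- The first order Taylor expansion of a `C^1` map is uniform on compact sets. -/
theorem eventually_norm_taylor_le_of_isCompact {f : V → F} {U K : Set V} (hU : IsOpen U)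
    (hf : ContDiffOn ℝ 1 f U) (hK : IsCompact K) (hKU : K ⊆ U) {ε : ℝ} (hε : 0 < ε) :
    ∀ᶠ h in 𝓝 (0 : V), ∀ x ∈ K, x + h ∈ U ∧ ‖f (x + h) - f x - fderiv ℝ f x h‖ ≤ ε * ‖h‖ := by
  refine hK.eventually_forall_of_forall_eventually (x₀ := (0 : V))
    (P := fun h x => x + h ∈ U ∧ ‖f (x + h) - f x - fderiv ℝ f x h‖ ≤ ε * ‖h‖) fun x hx => ?_
  have hxU := hKU hx
  have hfx : ContDiffAt ℝ 1 f x := hf.contDiffAt (hU.mem_nhds hxU)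
  have hs := hfx.hasStrictFDerivAt one_ne_zero
  have hcont : ContinuousAt (fderiv ℝ f) x := hfx.continuousAt_fderiv one_ne_zero
  have h1 := (hasStrictFDerivAt_iff_isLittleO.1 hs).def (half_pos hε)
  have t1 : Tendsto (fun p : V × V => p.2 + p.1) (𝓝 (0, x)) (𝓝 x) := by
    have : ContinuousAt (fun p : V × V => p.2 + p.1) (0, x) := by fun_prop
    simpa [ContinuousAt] using this
  have t2 : Tendsto (fun p : V × V => p.2) (𝓝 (0, x)) (𝓝 x) := by
    have : ContinuousAt (fun p : V × V => p.2) (0, x) := by fun_prop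
    simpa [ContinuousAt] using this
  have h2 := (t1.prodMk_nhds t2).eventually h1
  have h3 : ∀ᶠ p : V × V in 𝓝 (0, x), dist (fderiv ℝ f p.2) (fderiv ℝ f x) < ε / 2 :=
    t2.eventually (Metric.tendsto_nhds.1 hcont _ (half_pos hε))
  filter_upwards [h2, h3, t1.eventually (hU.mem_nhds hxU)] with p hp2 hp3 hp4
  refine ⟨hp4, ?_⟩
  have e : f (p.2 + p.1) - f p.2 - fderiv ℝ f p.2 p.1
      = (f (p.2 + p.1) - f p.2 - fderiv ℝ f x (p.2 + p.1 - p.2))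
        - (fderiv ℝ f p.2 - fderiv ℝ f x) p.1 := by
    simp
  rw [e]
  refine (norm_sub_le _ _).trans ?_
  have h5 : ‖(fderiv ℝ f p.2 - fderiv ℝ f x) p.1‖ ≤ ε / 2 * ‖p.1‖ :=
    ContinuousLinearMap.le_of_opNorm_le _ (by rw [← dist_eq_norm]; exact hp3.le) _
  have h6 := hp2
  simp only [add_sub_cancel_left] at h6 ⊢
  linarith

lemma gronwallBound_zero_mul (K c ε x : ℝ) :
    gronwallBound 0 K (c * ε) x = c * gronwallBound 0 K ε x := by
  by_cases hK : K = 0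
  · subst hK; simp [gronwallBound_K0]; ring
  · rw [gronwallBound_of_K_ne_0 hK, gronwallBound_of_K_ne_0 hK]; simp only; ring

/-- A linear total differential system `dX = 𝒜 X` whose connection form `𝒜` is flat has a solution
with any given initial value, on every star-shaped domain. -/
theorem exists_flatSystem_solution [CompleteSpace E] {U : Set V} (hU : IsOpen U)
    (hS : StarConvex ℝ 0 U) (h0 : (0 : V) ∈ U) {𝒜 : V → V →L[ℝ] E →L[ℝ] E} (h𝒜 : ContDiffOn ℝ 1 𝒜 U)
    (hflat : ∀ y ∈ U, ∀ a b, fderiv ℝ 𝒜 y a b + 𝒜 y b ∘L 𝒜 y a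
      = fderiv ℝ 𝒜 y b a + 𝒜 y a ∘L 𝒜 y b) (x₀ : E) :
    ∃ X : V → E, X 0 = x₀ ∧ ∀ y ∈ U, HasFDerivAt X ((𝒜 y).flip (X y)) y := by
  have hray : ∀ y ∈ U, ∀ t ∈ Icc (0 : ℝ) 1, t • y ∈ U := fun y hy t ht => by
    have := hS hy (sub_nonneg.2 ht.2) ht.1 (by ring)
    simpa using this
  have hcont : ∀ y ∈ U, ContinuousOn (fun t : ℝ => 𝒜 (t • y)) (Icc 0 1) := fun y hy =>
    h𝒜.continuousOn.comp (by fun_prop) (fun t ht => hray y hy t ht)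
  have hex : ∀ y ∈ U, ∃ Z : ℝ → E, Z 0 = x₀ ∧
      ∀ t ∈ Icc (0 : ℝ) 1, HasDerivWithinAt Z (𝒜 (t • y) y (Z t)) (Icc 0 1) t := fun y hy =>
    exists_linearODE_solution (B := fun t => 𝒜 (t • y) y)
      ((hcont y hy).clm_apply continuousOn_const) x₀
  choose! Z hZ0 hZ using hex
  refine ⟨fun y => Z y 1, ?_, fun y hy => ?_⟩
  · have h := constant_of_derivWithin_zero (f := Z 0) (a := 0) (b := 1)
      (fun t ht => (hZ 0 h0 t ht).differentiableWithinAt)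
      (fun t ht => by
        have := (hZ 0 h0 t ⟨ht.1, ht.2.le⟩).derivWithin
          (uniqueDiffOn_Icc zero_lt_one t ⟨ht.1, ht.2.le⟩)
        simpa using this) 1 (by simp)
    exact h.trans (hZ0 0 h0)
  -- uniform bounds along the ray towards `y`
  have hZc : ContinuousOn (Z y) (Icc 0 1) := fun t ht => (hZ y hy t ht).continuousWithinAt
  have hD : ContinuousOn (fun t : ℝ => fderiv ℝ 𝒜 (t • y)) (Icc 0 1) :=
    (h𝒜.continuousOn_fderiv_of_isOpen hU le_rfl).comp (by fun_prop) (fun t ht => hray y hy t ht)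
  obtain ⟨N₁, hN₁⟩ := isCompact_Icc.exists_bound_of_continuousOn hZc
  obtain ⟨N₂, hN₂⟩ := isCompact_Icc.exists_bound_of_continuousOn hD
  obtain ⟨N₃, hN₃⟩ := isCompact_Icc.exists_bound_of_continuousOn (hcont y hy)
  obtain ⟨N, hN1, hN2, hN3⟩ : ∃ N, N₁ ≤ N ∧ N₂ ≤ N ∧ N₃ ≤ N :=
    ⟨max N₁ (max N₂ N₃), by simp, by simp, by simp⟩
  replace hN₁ : ∀ t ∈ Icc (0 : ℝ) 1, ‖Z y t‖ ≤ N := fun t ht => (hN₁ t ht).trans hN1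
  replace hN₂ : ∀ t ∈ Icc (0 : ℝ) 1, ‖fderiv ℝ 𝒜 (t • y)‖ ≤ N := fun t ht => (hN₂ t ht).trans hN2
  replace hN₃ : ∀ t ∈ Icc (0 : ℝ) 1, ‖𝒜 (t • y)‖ ≤ N := fun t ht => (hN₃ t ht).trans hN3
  have hN0 : 0 ≤ N := (norm_nonneg _).trans (hN₁ 0 (by simp))
  set Y := ‖y‖ + 1 with hY
  have hY0 : 0 < Y := by positivity
  set K := (N + N + 1) * Y with hK
  have hK0 : 0 ≤ K := by positivity
  set C := N * N + Y * N + (N + (N + 1) * Y) * (N * N) with hC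
  have hC0 : 0 ≤ C := by positivity
  set g := gronwallBound 0 K 1 1 with hg
  have hg0 : 0 ≤ g := by
    have : (0 : ℝ) ≤ gronwallBound 0 K 1 0 := by rw [gronwallBound_x0]
    exact this.trans (gronwallBound_mono le_rfl zero_le_one hK0 zero_le_one)
  rw [hasFDerivAt_iff_isLittleO_nhds_zero, Asymptotics.isLittleO_iff]
  intro c hc
  obtain ⟨ε, hε0, hε1, hεc⟩ : ∃ ε : ℝ, 0 < ε ∧ ε ≤ 1 ∧ ε * C * g ≤ c := by
    refine ⟨min 1 (c / (C * g + 1)), by positivity, min_le_left _ _, ?_⟩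
    have h1 : min 1 (c / (C * g + 1)) ≤ c / (C * g + 1) := min_le_right _ _
    calc min 1 (c / (C * g + 1)) * C * g = min 1 (c / (C * g + 1)) * (C * g) := by ring
      _ ≤ c / (C * g + 1) * (C * g + 1) := by gcongr; linarith
      _ = c := by field_simp
  have hcpt : IsCompact ((fun t : ℝ => t • y) '' Icc 0 1) :=
    isCompact_Icc.image (by fun_prop)
  have hT := eventually_norm_taylor_le_of_isCompact hU h𝒜 hcpt
    (by rintro _ ⟨t, ht, rfl⟩; exact hray y hy t ht) hε0
  obtain ⟨δ, hδ0, hδ⟩ := Metric.eventually_nhds_iff_ball.1 hT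
  have hUy : ∀ᶠ h in 𝓝 (0 : V), y + h ∈ U := by
    have : ContinuousAt (fun h : V => y + h) 0 := by fun_prop
    exact this.eventually (by simpa using hU.mem_nhds hy)
  filter_upwards [hUy, Metric.ball_mem_nhds 0 hδ0, Metric.ball_mem_nhds 0 hε0] with h hyh hhδ hhε
  have hhε : ‖h‖ ≤ ε := by simpa using (mem_ball_zero_iff.1 hhε).le
  have hYh : ‖y + h‖ ≤ Y := (norm_add_le _ _).trans (by rw [hY]; linarith)
  -- the Taylor remainder along the ray
  set r : ℝ → V →L[ℝ] E →L[ℝ] E :=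
    fun t => 𝒜 (t • y + t • h) - 𝒜 (t • y) - fderiv ℝ 𝒜 (t • y) (t • h) with hr
  have hr_le : ∀ t ∈ Icc (0 : ℝ) 1, ‖r t‖ ≤ ε * ‖h‖ := fun t ht => by
    have hth : ‖t • h‖ ≤ ‖h‖ := by
      rw [norm_smul, Real.norm_of_nonneg ht.1]
      exact mul_le_of_le_one_left (norm_nonneg _) ht.2
    have := (hδ (t • h) (by
      rw [mem_ball_zero_iff] at hhδ ⊢
      exact hth.trans_lt hhδ) (t • y) ⟨t, ht, rfl⟩).2
    exact this.trans (by gcongr)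
  have hA' : ∀ t, 𝒜 (t • (y + h)) = 𝒜 (t • y) + t • fderiv ℝ 𝒜 (t • y) h + r t := fun t => by
    simp only [hr, map_smul, smul_add]; abel
  have hth_le : ∀ t ∈ Icc (0 : ℝ) 1, ‖t • fderiv ℝ 𝒜 (t • y) h + r t‖ ≤ (N + 1) * ‖h‖ := by
    intro t ht
    refine (norm_add_le _ _).trans ?_
    rw [norm_smul, Real.norm_of_nonneg ht.1]
    have h1 := (fderiv ℝ 𝒜 (t • y)).le_of_opNorm_le (hN₂ t ht) h
    have h2 : t * ‖fderiv ℝ 𝒜 (t • y) h‖ ≤ ‖fderiv ℝ 𝒜 (t • y) h‖ :=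
      mul_le_of_le_one_left (norm_nonneg _) ht.2
    have h3 := hr_le t ht
    have h4 : ε * ‖h‖ ≤ 1 * ‖h‖ := by gcongr
    linarith
  have hA'_le : ∀ t ∈ Icc (0 : ℝ) 1, ‖𝒜 (t • (y + h)) (y + h)‖ ≤ K := fun t ht => by
    refine ContinuousLinearMap.le_of_opNorm_le_of_le _ ?_ hYh
    rw [hA', add_assoc]
    refine (norm_add_le _ _).trans ?_
    have h1 := hth_le t ht
    have h2 : (N + 1) * ‖h‖ ≤ (N + 1) * 1 := by gcongr; linarith
    have := hN₃ t ht
    linarith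
  -- the first order prediction for the solution along the ray towards `y + h`
  set W : ℝ → E := fun t => Z y t + t • 𝒜 (t • y) h (Z y t) with hW
  set W' : ℝ → E := fun t => 𝒜 (t • y) y (Z y t) + (𝒜 (t • y) h (Z y t)
    + t • (fderiv ℝ 𝒜 (t • y) y h (Z y t) + 𝒜 (t • y) h (𝒜 (t • y) y (Z y t)))) with hW'
  have hWd : ∀ t ∈ Icc (0 : ℝ) 1, HasDerivWithinAt W (W' t) (Icc 0 1) t := fun t ht => by
    have hd : HasDerivAt (fun s : ℝ => 𝒜 (s • y)) (fderiv ℝ 𝒜 (t • y) y) t := by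
      have h1 : HasFDerivAt 𝒜 (fderiv ℝ 𝒜 (t • y)) (t • y) :=
        ((h𝒜.contDiffAt (hU.mem_nhds (hray y hy t ht))).differentiableAt one_ne_zero).hasFDerivAt
      have h2 : HasDerivAt (fun s : ℝ => s • y) y t := by
        simpa using (hasDerivAt_id t).smul_const y
      exact h1.comp_hasDerivAt t h2
    have h1 : HasDerivWithinAt (fun s : ℝ => 𝒜 (s • y) h) (fderiv ℝ 𝒜 (t • y) y h) (Icc 0 1) t := by
      simpa using (hd.hasDerivWithinAt (s := Icc 0 1)).clm_apply (hasDerivWithinAt_const t _ h)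
    have h2 := h1.clm_apply (hZ y hy t ht)
    have h3 := (hZ y hy t ht).add ((hasDerivWithinAt_id t _).smul h2)
    refine h3.congr_deriv ?_
    simp only [hW', id]
    module
  have hWerr : ∀ t ∈ Icc (0 : ℝ) 1,
      dist (W' t) (𝒜 (t • (y + h)) (y + h) (W t)) ≤ ε * C * ‖h‖ := fun t ht => by
    have hf := congrArg (fun T : E →L[ℝ] E => T (Z y t)) (hflat (t • y) (hray y hy t ht) y h)
    simp only [add_apply, ContinuousLinearMap.comp_apply] at hf
    have e1 : W' t - 𝒜 (t • (y + h)) (y + h) (W t)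
        = -((t • fderiv ℝ 𝒜 (t • y) h h + r t (y + h)) (Z y t))
          - t • ((𝒜 (t • y) h + (t • fderiv ℝ 𝒜 (t • y) h + r t) (y + h))
            (𝒜 (t • y) h (Z y t))) := by
      simp only [hW', hW, hA', add_apply, smul_apply, map_add, map_smul, hf]
      module
    rw [dist_eq_norm, e1]
    have hz := hN₁ t ht
    have hAh : ‖𝒜 (t • y) h‖ ≤ N * ‖h‖ := (𝒜 (t • y)).le_of_opNorm_le (hN₃ t ht) h
    have hAhZ : ‖𝒜 (t • y) h (Z y t)‖ ≤ N * ‖h‖ * N :=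
      ContinuousLinearMap.le_of_opNorm_le_of_le _ hAh hz
    have b1 : ‖t • fderiv ℝ 𝒜 (t • y) h h + r t (y + h)‖ ≤ N * ‖h‖ * ε + ε * ‖h‖ * Y := by
      refine (norm_add_le _ _).trans (add_le_add ?_ ?_)
      · rw [norm_smul, Real.norm_of_nonneg ht.1]
        refine (mul_le_of_le_one_left (norm_nonneg _) ht.2).trans ?_
        exact ContinuousLinearMap.le_of_opNorm_le_of_le _
          ((fderiv ℝ 𝒜 (t • y)).le_of_opNorm_le (hN₂ t ht) h) hhε
      · exact ContinuousLinearMap.le_of_opNorm_le_of_le _ (hr_le t ht) hYh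
    have b2 : ‖𝒜 (t • y) h + (t • fderiv ℝ 𝒜 (t • y) h + r t) (y + h)‖
        ≤ (N + (N + 1) * Y) * ε := by
      refine (norm_add_le _ _).trans ?_
      have := ContinuousLinearMap.le_of_opNorm_le_of_le _ (hth_le t ht) hYh
      have h5 : N * ‖h‖ ≤ N * ε := by gcongr
      have h6 : (N + 1) * ‖h‖ * Y ≤ (N + 1) * ε * Y := by gcongr
      linarith
    refine (norm_sub_le _ _).trans ?_
    rw [norm_neg, norm_smul, Real.norm_of_nonneg ht.1]
    have b3 := ContinuousLinearMap.le_of_opNorm_le_of_le _ b1 hz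
    have b4 := ContinuousLinearMap.le_of_opNorm_le_of_le _ b2 hAhZ
    have b5 := mul_le_of_le_one_left (norm_nonneg ((𝒜 (t • y) h
      + (t • fderiv ℝ 𝒜 (t • y) h + r t) (y + h)) (𝒜 (t • y) h (Z y t)))) ht.2
    have e2 : ε * C * ‖h‖ = (N * ‖h‖ * ε + ε * ‖h‖ * Y) * N
        + (N + (N + 1) * Y) * ε * (N * ‖h‖ * N) := by rw [hC]; ring
    linarith
  have hlip : ∀ t ∈ Ico (0 : ℝ) 1, LipschitzOnWith K.toNNReal
      (fun x => 𝒜 (t • (y + h)) (y + h) x) univ := fun t ht => by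
    refine LipschitzOnWith.of_dist_le_mul fun a _ b _ => ?_
    rw [dist_eq_norm, dist_eq_norm, ← map_sub, Real.coe_toNNReal _ hK0]
    exact ContinuousLinearMap.le_of_opNorm_le _ (hA'_le t ⟨ht.1, ht.2.le⟩) _
  have hfin := dist_le_of_approx_trajectories_ODE_of_mem (a := 0) (b := 1) (δ := 0)
    (f := W) (f' := W') (g := Z (y + h)) (g' := fun t => 𝒜 (t • (y + h)) (y + h) (Z (y + h) t))
    (εf := ε * C * ‖h‖) (εg := 0) hlip
    (fun t ht => (hWd t ht).continuousWithinAt)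
    (fun t ht => (hWd t ⟨ht.1, ht.2.le⟩).mono_of_mem_nhdsWithin (Icc_mem_nhdsGE_of_mem ht))
    (fun t ht => hWerr t ⟨ht.1, ht.2.le⟩) (fun _ _ => mem_univ _)
    (fun t ht => (hZ (y + h) hyh t ht).continuousWithinAt)
    (fun t ht => (hZ (y + h) hyh t ⟨ht.1, ht.2.le⟩).mono_of_mem_nhdsWithin
      (Icc_mem_nhdsGE_of_mem ht))
    (fun t ht => by simp) (fun _ _ => mem_univ _)
    (by simp [hW, hZ0 y hy, hZ0 (y + h) hyh]) 1 (by simp)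
  rw [Real.coe_toNNReal _ hK0, add_zero, sub_zero,
    show ε * C * ‖h‖ = (ε * C * ‖h‖) * 1 by ring, gronwallBound_zero_mul, ← hg] at hfin
  have e3 : Z (y + h) 1 - Z y 1 - (𝒜 y).flip (Z y 1) h = Z (y + h) 1 - W 1 := by
    simp only [hW, one_smul, ContinuousLinearMap.flip_apply]; abel
  rw [e3, ← dist_eq_norm, dist_comm]
  refine hfin.trans ?_
  calc ε * C * ‖h‖ * g = ε * C * g * ‖h‖ := by ring
    _ ≤ c * ‖h‖ := by gcongr

/-- A solution of a total differential system `dX = 𝒜 X` with smooth coefficients is smooth. -/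
theorem contDiffOn_of_hasFDerivAt_flatSystem {U : Set V} (hU : IsOpen U)
    {𝒜 : V → V →L[ℝ] E →L[ℝ] E} (h𝒜 : ContDiffOn ℝ ∞ 𝒜 U) {X : V → E}
    (hX : ∀ y ∈ U, HasFDerivAt X ((𝒜 y).flip (X y)) y) : ContDiffOn ℝ ∞ X U := by
  refine contDiffOn_infty.2 fun n => ?_
  induction n with
  | zero =>
    exact contDiffOn_zero.2 fun y hy => (hX y hy).continuousAt.continuousWithinAt
  | succ n ih =>
    push_cast
    rw [contDiffOn_succ_iff_fderiv_of_isOpen hU]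
    refine ⟨fun y hy => (hX y hy).differentiableAt.differentiableWithinAt, by simp, ?_⟩
    have : ContDiffOn ℝ n (fun y => (𝒜 y).flip (X y)) U := by
      exact ((ContinuousLinearMap.apply ℝ E).contDiff.comp_contDiffOn ih).clm_comp
        (contDiffOn_infty.1 h𝒜 n)
    exact this.congr fun y hy => (hX y hy).fderiv

end FlatSystem

namespace Coord

/-! ### Metrics of a coordinate domain and their curvature -/

section Calculus

lemma fin_two_eq (i : Fin 2) : i = 0 ∨ i = 1 := by fin_cases i <;> simp

variable {f g : Plane → ℝ} {y : Plane}

lemma partialDeriv_add (i : Fin 2) (hf : DifferentiableAt ℝ f y) (hg : DifferentiableAt ℝ g y) :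
    partialDeriv i (fun z => f z + g z) y = partialDeriv i f y + partialDeriv i g y := by
  simp only [partialDeriv]
  rw [fderiv_fun_add hf hg, add_apply]

lemma partialDeriv_sub (i : Fin 2) (hf : DifferentiableAt ℝ f y) (hg : DifferentiableAt ℝ g y) :
    partialDeriv i (fun z => f z - g z) y = partialDeriv i f y - partialDeriv i g y := by
  simp only [partialDeriv]
  rw [fderiv_fun_sub hf hg, sub_apply]

lemma partialDeriv_mul (i : Fin 2) (hf : DifferentiableAt ℝ f y) (hg : DifferentiableAt ℝ g y) :
    partialDeriv i (fun z => f z * g z) y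
      = partialDeriv i f y * g y + f y * partialDeriv i g y := by
  simp only [partialDeriv]
  rw [fderiv_fun_mul hf hg]
  simp only [add_apply, smul_apply, smul_eq_mul]
  ring

lemma partialDeriv_congr {U : Set Plane} (hU : IsOpen U) (hy : y ∈ U) (h : EqOn f g U) (i : Fin 2) :
    partialDeriv i f y = partialDeriv i g y := by
  rw [partialDeriv, partialDeriv, (h.eventuallyEq_of_mem (hU.mem_nhds hy)).fderiv_eq]

lemma contDiffOn_partialDeriv {U : Set Plane} (hU : IsOpen U) (hf : ContDiffOn ℝ ∞ f U)
    (i : Fin 2) : ContDiffOn ℝ ∞ (partialDeriv i f) U :=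
  (hf.fderiv_of_isOpen hU (m := ∞) (by simp)).clm_apply contDiffOn_const

lemma fderiv_eq_sum_partialDeriv (f : Plane → ℝ) (y v : Plane) :
    fderiv ℝ f y v = ∑ i, v i * partialDeriv i f y := by
  have h : v = ∑ i, v i • basisVec i := by
    ext k; fin_cases k <;> simp [basisVec]
  conv_lhs => rw [h]
  simp [partialDeriv]

lemma partialDeriv_partialDeriv {U : Set Plane} (hU : IsOpen U) (hf : ContDiffOn ℝ ∞ f U)
    (hy : y ∈ U) (i j : Fin 2) : partialDeriv i (partialDeriv j f) y
      = fderiv ℝ (fderiv ℝ f) y (basisVec i) (basisVec j) := by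
  have hd : DifferentiableAt ℝ (fderiv ℝ f) y :=
    ((hf.fderiv_of_isOpen hU (m := ∞) (by simp)).contDiffAt (hU.mem_nhds hy)).differentiableAt
      (by simp)
  have e : partialDeriv j f = fun z => fderiv ℝ f z (basisVec j) := rfl
  rw [partialDeriv, e, fderiv_clm_apply hd (differentiableAt_const _)]
  simp

lemma partialDeriv_comm {U : Set Plane} (hU : IsOpen U) (hf : ContDiffOn ℝ ∞ f U) (hy : y ∈ U)
    (i j : Fin 2) : partialDeriv i (partialDeriv j f) y = partialDeriv j (partialDeriv i f) y := by
  rw [partialDeriv_partialDeriv hU hf hy, partialDeriv_partialDeriv hU hf hy]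
  exact ((hf.contDiffAt (hU.mem_nhds hy)).isSymmSndFDerivAt
    (by simp only [minSmoothness_of_isRCLikeNormedField]; norm_cast)).eq _ _

end Calculus

/-- `G` is the matrix of a smooth Riemannian metric on the coordinate domain `U`. -/
structure IsMetricOn (G : Plane → Matrix (Fin 2) (Fin 2) ℝ) (U : Set Plane) : Prop where
  isOpen : IsOpen U
  contDiffOn : ∀ i j, ContDiffOn ℝ ∞ (fun y => G y i j) U
  posDef : ∀ y ∈ U, (G y).PosDef

namespace IsMetricOn

variable {G : Plane → Matrix (Fin 2) (Fin 2) ℝ} {U : Set Plane} {y : Plane}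

lemma mono (h : IsMetricOn G U) {U' : Set Plane} (hU' : IsOpen U') (hs : U' ⊆ U) :
    IsMetricOn G U' :=
  ⟨hU', fun i j => (h.contDiffOn i j).mono hs, fun y hy => h.posDef y (hs hy)⟩

lemma symm (h : IsMetricOn G U) (hy : y ∈ U) (i j : Fin 2) : G y i j = G y j i := by
  simpa using (h.posDef y hy).isHermitian.apply j i

lemma det_pos (h : IsMetricOn G U) (hy : y ∈ U) : 0 < (G y).det := (h.posDef y hy).det_pos

lemma contDiffOn_inv (h : IsMetricOn G U) (i j : Fin 2) :
    ContDiffOn ℝ ∞ (fun y => (G y)⁻¹ i j) U := by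
  have hd : ContDiffOn ℝ ∞ (fun y => (G y).det) U := by
    simp only [Matrix.det_fin_two]
    exact ((h.contDiffOn 0 0).mul (h.contDiffOn 1 1)).sub
      ((h.contDiffOn 0 1).mul (h.contDiffOn 1 0))
  have hi : ContDiffOn ℝ ∞ (fun y => ((G y).det)⁻¹) U := hd.inv fun y hy => (h.det_pos hy).ne'
  simp only [Matrix.inv_def, Ring.inverse_eq_inv', Matrix.adjugate_fin_two, Matrix.smul_apply,
    smul_eq_mul]
  refine hi.mul ?_
  fin_cases i <;> fin_cases j <;> simp
  · exact h.contDiffOn 1 1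
  · exact (h.contDiffOn 0 1).neg
  · exact (h.contDiffOn 1 0).neg
  · exact h.contDiffOn 0 0

lemma contDiffOn_christoffel (h : IsMetricOn G U) (k i j : Fin 2) :
    ContDiffOn ℝ ∞ (christoffel G k i j) U := by
  have hp := fun a b c => contDiffOn_partialDeriv h.isOpen (h.contDiffOn a b) c
  refine contDiffOn_const.mul (ContDiffOn.sum fun l _ => (h.contDiffOn_inv k l).mul ?_)
  exact ((hp j l i).add (hp i l j)).sub (hp i j l)

lemma partialDeriv_symm (h : IsMetricOn G U) (hy : y ∈ U) (l i j : Fin 2) :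
    partialDeriv l (fun z => G z i j) y = partialDeriv l (fun z => G z j i) y :=
  partialDeriv_congr h.isOpen hy (fun _ hz => h.symm hz i j) l

lemma christoffel_symm (h : IsMetricOn G U) (hy : y ∈ U) (k i j : Fin 2) :
    christoffel G k i j y = christoffel G k j i y := by
  simp only [christoffel]
  congr 1
  refine Finset.sum_congr rfl fun l _ => ?_
  rw [h.partialDeriv_symm hy l i j]
  ring

/-- The Christoffel symbols of the first kind. -/
lemma sum_mul_christoffel (h : IsMetricOn G U) (hy : y ∈ U) (m i j : Fin 2) :
    ∑ k, G y m k * christoffel G k i j y = 1 / 2 * (partialDeriv i (fun z => G z j m) y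
      + partialDeriv j (fun z => G z i m) y - partialDeriv m (fun z => G z i j) y) := by
  have hmul : G y * (G y)⁻¹ = 1 := Matrix.mul_nonsing_inv _ (h.det_pos hy).ne'.isUnit
  have h0 := congrFun (congrFun hmul m) 0
  have h1 := congrFun (congrFun hmul m) 1
  rw [Matrix.mul_apply, Fin.sum_univ_two] at h0 h1
  simp only [christoffel, Fin.sum_univ_two]
  obtain rfl | rfl := fin_two_eq m <;>
  simp only [Matrix.one_apply, if_true, if_false, zero_ne_one, one_ne_zero] at h0 h1 <;>
  linear_combination (1 / 2 * (partialDeriv i (fun z => G z j 0) y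
      + partialDeriv j (fun z => G z i 0) y - partialDeriv 0 (fun z => G z i j) y)) * h0
    + (1 / 2 * (partialDeriv i (fun z => G z j 1) y
      + partialDeriv j (fun z => G z i 1) y - partialDeriv 1 (fun z => G z i j) y)) * h1

/-- The Levi-Civita connection is compatible with the metric. -/
lemma partialDeriv_eq (h : IsMetricOn G U) (hy : y ∈ U) (i j m : Fin 2) :
    partialDeriv i (fun z => G z j m) y
      = ∑ k, (G y m k * christoffel G k i j y + G y j k * christoffel G k i m y) := by
  rw [Finset.sum_add_distrib, h.sum_mul_christoffel hy, h.sum_mul_christoffel hy,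
    h.partialDeriv_symm hy i m j, h.partialDeriv_symm hy j i m, h.partialDeriv_symm hy m i j,
    h.partialDeriv_symm hy j m i, h.partialDeriv_symm hy m j i]
  ring

lemma differentiableAt (h : IsMetricOn G U) (hy : y ∈ U) (i j : Fin 2) :
    DifferentiableAt ℝ (fun z => G z i j) y :=
  ((h.contDiffOn i j).contDiffAt (h.isOpen.mem_nhds hy)).differentiableAt (by simp)

lemma differentiableAt_christoffel (h : IsMetricOn G U) (hy : y ∈ U) (k i j : Fin 2) :
    DifferentiableAt ℝ (christoffel G k i j) y :=
  ((h.contDiffOn_christoffel k i j).contDiffAt (h.isOpen.mem_nhds hy)).differentiableAt (by simp)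

lemma partialDeriv_partialDeriv_eq (h : IsMetricOn G U) (hy : y ∈ U) (a i j m : Fin 2) :
    partialDeriv a (partialDeriv i (fun z => G z j m)) y
      = ∑ k, (partialDeriv a (fun z => G z m k) y * christoffel G k i j y
        + G y m k * partialDeriv a (christoffel G k i j) y
        + (partialDeriv a (fun z => G z j k) y * christoffel G k i m y
        + G y j k * partialDeriv a (christoffel G k i m) y)) := by
  rw [partialDeriv_congr h.isOpen hy (fun z hz => h.partialDeriv_eq hz i j m) a]
  have d := fun a b => h.differentiableAt hy a b
  have c := fun k i j => h.differentiableAt_christoffel hy k i j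
  simp only [Fin.sum_univ_two]
  rw [partialDeriv_add _ (((d _ _).fun_mul (c _ _ _)).fun_add ((d _ _).fun_mul (c _ _ _)))
      (((d _ _).fun_mul (c _ _ _)).fun_add ((d _ _).fun_mul (c _ _ _))),
    partialDeriv_add _ ((d _ _).fun_mul (c _ _ _)) ((d _ _).fun_mul (c _ _ _)),
    partialDeriv_add _ ((d _ _).fun_mul (c _ _ _)) ((d _ _).fun_mul (c _ _ _))]
  rw [partialDeriv_mul _ (d _ _) (c _ _ _), partialDeriv_mul _ (d _ _) (c _ _ _),
    partialDeriv_mul _ (d _ _) (c _ _ _), partialDeriv_mul _ (d _ _) (c _ _ _)]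

/-- The curvature tensor with lowered index is skew-symmetric in its first two indices, since
second derivatives of the metric commute. -/
lemma sum_mul_riemann_skew (h : IsMetricOn G U) (hy : y ∈ U) (m j : Fin 2) :
    ∑ l, G y m l * riemann G l j 0 1 y + ∑ l, G y j l * riemann G l m 0 1 y = 0 := by
  have hc := partialDeriv_comm h.isOpen (h.contDiffOn j m) hy 0 1
  rw [h.partialDeriv_partialDeriv_eq hy, h.partialDeriv_partialDeriv_eq hy] at hc
  simp only [h.partialDeriv_eq hy, Fin.sum_univ_two] at hc
  simp only [riemann, Fin.sum_univ_two]
  have s := h.symm hy 1 0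
  have c0 := h.christoffel_symm hy 0 1 0
  have c1 := h.christoffel_symm hy 1 1 0
  fin_cases m <;> fin_cases j <;>
    simp only [Fin.zero_eta, Fin.mk_one, Fin.isValue, s, c0, c1] at hc ⊢ <;>
    linear_combination hc

/-- In dimension two the Gaussian curvature determines the curvature tensor. -/
lemma riemann_eq (h : IsMetricOn G U) (hy : y ∈ U) (m j : Fin 2) :
    riemann G m j 0 1 y = gaussianCurvature G y *
      ((if m = 0 then G y 1 j else 0) - (if m = 1 then G y 0 j else 0)) := by
  have hd := (h.det_pos hy).ne'
  have s := h.symm hy 1 0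
  have h00 := h.sum_mul_riemann_skew hy 0 0
  have h01 := h.sum_mul_riemann_skew hy 0 1
  have h11 := h.sum_mul_riemann_skew hy 1 1
  have hK : gaussianCurvature G y * (G y).det = ∑ l, G y l 0 * riemann G l 1 0 1 y := by
    rw [gaussianCurvature, div_mul_cancel₀ _ hd]
  simp only [Matrix.det_fin_two, Fin.sum_univ_two, s] at hK hd h00 h01 h11
  set K := gaussianCurvature G y
  have key : ∀ r0 r1 a0 a1 : ℝ, G y 0 0 * r0 + G y 0 1 * r1 = a0 →
      G y 0 1 * r0 + G y 1 1 * r1 = a1 →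
      (G y 0 0 * G y 1 1 - G y 0 1 * G y 0 1) * r0 = G y 1 1 * a0 - G y 0 1 * a1 ∧
      (G y 0 0 * G y 1 1 - G y 0 1 * G y 0 1) * r1 = G y 0 0 * a1 - G y 0 1 * a0 := by
    rintro r0 r1 a0 a1 rfl rfl
    constructor <;> ring
  obtain ⟨e1, e2⟩ := key (riemann G 0 0 0 1 y) (riemann G 1 0 0 1 y) 0
    (-(K * (G y 0 0 * G y 1 1 - G y 0 1 * G y 0 1))) (by linarith) (by linarith)
  obtain ⟨e3, e4⟩ := key (riemann G 0 1 0 1 y) (riemann G 1 1 0 1 y)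
    (K * (G y 0 0 * G y 1 1 - G y 0 1 * G y 0 1)) 0 (by linarith) (by linarith)
  fin_cases m <;> fin_cases j <;> simp [s] <;> apply mul_left_cancel₀ hd
  · linear_combination e1
  · linear_combination e3
  · linear_combination e2
  · linear_combination e4

end IsMetricOn

end Coord

namespace Coord

/-! ### Total differential systems for matrices -/

section MatrixSystem

set_option maxSynthPendingDepth 3

variable {n : Type*}

/-- The coordinate functions of the plane. -/
def coordProj (i : Fin 2) : Plane →L[ℝ] ℝ := EuclideanSpace.proj i

@[simp] lemma coordProj_apply (i : Fin 2) (v : Plane) : coordProj i v = v i := rfl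

lemma coordProj_basisVec (i j : Fin 2) : coordProj i (basisVec j) = if i = j then 1 else 0 := by
  simp [basisVec]

lemma contDiffOn_pi_pi [Fintype n] {f : Plane → n → n → ℝ} {U : Set Plane} {k : WithTop ℕ∞} :
    ContDiffOn ℝ k f U ↔ ∀ a b, ContDiffOn ℝ k (fun y => f y a b) U :=
  contDiffOn_pi.trans (forall_congr' fun _ => contDiffOn_pi)

lemma partialDeriv_entry [Fintype n] {f : Plane → n → n → ℝ} {f' : Plane →L[ℝ] n → n → ℝ}
    {y : Plane} (h : HasFDerivAt f f' y) (i : Fin 2) (a b : n) :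
    partialDeriv i (fun z => f z a b) y = f' (basisVec i) a b := by
  rw [partialDeriv, (hasFDerivAt_pi'.1 (hasFDerivAt_pi'.1 h a) b).fderiv]
  rfl

variable [Fintype n] [DecidableEq n]

/-- Multiplication of square matrices as a continuous bilinear map on the normed space of
functions of two indices. -/
def matMul (n : Type*) [Fintype n] [DecidableEq n] :
    (n → n → ℝ) →L[ℝ] (n → n → ℝ) →L[ℝ] (n → n → ℝ) :=
  LinearMap.toContinuousLinearMap
    ((LinearMap.toContinuousLinearMap : ((n → n → ℝ) →ₗ[ℝ] (n → n → ℝ)) ≃ₗ[ℝ] _).toLinearMap ∘ₗ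
      ((LinearMap.mul ℝ (Matrix n n ℝ)).compl₁₂ (Matrix.ofLinearEquiv ℝ).toLinearMap
        (Matrix.ofLinearEquiv ℝ).toLinearMap).compr₂ (Matrix.ofLinearEquiv ℝ).symm.toLinearMap)

lemma matMul_assoc (a b c : n → n → ℝ) :
    matMul n a (matMul n b c) = matMul n (matMul n a b) c :=
  (mul_assoc (Matrix.of a) (Matrix.of b) (Matrix.of c)).symm

/-- A smooth flat system `∂_i X = A_i X` of matrix equations has a solution with any given initial
value on every star-shaped domain of the plane. -/
theorem exists_matrixSystem_solution {U : Set Plane} (hU : IsOpen U) (hS : StarConvex ℝ 0 U)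
    (h0 : (0 : Plane) ∈ U) {A : Fin 2 → Plane → Matrix n n ℝ}
    (hA : ∀ i a b, ContDiffOn ℝ ∞ (fun y => A i y a b) U)
    (hflat : ∀ y ∈ U, ∀ a b, partialDeriv 0 (fun z => A 1 z a b) y + (A 1 y * A 0 y) a b
      = partialDeriv 1 (fun z => A 0 z a b) y + (A 0 y * A 1 y) a b)
    (X₀ : Matrix n n ℝ) :
    ∃ X : Plane → Matrix n n ℝ, X 0 = X₀ ∧ (∀ a b, ContDiffOn ℝ ∞ (fun y => X y a b) U) ∧
      ∀ y ∈ U, ∀ i a b, partialDeriv i (fun z => X z a b) y = (A i y * X y) a b := by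
  set A' : Fin 2 → Plane → n → n → ℝ := fun i y a b => A i y a b with hA'
  set 𝒜 : Plane → Plane →L[ℝ] (n → n → ℝ) →L[ℝ] (n → n → ℝ) := fun y =>
    ∑ i, (coordProj i).smulRight (matMul n (A' i y)) with h𝒜
  have hAc : ∀ i, ContDiffOn ℝ ∞ (A' i) U := fun i => contDiffOn_pi_pi.2 (hA i)
  have hAd : ∀ i, ∀ y ∈ U, HasFDerivAt (A' i) (fderiv ℝ (A' i) y) y := fun i y hy =>
    (((hAc i).contDiffAt (hU.mem_nhds hy)).differentiableAt (by simp)).hasFDerivAt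
  have h𝒜c : ContDiffOn ℝ ∞ 𝒜 U := by
    refine ContDiffOn.sum fun i _ => ?_
    exact (ContinuousLinearMap.smulRightL ℝ Plane ((n → n → ℝ) →L[ℝ] (n → n → ℝ))
      (coordProj i)).contDiff.comp_contDiffOn ((matMul n).contDiff.comp_contDiffOn (hAc i))
  have h𝒜d : ∀ y ∈ U, ∀ a b, fderiv ℝ 𝒜 y a b
      = ∑ i, b i • matMul n (fderiv ℝ (A' i) y a) := fun y hy a b => by
    have h1 : HasFDerivAt 𝒜 (∑ i, ((ContinuousLinearMap.smulRightL ℝ Plane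
        ((n → n → ℝ) →L[ℝ] (n → n → ℝ)) (coordProj i)).comp
          ((matMul n).comp (fderiv ℝ (A' i) y)))) y := by
      refine HasFDerivAt.fun_sum fun i _ => ?_
      exact (ContinuousLinearMap.smulRightL ℝ Plane ((n → n → ℝ) →L[ℝ] (n → n → ℝ))
        (coordProj i)).hasFDerivAt.comp y ((matMul n).hasFDerivAt.comp y (hAd i y hy))
    rw [h1.fderiv]
    simp
  have hflat' : ∀ y ∈ U, fderiv ℝ (A' 1) y (basisVec 0) + matMul n (A' 1 y) (A' 0 y)
      = fderiv ℝ (A' 0) y (basisVec 1) + matMul n (A' 0 y) (A' 1 y) := fun y hy => by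
    ext a b
    have := hflat y hy a b
    have e1 := partialDeriv_entry (hAd 1 y hy) 0 a b
    have e2 := partialDeriv_entry (hAd 0 y hy) 1 a b
    simp only [hA'] at e1 e2
    rw [e1, e2] at this
    exact this
  have hbasis : ∀ v : Plane, v = v 0 • basisVec 0 + v 1 • basisVec 1 := fun v => by
    ext k; fin_cases k <;> simp [basisVec]
  obtain ⟨X, hX0, hX⟩ := exists_flatSystem_solution hU hS h0 (h𝒜c.of_le (by norm_cast))
    (𝒜 := 𝒜) (fun y hy a b => by
      have e0 : ∀ i v, fderiv ℝ (A' i) y v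
          = v 0 • fderiv ℝ (A' i) y (basisVec 0) + v 1 • fderiv ℝ (A' i) y (basisVec 1) :=
        fun i v => by conv_lhs => rw [hbasis v, map_add, map_smul, map_smul]
      have h1 : fderiv ℝ (A' 1) y (basisVec 0) = fderiv ℝ (A' 0) y (basisVec 1)
          + matMul n (A' 0 y) (A' 1 y) - matMul n (A' 1 y) (A' 0 y) :=
        eq_sub_of_add_eq (hflat' y hy)
      rw [h𝒜d y hy, h𝒜d y hy, Fin.sum_univ_two, Fin.sum_univ_two, e0 0 a, e0 1 a, e0 0 b, e0 1 b,
        h1]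
      ext1 M
      simp only [h𝒜, add_apply, ContinuousLinearMap.comp_apply, Fin.sum_univ_two,
        ContinuousLinearMap.smulRight_apply, smul_apply, coordProj_apply, matMul_assoc, map_add,
        map_sub, map_smul, sub_apply]
      module) X₀
  refine ⟨X, hX0, contDiffOn_pi_pi.1 (contDiffOn_of_hasFDerivAt_flatSystem hU h𝒜c hX),
    fun y hy i a b => ?_⟩
  refine (partialDeriv_entry (hX y hy) i a b).trans ?_
  have e : 𝒜 y (basisVec i) = matMul n (A' i y) := by
    rw [h𝒜]
    simp only [sum_apply, ContinuousLinearMap.smulRight_apply, coordProj_basisVec, ite_smul,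
      one_smul, zero_smul, Finset.sum_ite_eq', Finset.mem_univ, if_true]
  rw [ContinuousLinearMap.flip_apply, e]
  rfl

/-- A parallel matrix-valued form which vanishes at the origin vanishes on the whole
star-shaped domain. -/
theorem matrixSystem_eq_zero {U : Set Plane} (hU : IsOpen U) (hS : StarConvex ℝ 0 U)
    {A : Fin 2 → Plane → Matrix n n ℝ} (hA : ∀ i a b, ContDiffOn ℝ ∞ (fun y => A i y a b) U)
    {D : Plane → Matrix n n ℝ} (hDc : ∀ a b, ContDiffOn ℝ ∞ (fun y => D y a b) U)
    (hD : ∀ y ∈ U, ∀ i a b,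
      partialDeriv i (fun z => D z a b) y = (A i y * D y + D y * (A i y).transpose) a b)
    (hD0 : D 0 = 0) : ∀ y ∈ U, D y = 0 := by
  intro y hy
  have hray : ∀ t ∈ Icc (0 : ℝ) 1, t • y ∈ U := fun t ht => by
    simpa using hS hy (sub_nonneg.2 ht.2) ht.1 (by ring)
  set A' : Fin 2 → Plane → n → n → ℝ := fun i y a b => A i y a b with hA'
  set D' : Plane → n → n → ℝ := fun y a b => D y a b with hD'
  set B : ℝ → (n → n → ℝ) →L[ℝ] (n → n → ℝ) := fun t =>
    ∑ i, y i • (matMul n (A' i (t • y)) + (matMul n).flip (fun a b => A' i (t • y) b a)) with hB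
  have hAc : ∀ i a b, ContinuousOn (fun t : ℝ => A' i (t • y) a b) (Icc 0 1) := fun i a b =>
    (hA i a b).continuousOn.comp (by fun_prop) hray
  have hBc : ContinuousOn B (Icc 0 1) := by
    refine continuousOn_finsetSum _ fun i _ => ContinuousOn.fun_const_smul ?_ _
    exact ((matMul n).continuous.comp_continuousOn
      (continuousOn_pi.2 fun a => continuousOn_pi.2 fun b => hAc i a b)).add
      ((matMul n).flip.continuous.comp_continuousOn
        (continuousOn_pi.2 fun a => continuousOn_pi.2 fun b => hAc i b a))
  have hd : ∀ z ∈ U, HasFDerivAt D' (fderiv ℝ D' z) z := fun z hz =>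
    (((contDiffOn_pi_pi.2 hDc).contDiffAt (hU.mem_nhds hz)).differentiableAt
      (by simp)).hasFDerivAt
  have h := linearODE_eq_zero hBc (Z := fun t => D' (t • y)) (fun t ht => ?_)
    (by ext a b; simp [hD', hD0]) 1 (by simp)
  · ext a b
    simpa [hD'] using congrFun (congrFun h a) b
  have ht' := hray t ht
  have h2 : HasDerivAt (fun s : ℝ => s • y) y t := by
    simpa using (hasDerivAt_id t).smul_const y
  refine ((hd _ ht').comp_hasDerivAt t h2).hasDerivWithinAt.congr_deriv ?_
  have hbasis : y = y 0 • basisVec 0 + y 1 • basisVec 1 := by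
    ext k; fin_cases k <;> simp [basisVec]
  have e : ∀ i, fderiv ℝ D' (t • y) (basisVec i) = matMul n (A' i (t • y)) (D' (t • y))
      + matMul n (D' (t • y)) (fun a b => A' i (t • y) b a) := fun i => by
    ext a b
    exact (partialDeriv_entry (hd _ ht') i a b).symm.trans (hD _ ht' i a b)
  have e2 : fderiv ℝ D' (t • y) y
      = y 0 • fderiv ℝ D' (t • y) (basisVec 0) + y 1 • fderiv ℝ D' (t • y) (basisVec 1) := by
    rw [← map_smul, ← map_smul, ← map_add, ← hbasis]
  rw [e2, e, e]
  simp [hB, Fin.sum_univ_two, ContinuousLinearMap.flip_apply]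

end MatrixSystem

/-! ### The functions `f` with `Hess f = f g` on a hyperbolic domain -/

section HyperbolicFunctions

variable {G : Plane → Matrix (Fin 2) (Fin 2) ℝ} {U : Set Plane}

/-- The connection matrices of the system `∂_i f = p_i`, `∂_i p_j = Γ^k_ij p_k + f g_ij` for the
unknowns `(f, p_0, p_1)`, which expresses the equation `Hess f = f g`. -/
def connMatrix (G : Plane → Matrix (Fin 2) (Fin 2) ℝ) (i : Fin 2) (y : Plane) :
    Matrix (Fin 3) (Fin 3) ℝ :=
  !![0, if i = 0 then 1 else 0, if i = 1 then 1 else 0;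
    G y i 0, christoffel G 0 i 0 y, christoffel G 1 i 0 y;
    G y i 1, christoffel G 0 i 1 y, christoffel G 1 i 1 y]

/-- The Lorentzian form `-1 ⊕ g`, which is parallel for the connection `connMatrix`. -/
def lorentzMatrix (G : Plane → Matrix (Fin 2) (Fin 2) ℝ) (y : Plane) : Matrix (Fin 3) (Fin 3) ℝ :=
  !![-1, 0, 0; 0, G y 0 0, G y 0 1; 0, G y 1 0, G y 1 1]

@[simp] lemma partialDeriv_const (i : Fin 2) (c : ℝ) (y : Plane) :
    partialDeriv i (fun _ => c) y = 0 := by simp [partialDeriv]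

lemma contDiffOn_connMatrix (h : IsMetricOn G U) (i : Fin 2) (a b : Fin 3) :
    ContDiffOn ℝ ∞ (fun y => connMatrix G i y a b) U := by
  fin_cases a <;> fin_cases b <;>
  first
  | exact contDiffOn_const
  | exact h.contDiffOn _ _
  | exact h.contDiffOn_christoffel _ _ _

/-- The system `Hess f = f g` is integrable exactly because the curvature is `-1`. -/
lemma connMatrix_flat (h : IsMetricOn G U) {y : Plane} (hy : y ∈ U)
    (hK : gaussianCurvature G y = -1) (a b : Fin 3) :
    partialDeriv 0 (fun z => connMatrix G 1 z a b) y + (connMatrix G 1 y * connMatrix G 0 y) a b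
      = partialDeriv 1 (fun z => connMatrix G 0 z a b) y
        + (connMatrix G 0 y * connMatrix G 1 y) a b := by
  have s := h.symm hy 1 0
  have c0 := h.christoffel_symm hy 0 1 0
  have c1 := h.christoffel_symm hy 1 1 0
  have r := fun m j => h.riemann_eq hy m j
  have d := fun i j m => h.partialDeriv_eq hy i j m
  simp only [hK, riemann, Fin.sum_univ_two] at r d
  have r00 := r 0 0
  have r01 := r 0 1
  have r10 := r 1 0
  have r11 := r 1 1
  simp [s, c0, c1] at r00 r01 r10 r11
  fin_cases a <;> fin_cases b <;>
    simp [connMatrix, Matrix.mul_apply, Fin.sum_univ_three, c0, c1, s, d] <;> try ring1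
  · linear_combination r00
  · linear_combination r10
  · linear_combination r01
  · linear_combination r11

/-- The Lorentzian form is parallel for the connection `connMatrix`. -/
lemma partialDeriv_lorentzMatrix (h : IsMetricOn G U) {y : Plane} (hy : y ∈ U) (i : Fin 2)
    (a b : Fin 3) : partialDeriv i (fun z => lorentzMatrix G z a b) y
      = (connMatrix G i y * lorentzMatrix G y
        + lorentzMatrix G y * (connMatrix G i y).transpose) a b := by
  have s := h.symm hy 1 0
  have d := fun i j m => h.partialDeriv_eq hy i j m
  simp only [Fin.sum_univ_two] at d
  simp only [Matrix.add_apply, Matrix.mul_apply, Matrix.transpose_apply, Fin.sum_univ_three]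
  obtain rfl | rfl := fin_two_eq i <;> fin_cases a <;> fin_cases b <;>
    simp [connMatrix, lorentzMatrix, d, s] <;> ring1

/-- Three functions on a coordinate domain which solve `Hess f = f g`, whose jets at the origin are
those of the Lorentzian coordinates of the hyperboloid at its vertex, `P` being a matrix of the
identification of the tangent planes. They are the components of an isometric immersion into the
hyperboloid `-f_0² + f_1² + f_2² = -1`. -/
structure IsHyperboloidMap (G : Plane → Matrix (Fin 2) (Fin 2) ℝ) (U : Set Plane)
    (P : Matrix (Fin 2) (Fin 2) ℝ) (f : Fin 3 → Plane → ℝ) : Prop where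
  contDiffOn : ∀ a, ContDiffOn ℝ ∞ (f a) U
  apply_zero_zero : f 0 0 = 1
  apply_succ_zero : ∀ a : Fin 2, f a.succ 0 = 0
  deriv_zero_zero : ∀ i, partialDeriv i (f 0) 0 = 0
  deriv_succ_zero : ∀ (a i : Fin 2), partialDeriv i (f a.succ) 0 = P a i
  hess : ∀ y ∈ U, ∀ a i j, partialDeriv i (partialDeriv j (f a)) y
    = ∑ k, christoffel G k i j y * partialDeriv k (f a) y + f a y * G y i j
  sq : ∀ y ∈ U, -f 0 y * f 0 y + ∑ a : Fin 2, f a.succ y * f a.succ y = -1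
  deriv : ∀ y ∈ U, ∀ i j, -partialDeriv i (f 0) y * partialDeriv j (f 0) y
    + ∑ a : Fin 2, partialDeriv i (f a.succ) y * partialDeriv j (f a.succ) y = G y i j

/-- A hyperbolic metric on a star-shaped domain has an isometric immersion into the hyperboloid: its
components are the first entries of the three solutions of the system for `Hess f = f g` whose
initial values form a Lorentzian basis. -/
theorem exists_isHyperboloidMap {P : Matrix (Fin 2) (Fin 2) ℝ} (h : IsMetricOn G U)
    (hS : StarConvex ℝ 0 U) (h0 : (0 : Plane) ∈ U) (hK : ∀ y ∈ U, gaussianCurvature G y = -1)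
    (hP : P.transpose * P = G 0) : ∃ f : Fin 3 → Plane → ℝ, IsHyperboloidMap G U P f := by
  obtain ⟨X, hX0, hXc, hX⟩ := exists_matrixSystem_solution h.isOpen hS h0
    (contDiffOn_connMatrix h) (fun y hy => connMatrix_flat h hy (hK y hy))
    !![1, 0, 0; 0, P 0 0, P 1 0; 0, P 0 1, P 1 1]
  have hXd : ∀ y ∈ U, ∀ a b, DifferentiableAt ℝ (fun z => X z a b) y := fun y hy a b =>
    ((hXc a b).contDiffAt (h.isOpen.mem_nhds hy)).differentiableAt (by simp)
  -- the form `X η Xᵀ` and the Lorentzian form are both parallel, and agree at the origin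
  have hD := matrixSystem_eq_zero h.isOpen hS (contDiffOn_connMatrix h)
    (D := fun y => Matrix.of fun a b => -X y a 0 * X y b 0 + X y a 1 * X y b 1 + X y a 2 * X y b 2
      - lorentzMatrix G y a b) (fun a b => by
        simp only [Matrix.of_apply]
        refine ((((hXc a 0).neg.mul (hXc b 0)).add ((hXc a 1).mul (hXc b 1))).add
          ((hXc a 2).mul (hXc b 2))).sub ?_
        fin_cases a <;> fin_cases b <;>
          first
          | exact contDiffOn_const
          | exact h.contDiffOn _ _) (fun y hy i a b => by
        have hN : DifferentiableAt ℝ (fun z => lorentzMatrix G z a b) y := by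
          fin_cases a <;> fin_cases b <;>
            first
            | exact differentiableAt_const _
            | exact h.differentiableAt hy _ _
        have e := partialDeriv_lorentzMatrix h hy i a b
        have d := hXd y hy
        simp only [Matrix.of_apply]
        rw [partialDeriv_sub _ ((((d _ _).fun_neg.fun_mul (d _ _)).fun_add
            ((d _ _).fun_mul (d _ _))).fun_add ((d _ _).fun_mul (d _ _))) hN,
          partialDeriv_add _ (((d _ _).fun_neg.fun_mul (d _ _)).fun_add
            ((d _ _).fun_mul (d _ _))) ((d _ _).fun_mul (d _ _)),
          partialDeriv_add _ ((d _ _).fun_neg.fun_mul (d _ _)) ((d _ _).fun_mul (d _ _)),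
          partialDeriv_mul _ (d _ _).fun_neg (d _ _), partialDeriv_mul _ (d _ _) (d _ _),
          partialDeriv_mul _ (d _ _) (d _ _), e]
        have en : partialDeriv i (fun z => -X z a 0) y = -partialDeriv i (fun z => X z a 0) y := by
          simp [partialDeriv, fderiv_fun_neg]
        rw [en]
        simp only [hX y hy, Matrix.add_apply, Matrix.mul_apply, Matrix.transpose_apply,
          Fin.sum_univ_three, Matrix.of_apply]
        ring) (by
        have s := h.symm h0 1 0
        have e00 := congrFun (congrFun hP 0) 0
        have e01 := congrFun (congrFun hP 0) 1
        have e11 := congrFun (congrFun hP 1) 1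
        simp only [Matrix.mul_apply, Fin.sum_univ_two, Matrix.transpose_apply] at e00 e01 e11
        ext a b
        rw [hX0]
        fin_cases a <;> fin_cases b <;> simp [lorentzMatrix, s] <;> linarith)
  have hp : ∀ y ∈ U, ∀ i (a : Fin 3), partialDeriv i (fun z => X z 0 a) y = X y i.succ a := by
    intro y hy i a
    rw [hX y hy, Matrix.mul_apply, Fin.sum_univ_three]
    obtain rfl | rfl := fin_two_eq i <;> simp [connMatrix]
  refine ⟨fun a y => X y 0 a, fun a => hXc 0 a, by simp [hX0], fun a => ?_, fun i => ?_,
    fun a i => ?_, fun y hy a i j => ?_, fun y hy => ?_, fun y hy i j => ?_⟩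
  · rw [hX0]; fin_cases a <;> simp
  · rw [hp 0 h0, hX0]; fin_cases i <;> simp
  · rw [hp 0 h0, hX0]; fin_cases i <;> fin_cases a <;> simp
  · rw [partialDeriv_congr h.isOpen hy (fun z hz => hp z hz j a), hX y hy, Matrix.mul_apply,
      Fin.sum_univ_three, Fin.sum_univ_two, hp y hy, hp y hy]
    obtain rfl | rfl := fin_two_eq j <;> simp [connMatrix] <;> ring
  · have := congrFun (congrFun (hD y hy) 0) 0
    simp [lorentzMatrix] at this
    simp only [Fin.sum_univ_two, Fin.succ_zero_eq_one, Fin.succ_one_eq_two]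
    linarith
  · have := congrFun (congrFun (hD y hy) i.succ) j.succ
    simp only [Matrix.of_apply, Matrix.zero_apply] at this
    simp only [hp y hy, Fin.sum_univ_two, Fin.succ_zero_eq_one, Fin.succ_one_eq_two]
    have e : lorentzMatrix G y i.succ j.succ = G y i j := by
      obtain rfl | rfl := fin_two_eq i <;> obtain rfl | rfl := fin_two_eq j <;>
        simp [lorentzMatrix]
    linarith

end HyperbolicFunctions

end Coord

/-! ### The exponential map of the hyperbolic disc at its centre -/

section PowerSeries

/-- A power series which converges absolutely at the positive reals below `R` is smooth on the
interval of radius `R`. -/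
lemma contDiffOn_tsum_mul_pow {a : ℕ → ℝ} {R : ℝ} (hR : 0 < R)
    (ha : ∀ w, 0 < w → w < R → Summable fun n => |a n| * w ^ n) :
    ContDiffOn ℝ ∞ (fun w => ∑' n, a n * w ^ n) (Metric.ball 0 R) := by
  set p := FormalMultilinearSeries.ofScalars ℝ a with hp
  have hr : ENNReal.ofReal R ≤ p.radius := by
    refine ENNReal.le_of_forall_nnreal_lt fun r hr => ?_
    by_cases hr0 : r = 0
    · simp [hr0]
    refine p.le_radius_of_summable_norm ?_
    have h := ha r (by positivity) (by
      rw [ENNReal.ofReal, ENNReal.coe_lt_coe] at hr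
      simpa [hR.le] using (NNReal.coe_lt_coe.2 hr))
    refine h.congr fun n => ?_
    rw [hp, FormalMultilinearSeries.ofScalars_norm, Real.norm_eq_abs]
  have hf : HasFPowerSeriesOnBall (fun w => ∑' n, a n * w ^ n) p 0 (ENNReal.ofReal R) := by
    have h1 := (p.hasFPowerSeriesOnBall (lt_of_lt_of_le (by simpa using hR) hr)).mono
      (by simpa using hR) hr
    refine h1.congr fun w _ => ?_
    simp [FormalMultilinearSeries.sum, hp, mul_comm]
  have := hf.analyticOnNhd.contDiffOn (n := ∞) (by
    have := Metric.isOpen_ball (x := (0 : ℝ)) (ε := R)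
    rw [← Metric.eball_ofReal] at this
    exact this.uniqueDiffOn)
  rwa [Metric.eball_ofReal] at this

end PowerSeries

section DiscExp

/-- The exponential map of the hyperbolic disc at its centre, for the Euclidean metric `|dz|²` of
the tangent plane. -/
def discExp (v : Plane) : Plane := (Real.tanh (‖v‖ / 2) / ‖v‖) • v

/-- The inverse of `discExp`. -/
def discLog (w : Plane) : Plane := (2 * Real.artanh ‖w‖ / ‖w‖) • w

lemma tanh_half_eq (s : ℝ) : Real.tanh (s / 2) = Real.sinh s / (1 + Real.cosh s) := by
  have h : s = 2 * (s / 2) := by ring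
  have hc := Real.cosh_pos (s / 2)
  have h2 := Real.cosh_sq (s / 2)
  have e1 : Real.sinh s = 2 * Real.sinh (s / 2) * Real.cosh (s / 2) := by
    conv_lhs => rw [h, Real.sinh_two_mul]
  have e2 : 1 + Real.cosh s = 2 * Real.cosh (s / 2) ^ 2 := by
    conv_lhs => rw [h, Real.cosh_two_mul, h2]
    rw [h2]; ring
  rw [Real.tanh_eq_sinh_div_cosh, e1, e2]
  field_simp

lemma tanh_mem_Ioo (x : ℝ) : Real.tanh x ∈ Ioo (-1 : ℝ) 1 := Real.tanh_bijOn.mapsTo (mem_univ x)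

lemma tanh_strictMono : StrictMono Real.tanh := fun a b hab => by
  by_contra! h
  have := Real.strictMonoOn_artanh.monotoneOn (tanh_mem_Ioo b) (tanh_mem_Ioo a) h
  rw [Real.artanh_tanh, Real.artanh_tanh] at this
  linarith

lemma tanh_nonneg {x : ℝ} (hx : 0 ≤ x) : 0 ≤ Real.tanh x := by
  have := tanh_strictMono.monotone hx
  rwa [Real.tanh_zero] at this

lemma tanh_pos {x : ℝ} (hx : 0 < x) : 0 < Real.tanh x := by
  have := tanh_strictMono hx
  rwa [Real.tanh_zero] at this

lemma norm_discExp (v : Plane) : ‖discExp v‖ = Real.tanh (‖v‖ / 2) := by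
  rcases eq_or_ne v 0 with rfl | hv
  · simp [discExp]
  have h0 : 0 < ‖v‖ := norm_pos_iff.2 hv
  have := tanh_nonneg (half_pos h0).le
  rw [discExp, norm_smul, Real.norm_of_nonneg (by positivity), div_mul_cancel₀ _ h0.ne']

lemma norm_discLog {w : Plane} : ‖discLog w‖ = 2 * Real.artanh ‖w‖ := by
  rcases eq_or_ne w 0 with rfl | hw
  · simp [discLog]
  have h0 : 0 < ‖w‖ := norm_pos_iff.2 hw
  have := Real.artanh_nonneg h0.le
  rw [discLog, norm_smul, Real.norm_of_nonneg (by positivity), div_mul_cancel₀ _ h0.ne']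

lemma discLog_discExp (v : Plane) : discLog (discExp v) = v := by
  rcases eq_or_ne v 0 with rfl | hv
  · simp [discLog, discExp]
  have h0 : 0 < ‖v‖ := norm_pos_iff.2 hv
  have := tanh_pos (half_pos h0)
  rw [discLog, norm_discExp, Real.artanh_tanh, discExp, smul_smul]
  have : 2 * (‖v‖ / 2) / Real.tanh (‖v‖ / 2) * (Real.tanh (‖v‖ / 2) / ‖v‖) = 1 := by field_simp
  rw [this, one_smul]

lemma discExp_discLog {w : Plane} (hw1 : ‖w‖ < 1) : discExp (discLog w) = w := by
  rcases eq_or_ne w 0 with rfl | hw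
  · simp [discLog, discExp]
  have h0 : 0 < ‖w‖ := norm_pos_iff.2 hw
  have := Real.artanh_pos ⟨h0, hw1⟩
  rw [discExp, norm_discLog, mul_div_cancel_left₀ _ two_ne_zero,
    Real.tanh_artanh ⟨by linarith, hw1⟩, discLog, smul_smul]
  have : ‖w‖ / (2 * Real.artanh ‖w‖) * (2 * Real.artanh ‖w‖ / ‖w‖) = 1 := by field_simp
  rw [this, one_smul]

/-- `discExp` is smooth at the origin too, because `sinh s / s` and `cosh s` are power series in
`s ^ 2`. -/
lemma contDiff_discExp : ContDiff ℝ ∞ discExp := by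
  set S : ℝ → ℝ := fun w => ∑' n : ℕ, 1 / ((2 * n + 1).factorial : ℝ) * w ^ n with hS
  set C : ℝ → ℝ := fun w => ∑' n : ℕ, 1 / ((2 * n).factorial : ℝ) * w ^ n with hC
  have hSs : ∀ s : ℝ, s ≠ 0 →
      HasSum (fun n : ℕ => 1 / ((2 * n + 1).factorial : ℝ) * (s ^ 2) ^ n) (Real.sinh s / s) := by
    intro s hs
    refine ((Real.hasSum_sinh s).div_const s).congr_fun fun n => ?_
    rw [← pow_mul, pow_succ]; field_simp
  have hCs : ∀ s : ℝ,
      HasSum (fun n : ℕ => 1 / ((2 * n).factorial : ℝ) * (s ^ 2) ^ n) (Real.cosh s) := by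
    intro s
    refine (Real.hasSum_cosh s).congr_fun fun n => ?_
    rw [← pow_mul]; ring
  have hSd : ContDiff ℝ ∞ S := by
    refine contDiff_iff_contDiffAt.2 fun w => ?_
    refine (contDiffOn_tsum_mul_pow (R := |w| + 1) (by positivity) fun x hx _ => ?_).contDiffAt
      (Metric.isOpen_ball.mem_nhds (by simp))
    have := (hSs (√x) (Real.sqrt_pos.2 hx).ne').summable
    rw [Real.sq_sqrt hx.le] at this
    refine this.congr fun n => ?_
    rw [abs_of_nonneg (by positivity)]
  have hCd : ContDiff ℝ ∞ C := by
    refine contDiff_iff_contDiffAt.2 fun w => ?_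
    refine (contDiffOn_tsum_mul_pow (R := |w| + 1) (by positivity) fun x hx _ => ?_).contDiffAt
      (Metric.isOpen_ball.mem_nhds (by simp))
    have := (hCs (√x)).summable
    rw [Real.sq_sqrt hx.le] at this
    refine this.congr fun n => ?_
    rw [abs_of_nonneg (by positivity)]
  have hn : ContDiff ℝ ∞ fun v : Plane => ‖v‖ ^ 2 := contDiff_norm_sq ℝ
  have hCc : ∀ v : Plane, C (‖v‖ ^ 2) = Real.cosh ‖v‖ := fun v => (hCs _).tsum_eq
  have he : discExp = fun v : Plane => (S (‖v‖ ^ 2) / (1 + C (‖v‖ ^ 2))) • v := by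
    funext v
    rcases eq_or_ne v 0 with rfl | hv
    · simp [discExp]
    have h0 : ‖v‖ ≠ 0 := norm_ne_zero_iff.2 hv
    have h1 : S (‖v‖ ^ 2) = Real.sinh ‖v‖ / ‖v‖ := (hSs _ h0).tsum_eq
    rw [discExp, tanh_half_eq, h1, hCc, div_right_comm]
  rw [he]
  refine ContDiff.smul (ContDiff.div (hSd.comp hn) (contDiff_const.add (hCd.comp hn))
    fun v => ?_) contDiff_id
  have := Real.cosh_pos ‖v‖
  simp only [Function.comp_apply, hCc]
  positivity

/-- `discLog` is smooth at the origin too, because `artanh s / s` is a power series in `s ^ 2`. -/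
lemma contDiffOn_discLog : ContDiffOn ℝ ∞ discLog (Metric.ball 0 1) := by
  set T : ℝ → ℝ := fun w => ∑' n : ℕ, 2 / (2 * n + 1 : ℝ) * w ^ n with hT
  have hTs : ∀ s : ℝ, 0 < s → s < 1 →
      HasSum (fun n : ℕ => 2 / (2 * n + 1 : ℝ) * (s ^ 2) ^ n) (2 * Real.artanh s / s) := by
    intro s hs hs1
    have h := (Real.hasSum_log_sub_log_of_abs_lt_one (x := s) (by rwa [abs_of_pos hs])).div_const s
    have e : Real.log (1 + s) - Real.log (1 - s) = 2 * Real.artanh s := by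
      rw [Real.artanh_eq_half_log ⟨by linarith, hs1.le⟩,
        Real.log_div (by linarith) (by linarith)]
      ring
    rw [e] at h
    refine h.congr_fun fun n => ?_
    rw [← pow_mul, pow_succ]; field_simp
  have hTd : ContDiffOn ℝ ∞ T (Metric.ball 0 1) := by
    refine contDiffOn_tsum_mul_pow one_pos fun x hx hx1 => ?_
    have := (hTs (√x) (Real.sqrt_pos.2 hx)
      (by rw [Real.sqrt_lt' one_pos]; simpa using hx1)).summable
    rw [Real.sq_sqrt hx.le] at this
    refine this.congr fun n => ?_
    rw [abs_of_nonneg (by positivity)]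
  have hn : ContDiff ℝ ∞ fun v : Plane => ‖v‖ ^ 2 := contDiff_norm_sq ℝ
  have h : ContDiffOn ℝ ∞ (fun w : Plane => T (‖w‖ ^ 2) • w) (Metric.ball 0 1) := by
    refine ContDiffOn.smul (hTd.comp hn.contDiffOn fun w hw => ?_) contDiffOn_id
    rw [mem_ball_zero_iff] at hw ⊢
    rw [Real.norm_of_nonneg (by positivity)]
    exact pow_lt_one₀ (norm_nonneg _) hw two_ne_zero
  refine h.congr fun w hw => ?_
  rw [mem_ball_zero_iff] at hw
  rcases eq_or_ne w 0 with rfl | hw0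
  · simp [discLog]
  · rw [discLog, ← (hTs ‖w‖ (norm_pos_iff.2 hw0) hw).tsum_eq]

/-- The diffeomorphism from the ball of radius `r` onto the disc of radius `tanh (r / 2)` given by
the exponential map of the hyperbolic disc. -/
def discExpHomeomorph (r : ℝ) : OpenPartialHomeomorph Plane Plane where
  toFun := discExp
  invFun := discLog
  source := Metric.ball 0 r
  target := Metric.ball 0 (Real.tanh (r / 2))
  map_source' v hv := by
    rw [mem_ball_zero_iff] at hv ⊢
    rw [norm_discExp]
    exact tanh_strictMono (by linarith)
  map_target' w hw := by
    rw [mem_ball_zero_iff] at hw ⊢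
    rw [norm_discLog]
    have h1 := (tanh_mem_Ioo (r / 2))
    have := Real.artanh_lt_artanh (by linarith [norm_nonneg w]) h1.2 hw
    rw [Real.artanh_tanh] at this
    linarith
  left_inv' v _ := discLog_discExp v
  right_inv' w hw := discExp_discLog ((mem_ball_zero_iff.1 hw).trans (tanh_mem_Ioo (r / 2)).2)
  open_source := Metric.isOpen_ball
  open_target := Metric.isOpen_ball
  continuousOn_toFun := contDiff_discExp.continuous.continuousOn
  continuousOn_invFun := contDiffOn_discLog.continuousOn.mono
    (Metric.ball_subset_ball (tanh_mem_Ioo (r / 2)).2.le)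

end DiscExp

/-! ### The stereographic projection of the hyperboloid -/

namespace Coord

namespace IsHyperboloidMap

variable {G : Plane → Matrix (Fin 2) (Fin 2) ℝ} {U : Set Plane} {P : Matrix (Fin 2) (Fin 2) ℝ}
  {f : Fin 3 → Plane → ℝ} {y : Plane}

/-- The stereographic projection of the hyperboloid to the disc, composed with the immersion `f`. -/
def discMap (f : Fin 3 → Plane → ℝ) (y : Plane) : Plane :=
  WithLp.toLp 2 fun a : Fin 2 => f a.succ y / (1 + f 0 y)

lemma discMap_apply (f : Fin 3 → Plane → ℝ) (y : Plane) (a : Fin 2) :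
    discMap f y a = f a.succ y / (1 + f 0 y) := rfl

lemma differentiableAt (h : IsHyperboloidMap G U P f) (hU : IsOpen U) (hy : y ∈ U) (a : Fin 3) :
    DifferentiableAt ℝ (f a) y :=
  ((h.contDiffOn a).contDiffAt (hU.mem_nhds hy)).differentiableAt (by simp)

lemma contDiffOn_discMap (h : IsHyperboloidMap G U P f) {V : Set Plane} (hV : V ⊆ U)
    (hf : ∀ y ∈ V, 0 < 1 + f 0 y) : ContDiffOn ℝ ∞ (discMap f) V := by
  rw [contDiffOn_euclidean]
  exact fun a => ((h.contDiffOn a.succ).mono hV).div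
    (contDiffOn_const.add ((h.contDiffOn 0).mono hV)) fun y hy => (hf y hy).ne'

lemma one_sub_norm_discMap_sq (h : IsHyperboloidMap G U P f) (hy : y ∈ U) (hf : 0 < 1 + f 0 y) :
    1 - ‖discMap f y‖ ^ 2 = 2 / (1 + f 0 y) := by
  have hs := h.sq y hy
  simp only [EuclideanSpace.norm_sq_eq, discMap_apply, Fin.sum_univ_two, Real.norm_eq_abs,
    sq_abs, div_pow] at hs ⊢
  field_simp
  linear_combination -hs

lemma sum_mul_fderiv (h : IsHyperboloidMap G U P f) (hU : IsOpen U) (hy : y ∈ U) (v : Plane) :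
    -f 0 y * fderiv ℝ (f 0) y v + ∑ a : Fin 2, f a.succ y * fderiv ℝ (f a.succ) y v = 0 := by
  have d := fun a => (h.differentiableAt hU hy a).hasFDerivAt
  have h1 := ((d 0).fun_neg.fun_mul (d 0)).fun_add
    (HasFDerivAt.fun_sum fun (a : Fin 2) (_ : a ∈ Finset.univ) => (d a.succ).fun_mul (d a.succ))
  have h2 : HasFDerivAt (fun _ : Plane => (-1 : ℝ)) (0 : Plane →L[ℝ] ℝ) y := hasFDerivAt_const _ _
  have h3 : (fun z => -f 0 z * f 0 z + ∑ a : Fin 2, f a.succ z * f a.succ z) =ᶠ[𝓝 y]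
      fun _ => (-1 : ℝ) := by
    filter_upwards [hU.mem_nhds hy] with z hz using h.sq z hz
  have h4 := congrArg (fun T : Plane →L[ℝ] ℝ => T v)
    ((h2.congr_of_eventuallyEq h3).unique h1)
  simp only [Fin.sum_univ_two, add_apply, smul_apply, neg_apply, smul_eq_mul, zero_apply] at h4 ⊢
  linarith

/-- The immersion `f` is isometric. -/
lemma sum_fderiv_mul_fderiv (h : IsHyperboloidMap G U P f) (hy : y ∈ U) (v w : Plane) :
    -fderiv ℝ (f 0) y v * fderiv ℝ (f 0) y w
      + ∑ a : Fin 2, fderiv ℝ (f a.succ) y v * fderiv ℝ (f a.succ) y w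
      = ∑ i, ∑ j, v i * w j * G y i j := by
  simp only [fderiv_eq_sum_partialDeriv, ← h.deriv y hy, Fin.sum_univ_two]
  ring

/-- The stereographic projection of the hyperboloid carries `g` to the Poincaré metric. -/
lemma inner_fderiv_discMap (h : IsHyperboloidMap G U P f) (hU : IsOpen U) (hy : y ∈ U)
    (hf : 0 < 1 + f 0 y) (v w : Plane) :
    4 / (1 - ‖discMap f y‖ ^ 2) ^ 2 *
      inner ℝ (fderiv ℝ (discMap f) y v) (fderiv ℝ (discMap f) y w)
      = ∑ i, ∑ j, v i * w j * G y i j := by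
  have d := fun a => (h.differentiableAt hU hy a).hasFDerivAt
  have hd : ∀ a : Fin 2, HasFDerivAt (fun z => f a.succ z / (1 + f 0 z))
      (((1 + f 0 y) ^ 2)⁻¹ • ((1 + f 0 y) • fderiv ℝ (f a.succ) y
        - f a.succ y • fderiv ℝ (f 0) y)) y := fun a => by
    have := (d a.succ).fun_mul ((hasDerivAt_inv hf.ne').comp_hasFDerivAt y ((d 0).const_add 1))
    simp only [Function.comp_apply, ← div_eq_mul_inv] at this
    refine this.congr_fderiv ?_
    ext u
    simp only [add_apply, sub_apply, smul_apply, smul_eq_mul]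
    field_simp
    ring
  have hD : HasFDerivAt (discMap f) (fderiv ℝ (discMap f) y) y := by
    have : DifferentiableAt ℝ (discMap f) y := by
      rw [differentiableAt_euclidean]
      exact fun a => (hd a).differentiableAt
    exact this.hasFDerivAt
  have hDa : ∀ (a : Fin 2) (u : Plane), fderiv ℝ (discMap f) y u a
      = ((1 + f 0 y) ^ 2)⁻¹ * ((1 + f 0 y) * fderiv ℝ (f a.succ) y u
        - f a.succ y * fderiv ℝ (f 0) y u) := fun a u => by
    have := congrArg (fun T : Plane →L[ℝ] ℝ => T u)
      (((EuclideanSpace.proj a : Plane →L[ℝ] ℝ).hasFDerivAt.comp y hD).unique (hd a))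
    simpa using this
  rw [← h.sum_fderiv_mul_fderiv hy, h.one_sub_norm_discMap_sq hy hf, PiLp.inner_apply]
  have hs := h.sq y hy
  have hv := h.sum_mul_fderiv hU hy v
  have hw := h.sum_mul_fderiv hU hy w
  simp only [Fin.sum_univ_two, hDa, RCLike.inner_apply, conj_trivial] at hs hv hw ⊢
  generalize f 0 y = F at *
  generalize f (Fin.succ 0) y = F1 at *
  generalize f (Fin.succ 1) y = F2 at *
  generalize fderiv ℝ (f 0) y v = A0 at *
  generalize fderiv ℝ (f 0) y w = B0 at *
  generalize fderiv ℝ (f (Fin.succ 0)) y v = A1 at *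
  generalize fderiv ℝ (f (Fin.succ 0)) y w = B1 at *
  generalize fderiv ℝ (f (Fin.succ 1)) y v = A2 at *
  generalize fderiv ℝ (f (Fin.succ 1)) y w = B2 at *
  field_simp
  linear_combination (4 * A0 * B0) * hs - 4 * (1 + F) * B0 * hv - 4 * (1 + F) * A0 * hw

/-- If the rays from the origin are geodesics, the immersion `f` is given along them by
hyperbolic functions, as `f'' = |y|² f` along the ray `t ↦ t y`. -/
lemma apply_of_geodesic (h : IsHyperboloidMap G U P f) (hG : IsMetricOn G U)
    (hP : P.transpose * P = G 0)
    (hray : ∀ t ∈ Icc (0 : ℝ) 1, t • y ∈ U)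
    (hgeo : ∀ t ∈ Icc (0 : ℝ) 1, ∀ k, ∑ i, ∑ j, christoffel G k i j (t • y) * y i * y j = 0)
    {s : ℝ} (hs : s ^ 2 = ∑ a, (P.mulVec y a) ^ 2) (a : Fin 3) :
    s * f a y = (∑ i, y i * partialDeriv i (f a) 0) * Real.sinh s + s * f a 0 * Real.cosh s := by
  have hline : ∀ t : ℝ, HasDerivAt (fun τ : ℝ => τ • y) y t := fun t => by
    simpa using (hasDerivAt_id t).smul_const y
  -- the speed of the ray is constant
  have hspeed : ∀ t ∈ Icc (0 : ℝ) 1, ∑ i, ∑ j, G (t • y) i j * y i * y j = s ^ 2 := by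
    have hd : ∀ t ∈ Icc (0 : ℝ) 1,
        HasDerivAt (fun τ : ℝ => ∑ i, ∑ j, G (τ • y) i j * y i * y j) 0 t := fun t ht => by
      have hyt := hray t ht
      have h1 : ∀ i j, HasDerivAt (fun τ : ℝ => G (τ • y) i j)
          (∑ l, y l * partialDeriv l (fun z => G z i j) (t • y)) t := fun i j => by
        rw [← fderiv_eq_sum_partialDeriv]
        exact (hG.differentiableAt hyt i j).hasFDerivAt.comp_hasDerivAt t (hline t)
      have h2 := HasDerivAt.fun_sum fun (i : Fin 2) (_ : i ∈ Finset.univ) =>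
        HasDerivAt.fun_sum fun (j : Fin 2) (_ : j ∈ Finset.univ) =>
          ((h1 i j).mul_const (y i)).mul_const (y j)
      refine h2.congr_deriv ?_
      have g0 := hgeo t ht 0
      have g1 := hgeo t ht 1
      have sy := hG.symm hyt 1 0
      simp only [Fin.sum_univ_two, hG.partialDeriv_eq hyt, sy] at g0 g1 ⊢
      linear_combination (2 * (G (t • y) 0 0 * y 0 + G (t • y) 0 1 * y 1)) * g0
        + (2 * (G (t • y) 0 1 * y 0 + G (t • y) 1 1 * y 1)) * g1
    intro t ht
    have h3 := (convex_Icc (0 : ℝ) 1).is_const_of_fderivWithin_eq_zero (𝕜 := ℝ)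
      (f := fun τ : ℝ => ∑ i, ∑ j, G (τ • y) i j * y i * y j)
      (fun τ hτ => (hd τ hτ).differentiableAt.differentiableWithinAt)
      (fun τ hτ => by
        have := (hd τ hτ).hasFDerivAt.hasFDerivWithinAt (s := Icc 0 1)
        rw [this.fderivWithin (uniqueDiffOn_Icc zero_lt_one τ hτ)]
        ext; simp) ht (left_mem_Icc.2 zero_le_one)
    refine h3.trans ?_
    rw [hs]
    simp only [zero_smul, ← hP, Matrix.mul_apply, Matrix.mulVec, dotProduct, Fin.sum_univ_two,
      Matrix.transpose_apply]
    ring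
  set φ : ℝ → ℝ := fun t => f a (t • y) with hφ
  set q : ℝ → ℝ := fun t => ∑ i, y i * partialDeriv i (f a) (t • y) with hq
  have hφd : ∀ t ∈ Icc (0 : ℝ) 1, HasDerivAt φ (q t) t := fun t ht => by
    have := (h.differentiableAt hG.isOpen (hray t ht) a).hasFDerivAt.comp_hasDerivAt t (hline t)
    rwa [fderiv_eq_sum_partialDeriv] at this
  have hqd : ∀ t ∈ Icc (0 : ℝ) 1, HasDerivAt q (s ^ 2 * φ t) t := fun t ht => by
    have hyt := hray t ht
    have h1 : ∀ i, HasDerivAt (fun τ : ℝ => partialDeriv i (f a) (τ • y))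
        (∑ l, y l * partialDeriv l (partialDeriv i (f a)) (t • y)) t := fun i => by
      rw [← fderiv_eq_sum_partialDeriv]
      have hd : DifferentiableAt ℝ (partialDeriv i (f a)) (t • y) :=
        ((contDiffOn_partialDeriv hG.isOpen (h.contDiffOn a) i).contDiffAt
          (hG.isOpen.mem_nhds hyt)).differentiableAt (by simp)
      exact hd.hasFDerivAt.comp_hasDerivAt t (hline t)
    have h2 := HasDerivAt.fun_sum fun (i : Fin 2) (_ : i ∈ Finset.univ) => (h1 i).const_mul (y i)
    refine h2.congr_deriv ?_
    rw [← hspeed t ht]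
    have g0 := hgeo t ht 0
    have g1 := hgeo t ht 1
    simp only [h.hess _ hyt, Fin.sum_univ_two, hφ] at g0 g1 ⊢
    have sy := hG.symm hyt 1 0
    have c0 := hG.christoffel_symm hyt 0 1 0
    have c1 := hG.christoffel_symm hyt 1 1 0
    simp only [sy, c0, c1] at g0 g1 ⊢
    linear_combination (partialDeriv 0 (f a) (t • y)) * g0 + (partialDeriv 1 (f a) (t • y)) * g1
  -- `(q + c φ) e^{-c t}` is constant for both square roots `c` of `s ^ 2`, as `φ'' = s ^ 2 φ`
  have hfun : ∀ c : ℝ, c ^ 2 = s ^ 2 →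
      (q 1 + c * φ 1) * Real.exp (-c) = q 0 + c * φ 0 := fun c hc => by
    have hd : ∀ t ∈ Icc (0 : ℝ) 1,
        HasDerivAt (fun τ => (q τ + c * φ τ) * Real.exp (-c * τ)) 0 t := fun t ht => by
      have h1 : HasDerivAt (fun τ : ℝ => Real.exp (-c * τ)) (Real.exp (-c * t) * (-c * 1)) t :=
        ((hasDerivAt_id t).const_mul (-c)).exp
      have := ((hqd t ht).fun_add ((hφd t ht).const_mul c)).fun_mul h1
      refine this.congr_deriv ?_
      rw [← hc]; ring
    have h3 := (convex_Icc (0 : ℝ) 1).is_const_of_fderivWithin_eq_zero (𝕜 := ℝ)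
      (f := fun τ => (q τ + c * φ τ) * Real.exp (-c * τ))
      (fun τ hτ => (hd τ hτ).differentiableAt.differentiableWithinAt)
      (fun τ hτ => by
        have := (hd τ hτ).hasFDerivAt.hasFDerivWithinAt (s := Icc 0 1)
        rw [this.fderivWithin (uniqueDiffOn_Icc zero_lt_one τ hτ)]
        ext; simp) (right_mem_Icc.2 zero_le_one) (left_mem_Icc.2 zero_le_one)
    simpa using h3
  have e1 := hfun s rfl
  have e2 := hfun (-s) (by ring)
  have hx : Real.exp s * Real.exp (-s) = 1 := by rw [← Real.exp_add]; simp
  have e1' : q 1 + s * φ 1 = (q 0 + s * φ 0) * Real.exp s := by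
    rw [← e1]; linear_combination -(q 1 + s * φ 1) * hx
  have e2' : q 1 + -s * φ 1 = (q 0 + -s * φ 0) * Real.exp (-s) := by
    rw [← e2, neg_neg]; linear_combination -(q 1 + -s * φ 1) * hx
  have h0 : φ 0 = f a 0 := by simp [hφ]
  have h1 : φ 1 = f a y := by simp [hφ]
  have hq0 : q 0 = ∑ i, y i * partialDeriv i (f a) 0 := by simp [hq]
  rw [← h0, ← h1, ← hq0, Real.sinh_eq, Real.cosh_eq]
  linear_combination (e1' - e2') / 2

end IsHyperboloidMap

end Coord

/-! ### The metric of a surface in a chart -/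

namespace SurfaceMetric

variable {M : Type*} [TopologicalSpace M] [ChartedSpace Plane M]
  {e e' : OpenPartialHomeomorph M Plane}

lemma mdifferentiableAt_chart (he : e ∈ IsManifold.maximalAtlas 𝓘(ℝ, Plane) ∞ M) {x : M}
    (hx : x ∈ e.source) : MDifferentiableAt 𝓘(ℝ, Plane) 𝓘(ℝ, Plane) e x :=
  (contMDiffAt_of_mem_maximalAtlas he hx).mdifferentiableAt (by simp)

lemma mdifferentiableAt_chart_symm (he : e ∈ IsManifold.maximalAtlas 𝓘(ℝ, Plane) ∞ M) {y : Plane}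
    (hy : y ∈ e.target) : MDifferentiableAt 𝓘(ℝ, Plane) 𝓘(ℝ, Plane) e.symm y :=
  (contMDiffAt_symm_of_mem_maximalAtlas he hy).mdifferentiableAt (by simp)

lemma mfderiv_chart_comp_symm (he : e ∈ IsManifold.maximalAtlas 𝓘(ℝ, Plane) ∞ M) {y : Plane}
    (hy : y ∈ e.target) (v : Plane) : mfderiv 𝓘(ℝ, Plane) 𝓘(ℝ, Plane) e (e.symm y)
      (mfderiv 𝓘(ℝ, Plane) 𝓘(ℝ, Plane) e.symm y v) = v := by
  have h1 := mfderiv_comp y (mdifferentiableAt_chart he (e.map_target hy))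
    (mdifferentiableAt_chart_symm he hy)
  have h2 : e ∘ e.symm =ᶠ[𝓝 y] id := by
    filter_upwards [e.open_target.mem_nhds hy] with z hz using e.right_inv hz
  rw [h2.mfderiv_eq, mfderiv_id] at h1
  exact (congrArg (fun T : Plane →L[ℝ] Plane => T v) h1).symm

variable [IsManifold 𝓘(ℝ, Plane) ∞ M] {g : SurfaceMetric M}

/-- The metric `g` in the chart `e`, as a bilinear form on the plane. -/
def coordForm (g : SurfaceMetric M) (e : OpenPartialHomeomorph M Plane) (y v w : Plane) : ℝ :=
  g.inner (e.symm y) (mfderiv 𝓘(ℝ, Plane) 𝓘(ℝ, Plane) e.symm y v)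
    (mfderiv 𝓘(ℝ, Plane) 𝓘(ℝ, Plane) e.symm y w)

lemma coordMatrix_apply (y : Plane) (i j : Fin 2) :
    g.coordMatrix e y i j = g.coordForm e y (Coord.basisVec i) (Coord.basisVec j) := rfl

lemma eq_basisVec_sum (v : Plane) : v = v 0 • Coord.basisVec 0 + v 1 • Coord.basisVec 1 := by
  ext k; fin_cases k <;> simp [Coord.basisVec]

lemma coordForm_add_left (y u v w : Plane) :
    g.coordForm e y (u + v) w = g.coordForm e y u w + g.coordForm e y v w := by
  simp only [coordForm]
  erw [map_add, map_add]; rfl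

lemma coordForm_smul_left (c : ℝ) (y v w : Plane) :
    g.coordForm e y (c • v) w = c * g.coordForm e y v w := by
  simp only [coordForm]
  erw [map_smul, map_smul]; rfl

lemma coordForm_symm (y v w : Plane) : g.coordForm e y v w = g.coordForm e y w v :=
  g.symm _ _ _

lemma coordForm_eq_sum (y v w : Plane) :
    g.coordForm e y v w = ∑ i, ∑ j, v i * w j * g.coordMatrix e y i j := by
  have hl : ∀ u, g.coordForm e y v u = v 0 * g.coordForm e y (Coord.basisVec 0) u
      + v 1 * g.coordForm e y (Coord.basisVec 1) u := fun u => by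
    conv_lhs => rw [eq_basisVec_sum v]
    rw [coordForm_add_left, coordForm_smul_left, coordForm_smul_left]
  have hr : ∀ u, g.coordForm e y u w = w 0 * g.coordForm e y u (Coord.basisVec 0)
      + w 1 * g.coordForm e y u (Coord.basisVec 1) := fun u => by
    rw [coordForm_symm]
    conv_lhs => rw [eq_basisVec_sum w]
    rw [coordForm_add_left, coordForm_smul_left, coordForm_smul_left, coordForm_symm _ _ u,
      coordForm_symm _ _ u]
  simp only [Fin.sum_univ_two, coordMatrix_apply]
  rw [hl, hr, hr]
  ring

lemma coordForm_self_pos (he : e ∈ IsManifold.maximalAtlas 𝓘(ℝ, Plane) ∞ M) {y : Plane}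
    (hy : y ∈ e.target) {v : Plane} (hv : v ≠ 0) : 0 < g.coordForm e y v v := by
  refine g.pos _ _ fun h => hv ?_
  have := mfderiv_chart_comp_symm he hy v
  rw [h] at this
  rw [← this]
  exact map_zero _

lemma contDiffOn_coordForm (he : e ∈ IsManifold.maximalAtlas 𝓘(ℝ, Plane) ∞ M) (v w : Plane) :
    ContDiffOn ℝ ∞ (fun y => g.coordForm e y v w) e.target := by
  rw [← contMDiffOn_iff_contDiffOn]
  have hs := contMDiffOn_symm_of_mem_maximalAtlas he
  have hV : ∀ u : Plane, ContMDiffOn 𝓘(ℝ, Plane) (𝓘(ℝ, Plane).prod 𝓘(ℝ, Plane)) ∞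
      (fun y : Plane => (Bundle.TotalSpace.mk' Plane (e.symm y)
        (mfderiv 𝓘(ℝ, Plane) 𝓘(ℝ, Plane) e.symm y u) :
          Bundle.TotalSpace Plane (TangentSpace 𝓘(ℝ, Plane) (M := M)))) e.target := by
    intro u
    have h1 := hs.contMDiffOn_tangentMapWithin (m := ∞) (by simp) e.open_target.uniqueMDiffOn
    have h2 : ContMDiffOn 𝓘(ℝ, Plane) (𝓘(ℝ, Plane).prod 𝓘(ℝ, Plane)) ∞
        (fun y : Plane => (⟨y, u⟩ : TangentBundle 𝓘(ℝ, Plane) Plane)) e.target := by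
      intro y _
      rw [Bundle.contMDiffWithinAt_totalSpace]
      refine ⟨contMDiffWithinAt_id, ?_⟩
      simp
      exact contMDiffWithinAt_const
    refine (h1.comp h2 fun y hy => hy).congr fun y hy => ?_
    simp only [Function.comp_apply, tangentMapWithin]
    rw [mfderivWithin_of_isOpen e.open_target hy]
  have h3 : ContMDiffOn 𝓘(ℝ, Plane) (𝓘(ℝ, Plane).prod 𝓘(ℝ, ℝ)) ∞
      (fun y => Bundle.TotalSpace.mk' ℝ (E := Bundle.Trivial M ℝ) (e.symm y)
        (g.coordForm e y v w)) e.target :=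
    ContMDiffOn.clm_bundle_apply₂ (F₁ := Plane) (F₂ := Plane)
      (g.contMDiff.comp_contMDiffOn hs) (hV v) (hV w)
  intro y hy
  have := h3 y hy
  simp only [Bundle.contMDiffWithinAt_totalSpace] at this
  exact this.2

/-- The matrix of a metric in a smooth chart is that of a metric of the coordinate domain. -/
lemma isMetricOn_coordMatrix (g : SurfaceMetric M)
    (he : e ∈ IsManifold.maximalAtlas 𝓘(ℝ, Plane) ∞ M) :
    Coord.IsMetricOn (g.coordMatrix e) e.target := by
  refine ⟨e.open_target, fun i j => contDiffOn_coordForm he _ _, fun y hy => ?_⟩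
  refine Matrix.PosDef.of_dotProduct_mulVec_pos ?_ fun x hx => ?_
  · ext i j
    simp [coordMatrix_apply, coordForm_symm]
  · have h := coordForm_self_pos (g := g) he hy (v := WithLp.toLp 2 x) (by simpa using hx)
    rw [coordForm_eq_sum] at h
    simp only [Fin.sum_univ_two, dotProduct, Matrix.mulVec, Pi.star_apply, star_trivial] at h ⊢
    linarith

/-- The transformation of the components of a metric under a change of charts. -/
lemma coordForm_trans (he : e ∈ IsManifold.maximalAtlas 𝓘(ℝ, Plane) ∞ M)
    (he' : e' ∈ IsManifold.maximalAtlas 𝓘(ℝ, Plane) ∞ M) {y : Plane} (hy : y ∈ e'.target)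
    (hy' : e'.symm y ∈ e.source) (v w : Plane) :
    g.coordForm e' y v w = g.coordForm e (e (e'.symm y)) (fderiv ℝ (e ∘ e'.symm) y v)
      (fderiv ℝ (e ∘ e'.symm) y w) := by
  have h1 : MDifferentiableAt 𝓘(ℝ, Plane) 𝓘(ℝ, Plane) (e ∘ e'.symm) y :=
    (mdifferentiableAt_chart he hy').comp y (mdifferentiableAt_chart_symm he' hy)
  have h2 := mfderiv_comp y (mdifferentiableAt_chart_symm he (e.map_source hy')) h1
  have h3 : e.symm ∘ (e ∘ e'.symm) =ᶠ[𝓝 y] e'.symm := by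
    filter_upwards [e'.symm.continuousAt hy |>.preimage_mem_nhds (e.open_source.mem_nhds hy')]
      with z hz using e.left_inv hz
  rw [h3.mfderiv_eq] at h2
  have h4 : ∀ (p q : M) (_ : p = q) (a b : Plane),
      g.inner p (show TangentSpace 𝓘(ℝ, Plane) p from a) (show TangentSpace 𝓘(ℝ, Plane) p from b)
      = g.inner q (show TangentSpace 𝓘(ℝ, Plane) q from a)
        (show TangentSpace 𝓘(ℝ, Plane) q from b) := by
    rintro p _ rfl a b; rfl
  simp only [coordForm, h2, mfderiv_eq_fderiv]
  exact h4 _ _ (e.left_inv hy').symm _ _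

end SurfaceMetric

/-! ### Poincaré charts -/

section LinearAlgebra

/-- A positive definite form of the plane is the pull-back of the Euclidean one by a linear
automorphism, given by the Cholesky decomposition. -/
lemma exists_continuousLinearEquiv_inner {G : Matrix (Fin 2) (Fin 2) ℝ} (hG : G.PosDef) :
    ∃ A : Plane ≃L[ℝ] Plane, ∀ v w, inner ℝ (A v) (A w) = ∑ i, ∑ j, v i * w j * G i j := by
  have s : G 1 0 = G 0 1 := by simpa using hG.isHermitian.apply 0 1
  have hdet : 0 < G.det := hG.det_pos
  have h00 : 0 < G 0 0 := hG.diag_pos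
  rw [Matrix.det_fin_two, s] at hdet
  set a := √(G 0 0) with ha
  set d := √((G 0 0 * G 1 1 - G 0 1 * G 0 1) / G 0 0) with hd
  have ha2 : a ^ 2 = G 0 0 := Real.sq_sqrt h00.le
  have ha0 : 0 < a := Real.sqrt_pos.2 h00
  have hd2 : d ^ 2 * G 0 0 = G 0 0 * G 1 1 - G 0 1 * G 0 1 := by
    rw [hd, Real.sq_sqrt (by positivity)]; field_simp
  let L : Plane →ₗ[ℝ] Plane :=
    { toFun := fun v => !₂[a * v 0 + G 0 1 / a * v 1, d * v 1]
      map_add' := fun v w => by ext i; fin_cases i <;> simp <;> ring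
      map_smul' := fun c v => by ext i; fin_cases i <;> simp <;> ring }
  have hL : ∀ v w, inner ℝ (L v) (L w) = ∑ i, ∑ j, v i * w j * G i j := fun v w => by
    have hd3 : d ^ 2 + (G 0 1 / a) ^ 2 = G 1 1 := by
      rw [div_pow, ha2]; field_simp; linarith
    have ha3 : a * (G 0 1 / a) = G 0 1 := by field_simp
    simp [L, PiLp.inner_apply, Fin.sum_univ_two, s]
    linear_combination (v 0 * w 0) * ha2 + (v 1 * w 1) * hd3 + (v 0 * w 1 + v 1 * w 0) * ha3
  have hinj : Function.Injective L := by
    rw [injective_iff_map_eq_zero]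
    intro v hv
    by_contra hv0
    have h1 := hL v v
    rw [hv, inner_zero_left] at h1
    have h2 := hG.dotProduct_mulVec_pos (x := v.ofLp) (by simpa using hv0)
    simp only [Fin.sum_univ_two, dotProduct, Matrix.mulVec, Pi.star_apply, star_trivial] at h1 h2
    linarith
  refine ⟨(LinearEquiv.ofInjectiveEndo L hinj).toContinuousLinearEquiv, fun v w => hL v w⟩

lemma exists_continuousLinearEquiv_eq {T : Plane →L[ℝ] Plane} (hT : Function.Injective T) :
    ∃ L : Plane ≃L[ℝ] Plane, (L : Plane →L[ℝ] Plane) = T :=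
  ⟨(LinearEquiv.ofInjectiveEndo T.toLinearMap hT).toContinuousLinearEquiv, by ext v; rfl⟩

/-- An injective local homeomorphism of the plane which is smooth with injective differentials has a
smooth inverse. -/
lemma OpenPartialHomeomorph.contDiffOn_symm_of_injective (φ : OpenPartialHomeomorph Plane Plane)
    (hφ : ContDiffOn ℝ ∞ φ φ.source)
    (hinj : ∀ y ∈ φ.source, Function.Injective (fderiv ℝ φ y)) :
    ContDiffOn ℝ ∞ φ.symm φ.target := by
  intro y hy
  have hs := φ.map_target hy
  have hc := hφ.contDiffAt (φ.open_source.mem_nhds hs)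
  obtain ⟨L, hL⟩ := exists_continuousLinearEquiv_eq (hinj _ hs)
  have h := (hc.differentiableAt (by simp)).hasFDerivAt
  rw [← hL] at h
  exact (φ.contDiffAt_symm hy h hc).contDiffWithinAt

end LinearAlgebra

namespace Coord.IsHyperboloidMap

variable {G : Plane → Matrix (Fin 2) (Fin 2) ℝ} {U : Set Plane} {f : Fin 3 → Plane → ℝ}

/-- The matrix of a linear map of the plane. -/
def matrixOf (A : Plane ≃L[ℝ] Plane) : Matrix (Fin 2) (Fin 2) ℝ :=
  Matrix.of fun a i => A (basisVec i) a

lemma mulVec_matrixOf (A : Plane ≃L[ℝ] Plane) (v : Plane) (a : Fin 2) :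
    (matrixOf A).mulVec v a = A v a := by
  conv_rhs => rw [SurfaceMetric.eq_basisVec_sum v, map_add, map_smul, map_smul]
  simp [matrixOf, Matrix.mulVec, dotProduct, Fin.sum_univ_two]
  ring

lemma transpose_matrixOf_mul {A : Plane ≃L[ℝ] Plane} {G₀ : Matrix (Fin 2) (Fin 2) ℝ}
    (hA : ∀ v w, inner ℝ (A v) (A w) = ∑ i, ∑ j, v i * w j * G₀ i j) :
    (matrixOf A).transpose * matrixOf A = G₀ := by
  ext i j
  have h := hA (basisVec i) (basisVec j)
  simp only [PiLp.inner_apply, RCLike.inner_apply, conj_trivial] at h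
  rw [Matrix.mul_apply]
  simp only [matrixOf, Matrix.transpose_apply, Matrix.of_apply]
  refine Eq.trans ?_ (h.trans ?_)
  · exact Finset.sum_congr rfl fun _ _ => mul_comm _ _
  · simp [basisVec]

/-- When the rays from the origin are geodesics, the disc map is the exponential map. -/
lemma discMap_eq_discExp {A : Plane ≃L[ℝ] Plane} (h : IsHyperboloidMap G U (matrixOf A) f)
    (hG : IsMetricOn G U)
    (hA : ∀ v w, inner ℝ (A v) (A w) = ∑ i, ∑ j, v i * w j * G 0 i j) {y : Plane}
    (hray : ∀ t ∈ Icc (0 : ℝ) 1, t • y ∈ U)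
    (hgeo : ∀ t ∈ Icc (0 : ℝ) 1, ∀ k, ∑ i, ∑ j, christoffel G k i j (t • y) * y i * y j = 0) :
    0 < 1 + f 0 y ∧ discMap f y = discExp (A y) := by
  rcases eq_or_ne y 0 with rfl | hy
  · refine ⟨by rw [h.apply_zero_zero]; norm_num, ?_⟩
    ext a
    simp [discMap_apply, h.apply_succ_zero, discExp]
  have hs0 : 0 < ‖A y‖ := norm_pos_iff.2 (by simpa using hy)
  have hs2 : ‖A y‖ ^ 2 = ∑ a, ((matrixOf A).mulVec y a) ^ 2 := by
    simp only [mulVec_matrixOf, EuclideanSpace.norm_sq_eq, Real.norm_eq_abs, sq_abs]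
  have key := h.apply_of_geodesic hG (transpose_matrixOf_mul hA) hray hgeo hs2
  have h0 : f 0 y = Real.cosh ‖A y‖ := by
    have := key 0
    simp only [h.deriv_zero_zero, h.apply_zero_zero, mul_zero, Finset.sum_const_zero, zero_mul,
      zero_add, mul_one] at this
    exact mul_left_cancel₀ hs0.ne' this
  have h1 : ∀ a : Fin 2, ‖A y‖ * f a.succ y = A y a * Real.sinh ‖A y‖ := fun a => by
    have := key a.succ
    simp only [h.deriv_succ_zero, h.apply_succ_zero, mul_zero, zero_mul, add_zero] at this
    rw [this, ← mulVec_matrixOf]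
    simp only [Matrix.mulVec, dotProduct]
    congr 1
    exact Finset.sum_congr rfl fun _ _ => mul_comm _ _
  have hpos := Real.cosh_pos ‖A y‖
  refine ⟨by rw [h0]; positivity, ?_⟩
  ext a
  rw [discMap_apply, discExp, tanh_half_eq, h0]
  simp only [PiLp.smul_apply, smul_eq_mul]
  have := h1 a
  field_simp
  linarith

end Coord.IsHyperboloidMap

namespace SurfaceMetric

variable {M : Type*} [TopologicalSpace M] [ChartedSpace Plane M] [IsManifold 𝓘(ℝ, Plane) ∞ M]
  {σ : SurfaceMetric M} {e : OpenPartialHomeomorph M Plane} {ρ : ℝ}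

/-- The chart `e` is an isometry onto the disc of Euclidean radius `ρ` in the Poincaré model of the
hyperbolic plane, with its metric `4 |dz|² / (1 - |z|²)²`. -/
structure IsPoincareChart (σ : SurfaceMetric M) (e : OpenPartialHomeomorph M Plane) (ρ : ℝ) :
    Prop where
  mem : e ∈ IsManifold.maximalAtlas 𝓘(ℝ, Plane) ∞ M
  pos : 0 < ρ
  le_one : ρ ≤ 1
  target_eq : e.target = Metric.ball 0 ρ
  form : ∀ y ∈ Metric.ball (0 : Plane) ρ, ∀ v w,
    σ.coordForm e y v w = 4 / (1 - ‖y‖ ^ 2) ^ 2 * inner ℝ v w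

lemma trans_mem_maximalAtlas (he : e ∈ IsManifold.maximalAtlas 𝓘(ℝ, Plane) ∞ M)
    {φ : OpenPartialHomeomorph Plane Plane} (hφ : ContDiffOn ℝ ∞ φ φ.source)
    (hφ' : ContDiffOn ℝ ∞ φ.symm φ.target) :
    e.trans φ ∈ IsManifold.maximalAtlas 𝓘(ℝ, Plane) ∞ M := by
  refine OpenPartialHomeomorph.mem_maximalAtlas_of_contMDiffOn _ ?_ ?_
  · rw [OpenPartialHomeomorph.coe_trans]
    exact hφ.contMDiffOn.comp ((contMDiffOn_of_mem_maximalAtlas he).mono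
      (by rw [OpenPartialHomeomorph.trans_source]; exact inter_subset_left))
      (fun x hx => by rw [OpenPartialHomeomorph.trans_source] at hx; exact hx.2)
  · rw [OpenPartialHomeomorph.coe_trans_symm]
    exact (contMDiffOn_symm_of_mem_maximalAtlas he).comp (hφ'.contMDiffOn.mono
      (by rw [OpenPartialHomeomorph.trans_target]; exact inter_subset_left))
      (fun x hx => by rw [OpenPartialHomeomorph.trans_target] at hx; exact hx.2)

lemma coordForm_trans_right {g : SurfaceMetric M}
    (he : e ∈ IsManifold.maximalAtlas 𝓘(ℝ, Plane) ∞ M)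
    {φ : OpenPartialHomeomorph Plane Plane} (hφ : ContDiffOn ℝ ∞ φ φ.source)
    (hφ' : ContDiffOn ℝ ∞ φ.symm φ.target) {y : Plane} (hy : y ∈ φ.target)
    (hy' : φ.symm y ∈ e.target) (v w : Plane) :
    g.coordForm (e.trans φ) y v w
      = g.coordForm e (φ.symm y) (fderiv ℝ φ.symm y v) (fderiv ℝ φ.symm y w) := by
  have hyt : y ∈ (e.trans φ).target := by
    rw [OpenPartialHomeomorph.trans_target]; exact ⟨hy, hy'⟩
  have hs : (e.trans φ).symm y = e.symm (φ.symm y) := rfl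
  have he1 : e ((e.trans φ).symm y) = φ.symm y := by rw [hs, e.right_inv hy']
  rw [coordForm_trans he (trans_mem_maximalAtlas he hφ hφ') hyt (by
    rw [hs]; exact e.map_target hy'), he1]
  have hev : e ∘ (e.trans φ).symm =ᶠ[𝓝 y] φ.symm := by
    filter_upwards [(e.trans φ).open_target.mem_nhds hyt] with z hz
    rw [OpenPartialHomeomorph.trans_target] at hz
    exact e.right_inv hz.2
  rw [hev.fderiv_eq]

/-- A chart followed by an isometry onto a Poincaré disc. -/
lemma isPoincareChart_trans (he : e ∈ IsManifold.maximalAtlas 𝓘(ℝ, Plane) ∞ M)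
    {φ : OpenPartialHomeomorph Plane Plane} (hs : φ.source ⊆ e.target)
    (hφ : ContDiffOn ℝ ∞ φ φ.source) (hφ' : ContDiffOn ℝ ∞ φ.symm φ.target)
    (h0 : 0 < ρ) (h1 : ρ ≤ 1) (ht : φ.target = Metric.ball 0 ρ)
    (hform : ∀ y ∈ φ.source, ∀ v w, 4 / (1 - ‖φ y‖ ^ 2) ^ 2 *
      inner ℝ (fderiv ℝ φ y v) (fderiv ℝ φ y w) = σ.coordForm e y v w) :
    σ.IsPoincareChart (e.trans φ) ρ := by
  refine ⟨trans_mem_maximalAtlas he hφ hφ', h0, h1, ?_, fun y hy v w => ?_⟩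
  · rw [OpenPartialHomeomorph.trans_target, ← ht]
    exact inter_eq_left.2 fun y hy => hs (φ.map_target hy)
  · rw [← ht] at hy
    have hys := φ.map_target hy
    rw [coordForm_trans_right he hφ hφ' hy (hs hys), ← hform _ hys, φ.right_inv hy]
    have hd : ∀ u, fderiv ℝ φ (φ.symm y) (fderiv ℝ φ.symm y u) = u := fun u => by
      have d1 : DifferentiableAt ℝ φ (φ.symm y) :=
        (hφ.contDiffAt (φ.open_source.mem_nhds hys)).differentiableAt (by simp)
      have d2 : DifferentiableAt ℝ φ.symm y :=
        (hφ'.contDiffAt (φ.open_target.mem_nhds hy)).differentiableAt (by simp)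
      have h2 := fderiv_comp y d1 d2
      have h3 : φ ∘ φ.symm =ᶠ[𝓝 y] id := by
        filter_upwards [φ.open_target.mem_nhds hy] with z hz using φ.right_inv hz
      rw [h3.fderiv_eq, fderiv_id] at h2
      exact (congrArg (fun T : Plane →L[ℝ] Plane => T u) h2).symm
    rw [hd, hd]

lemma gaussianCurvature_eq_neg_one (hσ : σ.IsHyperbolic)
    (he : e ∈ IsManifold.maximalAtlas 𝓘(ℝ, Plane) ∞ M) {y : Plane} (hy : y ∈ e.target) :
    Coord.gaussianCurvature (σ.coordMatrix e) y = -1 := by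
  have := hσ e he (e.symm y) (e.map_target hy)
  rwa [curvatureIn, e.right_inv hy] at this

/-- In a chart in which the rays from the origin are geodesics, and whose domain is a metric ball of
the tangent plane, the exponential map of the disc yields a Poincaré chart. -/
lemma exists_isPoincareChart_of_geodesic (hσ : σ.IsHyperbolic)
    (he : e ∈ IsManifold.maximalAtlas 𝓘(ℝ, Plane) ∞ M) {r : ℝ} (hr : 0 < r)
    (htarget : e.target = {v | √(σ.coordForm e 0 v v) < r})
    (hgeo : ∀ y : Plane, ∀ t ∈ Icc (0 : ℝ) 1, y ∈ e.target → ∀ k,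
      ∑ i, ∑ j, Coord.christoffel (σ.coordMatrix e) k i j (t • y) * y i * y j = 0) :
    ∃ e' : OpenPartialHomeomorph M Plane, σ.IsPoincareChart e' (Real.tanh (r / 2)) ∧
      e.symm 0 ∈ e'.source ∧ e' (e.symm 0) = 0 := by
  have h00 : (0 : Plane) ∈ e.target := by
    rw [htarget, mem_ofPred_eq, coordForm_eq_sum]
    simpa using hr
  have hG := isMetricOn_coordMatrix σ he
  obtain ⟨A, hA⟩ := exists_continuousLinearEquiv_inner (hG.posDef 0 h00)
  have hU : e.target = A ⁻¹' Metric.ball 0 r := by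
    rw [htarget]
    ext v
    rw [mem_ofPred_eq, mem_preimage, mem_ball_zero_iff, coordForm_eq_sum, ← hA,
      real_inner_self_eq_norm_sq, Real.sqrt_sq (norm_nonneg _)]
  have hray : ∀ y ∈ e.target, ∀ t ∈ Icc (0 : ℝ) 1, t • y ∈ e.target := fun y hy t ht => by
    rw [hU, mem_preimage, mem_ball_zero_iff] at hy ⊢
    rw [map_smul, norm_smul, Real.norm_of_nonneg ht.1]
    exact (mul_le_of_le_one_left (norm_nonneg _) ht.2).trans_lt hy
  have hS : StarConvex ℝ 0 e.target := fun y hy a b ha hb hab => by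
    rw [smul_zero, zero_add]
    exact hray y hy b ⟨hb, by linarith⟩
  obtain ⟨f, hf⟩ := Coord.exists_isHyperboloidMap hG hS h00
    (fun y hy => gaussianCurvature_eq_neg_one hσ he hy)
    (Coord.IsHyperboloidMap.transpose_matrixOf_mul hA)
  have hfE := fun y hy => hf.discMap_eq_discExp hG hA (hray y hy) (fun t ht => hgeo y t ht hy)
  set φ := A.toHomeomorph.toOpenPartialHomeomorph.trans (discExpHomeomorph r) with hφdef
  have hφs : φ.source = e.target := by
    rw [hU]; simp [hφdef, discExpHomeomorph]
  have hφt : φ.target = Metric.ball 0 (Real.tanh (r / 2)) := by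
    simp [hφdef, discExpHomeomorph]
  have hφE : ∀ y, φ y = discExp (A y) := fun y => rfl
  have hφ : ContDiffOn ℝ ∞ φ φ.source := (contDiff_discExp.comp A.contDiff).contDiffOn
  have hφ' : ContDiffOn ℝ ∞ φ.symm φ.target := by
    rw [hφt]
    exact A.symm.contDiff.comp_contDiffOn (contDiffOn_discLog.mono
      (Metric.ball_subset_ball (tanh_mem_Ioo (r / 2)).2.le))
  refine ⟨e.trans φ, isPoincareChart_trans he hφs.subset hφ hφ' (tanh_pos (half_pos hr))
    (tanh_mem_Ioo _).2.le hφt fun y hy v w => ?_, ?_, ?_⟩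
  · rw [hφs] at hy
    have hev : φ =ᶠ[𝓝 y] Coord.IsHyperboloidMap.discMap f := by
      filter_upwards [e.open_target.mem_nhds hy] with z hz using (hfE z hz).2.symm
    rw [hev.fderiv_eq, hev.eq_of_nhds, hf.inner_fderiv_discMap e.open_target hy (hfE y hy).1,
      coordForm_eq_sum]
  · rw [OpenPartialHomeomorph.trans_source]
    refine ⟨e.map_target h00, ?_⟩
    rw [mem_preimage, e.right_inv h00, hφs]
    exact h00
  · rw [OpenPartialHomeomorph.coe_trans, Function.comp_apply, e.right_inv h00, hφE, map_zero]
    simp [discExp]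

/-- Every point of a hyperbolic surface is the centre of a Poincaré chart. -/
lemma exists_isPoincareChart (hσ : σ.IsHyperbolic) (p : M) :
    ∃ (e : OpenPartialHomeomorph M Plane) (ρ : ℝ),
      σ.IsPoincareChart e ρ ∧ p ∈ e.source ∧ e p = 0 := by
  obtain ⟨e, he, hpe, hp0⟩ : ∃ e ∈ IsManifold.maximalAtlas 𝓘(ℝ, Plane) ∞ M,
      p ∈ e.source ∧ e p = 0 := by
    set c := chartAt Plane p
    set τ := (Homeomorph.addRight (-c p)).toOpenPartialHomeomorph
    refine ⟨c.trans τ, trans_mem_maximalAtlas (IsManifold.chart_mem_maximalAtlas p)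
      (contDiff_id.add contDiff_const).contDiffOn (contDiff_id.add contDiff_const).contDiffOn,
      ?_, ?_⟩
    · rw [OpenPartialHomeomorph.trans_source]
      exact ⟨mem_chart_source _ p, mem_univ _⟩
    · simp [τ]
  have h00 : (0 : Plane) ∈ e.target := hp0 ▸ e.map_source hpe
  obtain ⟨δ, hδ0, hδ⟩ := Metric.isOpen_iff.1 e.open_target 0 h00
  have hG := (isMetricOn_coordMatrix σ he).mono Metric.isOpen_ball hδ
  have h0δ : (0 : Plane) ∈ Metric.ball (0 : Plane) δ := Metric.mem_ball_self hδ0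
  obtain ⟨A, hA⟩ := exists_continuousLinearEquiv_inner (hG.posDef 0 h0δ)
  obtain ⟨f, hf⟩ := Coord.exists_isHyperboloidMap hG
    ((convex_ball (0 : Plane) δ).starConvex h0δ) h0δ
    (fun y hy => gaussianCurvature_eq_neg_one hσ he (hδ hy))
    (Coord.IsHyperboloidMap.transpose_matrixOf_mul hA)
  set F := Coord.IsHyperboloidMap.discMap f with hF
  set V := {y ∈ Metric.ball (0 : Plane) δ | 0 < 1 + f 0 y} with hV
  have hVo : IsOpen V := by
    have := (hf.contDiffOn 0).continuousOn
    exact (continuousOn_const.add this).isOpen_inter_preimage Metric.isOpen_ball isOpen_Ioi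
  have h0V : (0 : Plane) ∈ V := ⟨h0δ, by rw [hf.apply_zero_zero]; norm_num⟩
  have hFc : ContDiffOn ℝ ∞ F V := hf.contDiffOn_discMap (fun y hy => hy.1) fun y hy => hy.2
  have hFform : ∀ y ∈ V, ∀ v w, 4 / (1 - ‖F y‖ ^ 2) ^ 2 *
      inner ℝ (fderiv ℝ F y v) (fderiv ℝ F y w) = σ.coordForm e y v w := fun y hy v w => by
    rw [hf.inner_fderiv_discMap Metric.isOpen_ball hy.1 hy.2, coordForm_eq_sum]
  have hFinj : ∀ y ∈ V, Function.Injective (fderiv ℝ F y) := fun y hy => by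
    rw [injective_iff_map_eq_zero]
    intro v hv
    by_contra hv0
    have h1 := hFform y hy v v
    rw [hv, inner_zero_left, mul_zero] at h1
    exact (coordForm_self_pos (g := σ) he (hδ hy.1) hv0).ne h1
  have hF0 : F 0 = 0 := by
    ext a; simp [hF, Coord.IsHyperboloidMap.discMap_apply, hf.apply_succ_zero]
  have hc0 : ContDiffAt ℝ ∞ F 0 := hFc.contDiffAt (hVo.mem_nhds h0V)
  have hd0 := (hc0.differentiableAt (by simp)).hasFDerivAt
  obtain ⟨L, hL⟩ := exists_continuousLinearEquiv_eq (hFinj 0 h0V)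
  rw [← hL] at hd0
  set φ₀ := hc0.toOpenPartialHomeomorph F hd0 (by simp) with hφ₀
  set φ₁ := φ₀.restrOpen V hVo with hφ₁
  have h0s : (0 : Plane) ∈ φ₁.source := by
    rw [hφ₁, OpenPartialHomeomorph.restrOpen_source]
    exact ⟨hc0.mem_toOpenPartialHomeomorph_source hd0 (by simp), h0V⟩
  have h0t : (0 : Plane) ∈ φ₁.target := by
    have : φ₁ 0 = 0 := hF0
    rw [← this]; exact φ₁.map_source h0s
  obtain ⟨δ', hδ'0, hδ'⟩ := Metric.isOpen_iff.1 φ₁.open_target 0 h0t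
  set ρ := min δ' 1 with hρ
  have hρ0 : 0 < ρ := lt_min hδ'0 one_pos
  set φ := (φ₁.symm.restrOpen (Metric.ball 0 ρ) Metric.isOpen_ball).symm with hφ
  have hφt : φ.target = Metric.ball 0 ρ := by
    rw [hφ, OpenPartialHomeomorph.symm_target, OpenPartialHomeomorph.restrOpen_source,
      OpenPartialHomeomorph.symm_source]
    exact inter_eq_right.2 ((Metric.ball_subset_ball (min_le_left _ _)).trans hδ')
  have hφs : φ.source ⊆ V := by
    intro y hy
    have : y ∈ φ₁.source := hy.1
    rw [hφ₁, OpenPartialHomeomorph.restrOpen_source] at this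
    exact this.2
  have hφF : ⇑φ = F := rfl
  have hφc : ContDiffOn ℝ ∞ φ φ.source := hφF ▸ hFc.mono hφs
  have hφ' : ContDiffOn ℝ ∞ φ.symm φ.target :=
    φ.contDiffOn_symm_of_injective hφc fun y hy => hFinj y (hφs hy)
  have h0φ : (0 : Plane) ∈ φ.source := by
    have h1 : (0 : Plane) ∈ φ.target := by rw [hφt]; exact Metric.mem_ball_self hρ0
    have h2 := φ.map_target h1
    have h3 : φ.symm 0 = 0 := by
      have : φ₁.symm (φ₁ 0) = 0 := φ₁.left_inv h0s
      rwa [show φ₁ 0 = 0 from hF0] at this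
    rwa [h3] at h2
  refine ⟨e.trans φ, ρ, isPoincareChart_trans he (fun y hy => hδ (hφs hy).1) hφc hφ' hρ0
    (min_le_right _ _) hφt (fun y hy v w => hFform y (hφs hy) v w), ?_, ?_⟩
  · rw [OpenPartialHomeomorph.trans_source]
    exact ⟨hpe, by rw [mem_preimage, hp0]; exact h0φ⟩
  · rw [OpenPartialHomeomorph.coe_trans, Function.comp_apply, hp0]
    exact hF0

end SurfaceMetric

/-! ### The geodesic equation under a change of coordinates -/

namespace Coord

/-- A curve whose lift through `ψ` satisfies the Euler-Lagrange equation of the pulled back energy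
`Q = ψ^* g` satisfies the geodesic equation of `g`. -/
lemma geodesic_of_pullback {G : Plane → Matrix (Fin 2) (Fin 2) ℝ} {W V : Set Plane}
    (hG : IsMetricOn G W) (hV : IsOpen V) {ψ : Plane → Plane} (hψ : ContDiffOn ℝ ∞ ψ V)
    (hmaps : MapsTo ψ V W) {Q : Plane → Plane → Plane → ℝ}
    (hQ : ∀ z ∈ V, ∀ a b, Q z a b
      = ∑ i, ∑ j, G (ψ z) i j * fderiv ℝ ψ z a i * fderiv ℝ ψ z b j)
    {c c' : ℝ → Plane} {c'' : Plane} {t : ℝ} (ht : c t ∈ V) (hc : ∀ τ, HasDerivAt c (c' τ) τ)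
    (hc' : HasDerivAt c' c'' t) (hsurj : Function.Surjective (fderiv ℝ ψ (c t)))
    (hEL : ∀ w, ∃ d, HasDerivAt (fun τ => Q (c τ) (c' τ) w) d t ∧
      fderiv ℝ (fun z => Q z (c' t) (c' t)) (c t) w = 2 * d) (k : Fin 2) :
    deriv (deriv fun τ => ψ (c τ)) t k
      + ∑ i, ∑ j, christoffel G k i j (ψ (c t)) * deriv (fun τ => ψ (c τ)) t i
        * deriv (fun τ => ψ (c τ)) t j = 0 := by
  set D := fderiv ℝ ψ with hD
  have hψd : ∀ z ∈ V, HasFDerivAt ψ (D z) z := fun z hz =>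
    ((hψ.contDiffAt (hV.mem_nhds hz)).differentiableAt (by simp)).hasFDerivAt
  have hD2 : HasFDerivAt D (fderiv ℝ D (c t)) (c t) :=
    (((hψ.fderiv_of_isOpen hV (m := ∞) (by simp)).contDiffAt
      (hV.mem_nhds ht)).differentiableAt (by simp)).hasFDerivAt
  set H := fderiv ℝ D (c t) with hH
  have hHs : ∀ a b, H a b = H b a := fun a b =>
    ((hψ.contDiffAt (hV.mem_nhds ht)).isSymmSndFDerivAt
      (by simp only [minSmoothness_of_isRCLikeNormedField]; norm_cast)).eq a b
  have hcV : ∀ᶠ τ in 𝓝 t, c τ ∈ V := (hc t).continuousAt.eventually (hV.mem_nhds ht)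
  -- the velocity and the acceleration of the curve
  have hx : ∀ τ, c τ ∈ V → HasDerivAt (fun τ => ψ (c τ)) (D (c τ) (c' τ)) τ := fun τ hτ =>
    (hψd _ hτ).comp_hasDerivAt τ (hc τ)
  have hDc : HasDerivAt (fun τ => D (c τ)) (H (c' t)) t := hD2.comp_hasDerivAt t (hc t)
  set x' := D (c t) (c' t) with hx'
  set x'' := H (c' t) (c' t) + D (c t) c'' with hx''
  have hderiv : deriv (fun τ => ψ (c τ)) =ᶠ[𝓝 t] fun τ => D (c τ) (c' τ) := by
    filter_upwards [hcV] with τ hτ using (hx τ hτ).deriv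
  have hvel : HasDerivAt (fun τ => D (c τ) (c' τ)) x'' t := hDc.clm_apply hc'
  rw [hderiv.deriv_eq, hderiv.eq_of_nhds, hvel.deriv]
  have hy := hmaps ht
  have proj : ∀ {f : ℝ → Plane} {f' : Plane} (_ : HasDerivAt f f' t) (i : Fin 2),
      HasDerivAt (fun τ => f τ i) (f' i) t := fun hf i =>
    (EuclideanSpace.proj i : Plane →L[ℝ] ℝ).hasFDerivAt.comp_hasDerivAt t hf
  -- the Euler-Lagrange equation of `g`, tested against the vector `D (c t) w`
  have key : ∀ w, ∑ l, D (c t) w l * (∑ k, G (ψ (c t)) l k * x'' k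
      + ∑ i, ∑ j, partialDeriv i (fun z => G z j l) (ψ (c t)) * x' i * x' j
      - 1 / 2 * ∑ i, ∑ j, partialDeriv l (fun z => G z i j) (ψ (c t)) * x' i * x' j) = 0 := by
    intro w
    obtain ⟨d, hd1, hd2⟩ := hEL w
    have hGc : ∀ i j, HasDerivAt (fun τ => G (ψ (c τ)) i j)
        (∑ l, x' l * partialDeriv l (fun z => G z i j) (ψ (c t))) t := fun i j => by
      rw [← fderiv_eq_sum_partialDeriv]
      exact (hG.differentiableAt hy i j).hasFDerivAt.comp_hasDerivAt t (hx t ht)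
    have hW : HasDerivAt (fun τ => D (c τ) w) (H (c' t) w) t := by
      simpa using hDc.clm_apply (hasDerivAt_const t w)
    have e1 := HasDerivAt.fun_sum fun (i : Fin 2) (_ : i ∈ Finset.univ) =>
      HasDerivAt.fun_sum fun (j : Fin 2) (_ : j ∈ Finset.univ) =>
        ((hGc i j).fun_mul (proj hvel i)).fun_mul (proj hW j)
    have e1' : (fun τ => Q (c τ) (c' τ) w) =ᶠ[𝓝 t]
        fun τ => ∑ i, ∑ j, G (ψ (c τ)) i j * D (c τ) (c' τ) i * D (c τ) w j := by
      filter_upwards [hcV] with τ hτ using hQ _ hτ _ _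
    have hd1' := (hd1.congr_of_eventuallyEq e1'.symm).unique e1
    -- differentiate the energy along the line through `c t` in the direction `w`
    have hline : HasDerivAt (fun s : ℝ => c t + s • w) w 0 := by
      simpa using ((hasDerivAt_id (0 : ℝ)).smul_const w).const_add (c t)
    have hl0 : c t + (0 : ℝ) • w = c t := by simp
    have hDl : HasDerivAt (fun s : ℝ => D (c t + s • w) (c' t)) (H w (c' t)) 0 := by
      have h1 : HasDerivAt (fun s : ℝ => D (c t + s • w)) (H w) 0 := hD2.hasLineDerivAt w
      simpa using h1.clm_apply (hasDerivAt_const (0 : ℝ) (c' t))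
    have proj0 : ∀ i : Fin 2, HasDerivAt (fun s : ℝ => D (c t + s • w) (c' t) i)
        (H w (c' t) i) 0 := fun i =>
      (EuclideanSpace.proj i : Plane →L[ℝ] ℝ).hasFDerivAt.comp_hasDerivAt (0 : ℝ) hDl
    have hGl : ∀ i j, HasDerivAt (fun s : ℝ => G (ψ (c t + s • w)) i j)
        (∑ l, D (c t) w l * partialDeriv l (fun z => G z i j) (ψ (c t))) 0 := fun i j => by
      rw [← fderiv_eq_sum_partialDeriv]
      exact ((hG.differentiableAt hy i j).hasFDerivAt.comp (c t) (hψd _ ht)).hasLineDerivAt w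
    have e2 := HasDerivAt.fun_sum fun (i : Fin 2) (_ : i ∈ Finset.univ) =>
      HasDerivAt.fun_sum fun (j : Fin 2) (_ : j ∈ Finset.univ) =>
        ((hGl i j).fun_mul (proj0 i)).fun_mul (proj0 j)
    have hQd : DifferentiableAt ℝ (fun z => Q z (c' t) (c' t)) (c t) := by
      have h1 : DifferentiableAt ℝ (fun z => ∑ i, ∑ j, G (ψ z) i j * D z (c' t) i * D z (c' t) j)
          (c t) := by
        have hg : ∀ i j, DifferentiableAt ℝ (fun z => G (ψ z) i j) (c t) := fun i j =>
          (hG.differentiableAt hy i j).comp (c t) (hψd _ ht).differentiableAt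
        have hv : ∀ i : Fin 2, DifferentiableAt ℝ (fun z => D z (c' t) i) (c t) := fun i =>
          (EuclideanSpace.proj i : Plane →L[ℝ] ℝ).differentiableAt.comp (c t)
            (hD2.differentiableAt.clm_apply (differentiableAt_const _))
        exact DifferentiableAt.fun_sum fun i _ => DifferentiableAt.fun_sum fun j _ =>
          ((hg i j).fun_mul (hv i)).fun_mul (hv j)
      refine h1.congr_of_eventuallyEq ?_
      filter_upwards [hV.mem_nhds ht] with z hz using hQ z hz _ _
    have e3 : HasDerivAt (fun s : ℝ => Q (c t + s • w) (c' t) (c' t)) (2 * d) 0 := by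
      rw [← hd2]
      exact hQd.hasFDerivAt.hasLineDerivAt w
    have e3' : (fun s : ℝ => Q (c t + s • w) (c' t) (c' t)) =ᶠ[𝓝 0]
        fun s => ∑ i, ∑ j, G (ψ (c t + s • w)) i j * D (c t + s • w) (c' t) i
          * D (c t + s • w) (c' t) j := by
      have : ∀ᶠ s : ℝ in 𝓝 0, c t + s • w ∈ V :=
        hline.continuousAt.eventually (by simpa using hV.mem_nhds ht)
      filter_upwards [this] with s hs using hQ _ hs _ _
    have hd2' := (e3.congr_of_eventuallyEq e3'.symm).unique e2
    rw [hl0, hHs w] at hd2'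
    have s := hG.symm hy 1 0
    have ds := fun l => hG.partialDeriv_symm hy l 1 0
    simp only [Fin.sum_univ_two, ← hx', s, ds] at hd1' hd2' ⊢
    linear_combination hd2' / 2 - hd1'
  -- the geodesic equation with lowered index
  have key2 : ∀ l, ∑ k, G (ψ (c t)) l k * (x'' k
      + ∑ i, ∑ j, christoffel G k i j (ψ (c t)) * x' i * x' j) = 0 := by
    intro l
    obtain ⟨w, hw⟩ := hsurj (basisVec l)
    have h1 := key w
    have c1 := fun i j => hG.sum_mul_christoffel hy l i j
    simp only [Fin.sum_univ_two] at c1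
    have ds := fun l => hG.partialDeriv_symm hy l 1 0
    rw [hw] at h1
    obtain rfl | rfl := fin_two_eq l <;>
    simp [basisVec, Fin.sum_univ_two] at h1 ⊢ <;>
    linear_combination h1 + x' 0 * x' 0 * c1 0 0 + x' 0 * x' 1 * c1 0 1 + x' 1 * x' 0 * c1 1 0
      + x' 1 * x' 1 * c1 1 1
  have hdet := (hG.det_pos hy).ne'
  have k0 := key2 0
  have k1 := key2 1
  rw [Fin.sum_univ_two] at k0 k1
  rw [Matrix.det_fin_two] at hdet
  refine mul_left_cancel₀ hdet ?_
  obtain rfl | rfl := fin_two_eq k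
  · linear_combination G (ψ (c t)) 1 1 * k0 - G (ψ (c t)) 0 1 * k1
  · linear_combination G (ψ (c t)) 0 0 * k1 - G (ψ (c t)) 1 0 * k0

end Coord

/-! ### Normal balls at the centre of a Poincaré chart -/

lemma hasDerivAt_tanh (x : ℝ) : HasDerivAt Real.tanh (1 - Real.tanh x ^ 2) x := by
  have h := (Real.hasDerivAt_sinh x).div (Real.hasDerivAt_cosh x) (Real.cosh_pos x).ne'
  have h1 : Real.tanh = Real.sinh / Real.cosh := by
    ext y; rw [Real.tanh_eq_sinh_div_cosh]; rfl
  rw [h1]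
  refine h.congr_deriv ?_
  have := (Real.cosh_pos x).ne'
  rw [Pi.div_apply]
  field_simp

lemma hasDerivAt_four_div_sq {x : ℝ} (hx : x ≠ 0) :
    HasDerivAt (fun x : ℝ => 4 / x ^ 2) (-8 / x ^ 3) x := by
  have := ((hasDerivAt_pow 2 x).fun_inv (pow_ne_zero 2 hx)).const_mul 4
  refine (this.congr_deriv ?_).congr_of_eventuallyEq (Eventually.of_forall fun x => ?_)
  · simp; field_simp; norm_num
  · simp [div_eq_mul_inv]

lemma discExp_smul_of_norm_eq_one {n : Plane} (hn : ‖n‖ = 1) (x : ℝ) :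
    discExp (x • n) = Real.tanh (x / 2) • n := by
  rw [discExp, norm_smul, hn, mul_one, smul_smul, Real.norm_eq_abs]
  congr 1
  rcases lt_trichotomy x 0 with hx | rfl | hx
  · rw [abs_of_neg hx, neg_div, Real.tanh_neg, neg_div_neg_eq, div_mul_cancel₀ _ hx.ne]
  · simp
  · rw [abs_of_pos hx, div_mul_cancel₀ _ hx.ne']

namespace Coord

/-- The geodesics of the Poincaré disc issued from the origin satisfy the Euler-Lagrange equation of
its energy. -/
lemma geodesic_poincare {G : Plane → Matrix (Fin 2) (Fin 2) ℝ} {W V : Set Plane}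
    (hG : IsMetricOn G W) (hV : IsOpen V) {ψ : Plane → Plane} (hψ : ContDiffOn ℝ ∞ ψ V)
    (hmaps : MapsTo ψ V W)
    (hQ : ∀ z ∈ V, ∀ a b, 4 / (1 - ‖z‖ ^ 2) ^ 2 * inner ℝ a b
      = ∑ i, ∑ j, G (ψ z) i j * fderiv ℝ ψ z a i * fderiv ℝ ψ z b j)
    {n : Plane} (hn : ‖n‖ = 1) (s : ℝ) {t : ℝ} (ht : Real.tanh (t * s / 2) • n ∈ V) (k : Fin 2) :
    deriv (deriv fun τ => ψ (Real.tanh (τ * s / 2) • n)) t k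
      + ∑ i, ∑ j, christoffel G k i j (ψ (Real.tanh (t * s / 2) • n))
        * deriv (fun τ => ψ (Real.tanh (τ * s / 2) • n)) t i
        * deriv (fun τ => ψ (Real.tanh (τ * s / 2) • n)) t j = 0 := by
  set T : ℝ → ℝ := fun τ => Real.tanh (τ * s / 2) with hT
  have hT1 : ∀ τ, 0 < 1 - T τ ^ 2 := fun τ => by
    have := tanh_mem_Ioo (τ * s / 2)
    have h2 : T τ ^ 2 < 1 := (sq_lt_one_iff_abs_lt_one _).2 (abs_lt.2 ⟨this.1, this.2⟩)
    linarith
  have hTd : ∀ τ, HasDerivAt T (s / 2 * (1 - T τ ^ 2)) τ := fun τ => by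
    have := (hasDerivAt_tanh (τ * s / 2)).comp τ (((hasDerivAt_id τ).mul_const s).div_const 2)
    refine this.congr_deriv ?_
    simp only [hT]; ring
  have hTn : ∀ τ, ‖T τ • n‖ ^ 2 = T τ ^ 2 := fun τ => by
    rw [norm_smul, hn, mul_one, Real.norm_eq_abs, sq_abs]
  have hc : ∀ τ, HasDerivAt (fun τ => T τ • n) ((s / 2 * (1 - T τ ^ 2)) • n) τ :=
    fun τ => (hTd τ).smul_const n
  have hTd2 : ∀ τ, HasDerivAt (fun τ => 1 - T τ ^ 2) (-(s * T τ * (1 - T τ ^ 2))) τ := fun τ => by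
    refine (((hTd τ).fun_pow 2).const_sub 1).congr_deriv ?_
    simp; ring
  have hc' : HasDerivAt (fun τ => (s / 2 * (1 - T τ ^ 2)) • n)
      ((s / 2 * (-(s * T t * (1 - T t ^ 2)))) • n) t := ((hTd2 t).const_mul _).smul_const n
  have hinj : Function.Injective (fderiv ℝ ψ (T t • n)) := by
    rw [injective_iff_map_eq_zero]
    intro v hv
    have h1 := hQ _ ht v v
    rw [hv, real_inner_self_eq_norm_sq, hTn] at h1
    have h2 : (4 : ℝ) / (1 - T t ^ 2) ^ 2 ≠ 0 := by have := hT1 t; positivity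
    simpa [h2] using h1
  obtain ⟨L, hL⟩ := exists_continuousLinearEquiv_eq hinj
  refine geodesic_of_pullback hG hV hψ hmaps hQ ht hc hc' (by rw [← hL]; exact L.surjective)
    (fun w => ⟨2 * s ^ 2 * T t / (1 - T t ^ 2) * inner ℝ n w, ?_, ?_⟩) k
  · have h1 : (fun τ => 4 / (1 - ‖T τ • n‖ ^ 2) ^ 2 * inner ℝ ((s / 2 * (1 - T τ ^ 2)) • n) w)
        = fun τ => 2 * s * (1 - T τ ^ 2)⁻¹ * inner ℝ n w := by
      funext τ
      have := (hT1 τ).ne'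
      rw [hTn, real_inner_smul_left]; field_simp; ring
    rw [h1]
    refine ((((hTd2 t).inv (hT1 t).ne').const_mul (2 * s)).mul_const (inner ℝ n w)).congr_deriv ?_
    have := (hT1 t).ne'
    field_simp
  · have h1 : HasFDerivAt (fun z : Plane => 1 - ‖z‖ ^ 2) (-(2 • innerSL ℝ (T t • n))) (T t • n) :=
      (hasStrictFDerivAt_norm_sq (T t • n)).hasFDerivAt.const_sub 1
    have h2 : (1 - ‖T t • n‖ ^ 2) ≠ 0 := by rw [hTn]; exact (hT1 t).ne'
    have hK : inner ℝ ((s / 2 * (1 - T t ^ 2)) • n) ((s / 2 * (1 - T t ^ 2)) • n)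
        = (s / 2 * (1 - T t ^ 2)) ^ 2 := by
      rw [real_inner_self_eq_norm_sq, norm_smul, hn, mul_one, Real.norm_eq_abs, sq_abs]
    have h4 : HasFDerivAt (fun z : Plane => 4 / (1 - ‖z‖ ^ 2) ^ 2 * (s / 2 * (1 - T t ^ 2)) ^ 2) _
        (T t • n) :=
      ((hasDerivAt_four_div_sq h2).comp_hasFDerivAt (T t • n) h1).mul_const _
    simp only [hK]
    rw [h4.fderiv]
    have := (hT1 t).ne'
    simp [hn, norm_smul]
    field_simp
    ring

end Coord

namespace SurfaceMetric

lemma mfderiv_comp_curve {M : Type*} [TopologicalSpace M] [ChartedSpace Plane M]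
    {f : Plane → M} {c : ℝ → Plane} {t : ℝ} {y c' : Plane}
    (hf : MDifferentiableAt 𝓘(ℝ, Plane) 𝓘(ℝ, Plane) f y) (hy : c t = y) (hc : HasDerivAt c c' t) :
    (mfderiv 𝓘(ℝ, ℝ) 𝓘(ℝ, Plane) (fun τ => f (c τ)) t (1 : ℝ) : Plane)
      = mfderiv 𝓘(ℝ, Plane) 𝓘(ℝ, Plane) f y c' := by
  subst hy
  have h : mfderiv 𝓘(ℝ, ℝ) 𝓘(ℝ, Plane) (fun τ => f (c τ)) t = _ :=
    (HasMFDerivAt.comp t hf.hasMFDerivAt hc.hasFDerivAt.hasMFDerivAt).mfderiv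
  rw [h]
  show mfderiv 𝓘(ℝ, Plane) 𝓘(ℝ, Plane) f (c t) ((1 : ℝ) • c') = _
  rw [one_smul]

variable {M : Type*} [TopologicalSpace M] [ChartedSpace Plane M] [IsManifold 𝓘(ℝ, Plane) ∞ M]
  {σ : SurfaceMetric M} {e : OpenPartialHomeomorph M Plane} {ρ : ℝ}

/-- The exponential map at the centre of a Poincaré chart is, up to a linear isometry, the
exponential map of the disc; in particular it is a diffeomorphism from the balls whose image in the
disc lies in the chart. -/
lemma IsPoincareChart.hasNormalBall (h : σ.IsPoincareChart e ρ) {r : ℝ}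
    (hr : Real.tanh (r / 2) ≤ ρ) : σ.HasNormalBall (e.symm 0) r := by
  have he := h.mem
  have h0 : (0 : Plane) ∈ Metric.ball (0 : Plane) ρ := Metric.mem_ball_self h.pos
  have h0t : (0 : Plane) ∈ e.target := by rw [h.target_eq]; exact h0
  set D : Plane →L[ℝ] Plane := mfderiv 𝓘(ℝ, Plane) 𝓘(ℝ, Plane) e.symm 0 with hD
  have hDform : ∀ v w, σ.coordForm e 0 v w = σ.inner (e.symm 0) (D v) (D w) := fun v w => rfl
  have hDinj : Function.Injective D := by
    rw [injective_iff_map_eq_zero]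
    intro v hv
    have := mfderiv_chart_comp_symm he h0t v
    rw [← this]
    exact (congrArg _ hv).trans (map_zero _)
  obtain ⟨L, hL⟩ := exists_continuousLinearEquiv_eq hDinj
  have hLD : ∀ v, D (L.symm v) = v := fun v => by rw [← hL]; exact L.apply_symm_apply v
  obtain ⟨A, hA⟩ := exists_continuousLinearEquiv_eq (T := (2 : ℝ) • (L.symm : Plane →L[ℝ] Plane))
    (fun v w hvw => by simpa using hvw)
  have hA' : ∀ v, A v = (2 : ℝ) • L.symm v := fun v =>
    congrArg (fun T : Plane →L[ℝ] Plane => T v) hA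
  have hnorm : ∀ v : Plane, √(σ.inner (e.symm 0) v v) = ‖A v‖ := fun v => by
    have h1 := h.form 0 h0 (L.symm v) (L.symm v)
    rw [hDform, hLD, real_inner_self_eq_norm_sq] at h1
    rw [hA', norm_smul, ← Real.sqrt_sq (mul_nonneg (norm_nonneg _) (norm_nonneg _)), h1]
    congr 1
    simp; ring
  have hball : σ.tangentBall (e.symm 0) r = A ⁻¹' Metric.ball 0 r := by
    ext v
    rw [mem_preimage, mem_ball_zero_iff, ← hnorm]
    rfl
  set φ := A.toHomeomorph.toOpenPartialHomeomorph.trans (discExpHomeomorph r) with hφdef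
  have hφs : φ.source = σ.tangentBall (e.symm 0) r := by
    rw [hball]; simp [hφdef, discExpHomeomorph]
  have hφt : φ.target = Metric.ball 0 (Real.tanh (r / 2)) := by
    simp [hφdef, discExpHomeomorph]
  have hφ : ContDiffOn ℝ ∞ φ φ.source := (contDiff_discExp.comp A.contDiff).contDiffOn
  have hφ' : ContDiffOn ℝ ∞ φ.symm φ.target := by
    rw [hφt]
    exact A.symm.contDiff.comp_contDiffOn (contDiffOn_discLog.mono
      (Metric.ball_subset_ball (tanh_mem_Ioo (r / 2)).2.le))
  have hφe : φ.target ⊆ e.target := by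
    rw [hφt, h.target_eq]; exact Metric.ball_subset_ball hr
  set Φ := φ.trans e.symm with hΦ
  have hΦs : Φ.source = σ.tangentBall (e.symm 0) r := by
    rw [hΦ, OpenPartialHomeomorph.trans_source, ← hφs]
    exact inter_eq_left.2 fun y hy => hφe (φ.map_source hy)
  have hΦF : ∀ v, Φ v = e.symm (discExp (A v)) := fun v => rfl
  have hΦc : ContMDiffOn 𝓘(ℝ, Plane) 𝓘(ℝ, Plane) ∞ Φ Φ.source :=
    (contMDiffOn_symm_of_mem_maximalAtlas he).comp (hφ.contMDiffOn.mono
      (by rw [hΦ, OpenPartialHomeomorph.trans_source]; exact inter_subset_left))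
      (fun y hy => by rw [hΦ, OpenPartialHomeomorph.trans_source] at hy; exact hy.2)
  have hΦc' : ContMDiffOn 𝓘(ℝ, Plane) 𝓘(ℝ, Plane) ∞ Φ.symm Φ.target :=
    hφ'.contMDiffOn.comp ((contMDiffOn_of_mem_maximalAtlas he).mono
      (by rw [hΦ, OpenPartialHomeomorph.trans_target]; exact inter_subset_left))
      (fun y hy => by rw [hΦ, OpenPartialHomeomorph.trans_target] at hy; exact hy.2)
  refine ⟨Φ, ⟨?_, fun v hv => ?_⟩, ?_, ?_⟩
  · rw [hΦF, map_zero]; simp [discExp]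
  · obtain ⟨n, s, hn, hns⟩ : ∃ (n : Plane) (s : ℝ), ‖n‖ = 1 ∧ A v = s • n := by
      rcases eq_or_ne (A v) 0 with h1 | h1
      · exact ⟨Coord.basisVec 0, 0, by simp [Coord.basisVec], by simpa using h1⟩
      · exact ⟨‖A v‖⁻¹ • A v, ‖A v‖, by simp [norm_smul, h1], by simp [smul_smul, h1]⟩
    have hcurve : (fun t : ℝ => Φ (t • v)) = fun t => e.symm (Real.tanh (t * s / 2) • n) := by
      funext t
      rw [hΦF, map_smul, hns, smul_smul, discExp_smul_of_norm_eq_one hn]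
    have hmem : ∀ t : ℝ, t • v ∈ σ.tangentBall (e.symm 0) r →
        Real.tanh (t * s / 2) • n ∈ e.target := fun t ht => by
      rw [← discExp_smul_of_norm_eq_one hn, ← smul_smul, ← hns, ← map_smul]
      exact hφe (φ.map_source (by rw [hφs]; exact ht))
    refine ⟨⟨?_, fun e₂ he₂ t ht hte k => ?_⟩, ?_⟩
    · have : ContDiff ℝ ∞ fun t : ℝ => t • v := contDiff_id.smul contDiff_const
      exact hΦc.comp this.contMDiff.contMDiffOn fun t ht => by rw [hΦs]; exact ht
    · have hcurve' : ∀ t : ℝ, Φ (t • v) = e.symm (Real.tanh (t * s / 2) • n) := congrFun hcurve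
      simp only [hcurve'] at hte ⊢
      have hV : (e.symm.trans e₂).source = e.target ∩ e.symm ⁻¹' e₂.source :=
        OpenPartialHomeomorph.trans_source _ _
      refine Coord.geodesic_poincare (ψ := e₂ ∘ e.symm) (isMetricOn_coordMatrix σ he₂)
        (e.symm.trans e₂).open_source ?_ ?_ ?_ hn s ?_ k
      · rw [hV, ← contMDiffOn_iff_contDiffOn]
        exact (contMDiffOn_of_mem_maximalAtlas he₂).comp
          ((contMDiffOn_symm_of_mem_maximalAtlas he).mono inter_subset_left) fun y hy => hy.2
      · rw [hV]
        exact fun y hy => e₂.map_source hy.2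
      · rw [hV]
        intro z hz a b
        rw [← h.form z (h.target_eq ▸ hz.1), coordForm_trans he₂ he hz.1 hz.2, coordForm_eq_sum]
        refine Finset.sum_congr rfl fun i _ => Finset.sum_congr rfl fun j _ => ?_
        simp only [Function.comp_apply]
        ring
      · rw [hV]
        exact ⟨hmem t ht, hte⟩
    · rw [hcurve]
      have hc : HasDerivAt (fun t : ℝ => Real.tanh (t * s / 2) • n) (L.symm v) 0 := by
        have h1 := ((hasDerivAt_tanh ((0 : ℝ) * s / 2)).comp (0 : ℝ)
          (((hasDerivAt_id (0 : ℝ)).mul_const s).div_const 2)).smul_const n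
        have h2 : L.symm v = (s / 2) • n := by
          have := hA' v
          rw [hns] at this
          rw [div_eq_inv_mul, ← smul_smul, this, smul_smul]
          norm_num
        rw [h2]
        simpa using h1
      exact (mfderiv_comp_curve (mdifferentiableAt_chart_symm he h0t) (by simp) hc).trans (hLD v)
  · intro ⟨v, hv⟩
    exact ⟨⟨Φ.toPartialEquiv, Φ.open_source, Φ.open_target, hΦc, hΦc'⟩, by
      rw [← hΦs] at hv; exact hv, fun _ _ => rfl⟩
  · rw [← hΦs]
    exact Φ.injOn

end SurfaceMetric

/-! ### Poincaré charts from the exponential map -/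

/-- An injective local diffeomorphism on an open set, as a local homeomorphism. -/
lemma exists_openPartialHomeomorph_of_isLocalDiffeomorphOn {M : Type*} [TopologicalSpace M]
    [ChartedSpace Plane M] [IsManifold 𝓘(ℝ, Plane) ∞ M] {F : Plane → M} {B : Set Plane}
    (hB : IsOpen B) (hF : IsLocalDiffeomorphOn 𝓘(ℝ, Plane) 𝓘(ℝ, Plane) ∞ F B)
    (hinj : InjOn F B) :
    ∃ e ∈ IsManifold.maximalAtlas 𝓘(ℝ, Plane) ∞ M, e.target = B ∧ ⇑e.symm = F := by
  have hloc := hF.isLocalHomeomorphOn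
  have hopen : IsOpenMap (B.domRestrict F) := by
    rw [isOpenMap_iff_nhds_le]
    intro x
    have h1 : B.domRestrict F = F ∘ Subtype.val := rfl
    rw [h1, ← Filter.map_map, map_nhds_subtype_coe_eq_nhds x.2 (hB.mem_nhds x.2),
      hloc.map_nhds_eq x.2]
    rfl
  set Φ : OpenPartialHomeomorph Plane M := OpenPartialHomeomorph.ofContinuousOpenRestrict
    (hinj.toPartialEquiv F B) hloc.continuousOn hopen hB with hΦ
  have hΦs : Φ.source = B := rfl
  have hΦF : ⇑Φ = F := rfl
  refine ⟨Φ.symm, OpenPartialHomeomorph.mem_maximalAtlas_of_contMDiffOn _ ?_ ?_, hΦs, hΦF⟩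
  · intro y hy
    have hx := Φ.map_target hy
    obtain ⟨Ψ, hxΨ, hΨ⟩ := hF ⟨_, hx⟩
    have hyΨ : Ψ (Φ.symm y) = y := by
      rw [← hΨ hxΨ, ← hΦF, Φ.right_inv hy]
    have hyt : y ∈ Ψ.target := by
      have := Ψ.map_source hxΨ
      rwa [show Ψ.toPartialEquiv (Φ.symm y) = y from hyΨ] at this
    have h1 := Ψ.contMDiffOn_invFun.contMDiffAt (Ψ.open_target.mem_nhds hyt)
    have hΨy : Ψ.invFun y = Φ.symm y := by
      have := Ψ.left_inv hxΨ
      rwa [show Ψ.toPartialEquiv (Φ.symm y) = y from hyΨ] at this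
    have h2 : Φ.symm =ᶠ[𝓝 y] Ψ.invFun := by
      have hB' : B ∈ 𝓝 (Ψ.invFun y) := by rw [hΨy]; exact hB.mem_nhds hx
      filter_upwards [Ψ.open_target.mem_nhds hyt, h1.continuousAt.preimage_mem_nhds hB']
        with z hz hzB
      have h3 : Φ (Ψ.invFun z) = z := by
        rw [hΦF]
        exact (hΨ (Ψ.map_target hz)).trans (Ψ.right_inv hz)
      rw [← h3, Φ.left_inv hzB, h3]
    exact (h1.congr_of_eventuallyEq h2).contMDiffWithinAt
  · exact hF.contMDiffOn

namespace SurfaceMetric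

variable {M : Type*} [TopologicalSpace M] [ChartedSpace Plane M] [IsManifold 𝓘(ℝ, Plane) ∞ M]
  {σ : SurfaceMetric M} {e : OpenPartialHomeomorph M Plane} {ρ : ℝ}

lemma isOpen_tangentBall (g : SurfaceMetric M) (p : M) (r : ℝ) : IsOpen (g.tangentBall p r) := by
  have hc : Continuous fun v : Plane => √(g.inner p v v) := by
    set T : Plane →L[ℝ] Plane →L[ℝ] ℝ := g.inner p
    exact ((T.continuous.clm_apply continuous_id).sqrt : Continuous fun v => √(T v v))
  exact isOpen_lt hc continuous_const

lemma inner_smul_smul (g : SurfaceMetric M) (p : M) (c : ℝ) (v : Plane) :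
    √(g.inner p (c • v : Plane) (c • v : Plane)) = |c| * √(g.inner p v v) := by
  set T : Plane →L[ℝ] Plane →L[ℝ] ℝ := g.inner p with hT
  have : T (c • v) (c • v) = c ^ 2 * T v v := by
    simp; ring
  show √(T (c • v) (c • v)) = |c| * √(T v v)
  rw [this, Real.sqrt_mul (sq_nonneg c), Real.sqrt_sq_eq_abs]

lemma mem_tangentBall {g : SurfaceMetric M} {p : M} {r : ℝ} {v : Plane} :
    v ∈ g.tangentBall p r ↔ √(g.inner p v v) < r := Iff.rfl

/-- The differential at the origin of the exponential map is the identity. -/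
lemma IsExpOn.mfderiv_zero {g : SurfaceMetric M} {p : M} {r : ℝ} (hr : 0 < r) {F : Plane → M}
    (h : g.IsExpOn p (g.tangentBall p r) F)
    (hF : MDifferentiableAt 𝓘(ℝ, Plane) 𝓘(ℝ, Plane) F 0) (v : Plane) :
    (mfderiv 𝓘(ℝ, Plane) 𝓘(ℝ, Plane) F 0 v : Plane) = v := by
  set N := √(g.inner p v v) with hN
  have hN0 : 0 ≤ N := Real.sqrt_nonneg _
  set c := r / (N + 1) / 2 with hc
  have hc0 : 0 < c := by positivity
  have hcv : c • v ∈ g.tangentBall p r := by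
    rw [mem_tangentBall, inner_smul_smul, abs_of_pos hc0, ← hN, hc]
    have : N < N + 1 := by linarith
    rw [div_div, div_mul_eq_mul_div, div_lt_iff₀ (by positivity)]
    nlinarith
  have h1 := (h.2 _ hcv).2
  have hd : HasDerivAt (fun t : ℝ => t • c • v) (c • v) 0 := by
    simpa using (hasDerivAt_id (0 : ℝ)).smul_const (c • v)
  have h2 := (mfderiv_comp_curve hF (zero_smul ℝ (c • v)) hd).symm.trans h1
  set D : Plane →L[ℝ] Plane := mfderiv 𝓘(ℝ, Plane) 𝓘(ℝ, Plane) F 0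
  have h3 : D (c • v) = c • v := h2
  rw [map_smul] at h3
  exact smul_right_injective Plane hc0.ne' h3

/-- The exponential map of a normal ball of a hyperbolic surface identifies it with a Poincaré
disc. -/
lemma HasNormalBall.exists_isPoincareChart (hσ : σ.IsHyperbolic) {p : M} {r : ℝ} (hr : 0 < r)
    (h : σ.HasNormalBall p r) : ∃ e : OpenPartialHomeomorph M Plane,
      σ.IsPoincareChart e (Real.tanh (r / 2)) ∧ p ∈ e.source ∧ e p = 0 := by
  obtain ⟨F, hexp, hloc, hinj⟩ := h
  obtain ⟨e, he, het, heF⟩ := exists_openPartialHomeomorph_of_isLocalDiffeomorphOn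
    (isOpen_tangentBall σ p r) hloc hinj
  have hp : e.symm 0 = p := by rw [heF]; exact hexp.1
  have h0 : (0 : Plane) ∈ e.target := by
    rw [het, mem_tangentBall]
    have := inner_smul_smul σ p 0 0
    rw [zero_smul, abs_zero, zero_mul] at this
    rwa [this]
  have hstar : ∀ y ∈ e.target, ∀ t ∈ Icc (0 : ℝ) 1, t • y ∈ e.target := fun y hy t ht => by
    rw [het, mem_tangentBall] at hy ⊢
    rw [inner_smul_smul, abs_of_nonneg ht.1]
    exact (mul_le_of_le_one_left (Real.sqrt_nonneg _) ht.2).trans_lt hy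
  have hform : ∀ v, σ.coordForm e 0 v v = σ.inner p v v := fun v => by
    have h1 : (mfderiv 𝓘(ℝ, Plane) 𝓘(ℝ, Plane) e.symm 0 v : Plane) = v := by
      have := hexp.mfderiv_zero hr (heF ▸ mdifferentiableAt_chart_symm he h0) v
      rwa [← heF] at this
    subst hp
    exact congrArg (fun w : Plane => σ.inner (e.symm 0) w w) h1
  obtain ⟨e', h1, h2, h3⟩ := exists_isPoincareChart_of_geodesic hσ he hr (by
    rw [het]
    ext v
    rw [mem_tangentBall, mem_ofPred_eq, hform]) fun y t ht hy k => by
      have hty := hstar y hy t ht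
      have h1 := ((hexp.2 y (het ▸ hy)).1).2 e he t (het ▸ hty) (by
        rw [← heF]; exact e.map_target hty) k
      have hev : (fun τ : ℝ => e (F (τ • y))) =ᶠ[𝓝 t] fun τ => τ • y := by
        have hcont : Continuous fun τ : ℝ => τ • y := by fun_prop
        filter_upwards [hcont.continuousAt.preimage_mem_nhds (e.open_target.mem_nhds hty)]
          with τ hτ
        rw [← heF]
        exact e.right_inv hτ
      have hd : ∀ τ : ℝ, HasDerivAt (fun τ : ℝ => τ • y) y τ := fun τ => by
        simpa using (hasDerivAt_id τ).smul_const y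
      have hdd : deriv (fun τ : ℝ => τ • y) = fun _ => y := funext fun τ => (hd τ).deriv
      rw [hev.deriv.deriv_eq, hev.deriv_eq, hdd, deriv_const, ← heF, e.right_inv hty] at h1
      simpa using h1
  rw [hp] at h2 h3
  exact ⟨e', h1, h2, h3⟩

end SurfaceMetric

/-! ### Recentring of Poincaré charts -/

section Mobius

open ComplexConjugate

/-- The automorphism `z ↦ (z - a) / (1 - conj a * z)` of the unit disc. -/
def mobius (a z : ℂ) : ℂ := (z - a) / (1 - conj a * z)

lemma one_sub_conj_mul_ne_zero {a z : ℂ} (ha : ‖a‖ < 1) (hz : ‖z‖ < 1) : 1 - conj a * z ≠ 0 := by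
  intro h
  have h1 : ‖conj a * z‖ = 1 := by rw [← sub_eq_zero.1 h, norm_one]
  rw [norm_mul, Complex.norm_conj] at h1
  nlinarith [norm_nonneg a, norm_nonneg z]

lemma one_sub_norm_mobius_sq {a z : ℂ} (ha : ‖a‖ < 1) (hz : ‖z‖ < 1) :
    1 - ‖mobius a z‖ ^ 2 = (1 - ‖a‖ ^ 2) * (1 - ‖z‖ ^ 2) / ‖1 - conj a * z‖ ^ 2 := by
  have h := norm_ne_zero_iff.2 (one_sub_conj_mul_ne_zero ha hz)
  rw [mobius, norm_div, div_pow, eq_div_iff (pow_ne_zero 2 h), sub_mul, div_mul_cancel₀ _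
    (pow_ne_zero 2 h)]
  simp only [← Complex.normSq_eq_norm_sq, Complex.normSq_apply]
  simp
  ring

lemma norm_mobius_lt_one {a z : ℂ} (ha : ‖a‖ < 1) (hz : ‖z‖ < 1) : ‖mobius a z‖ < 1 := by
  have h := norm_pos_iff.2 (one_sub_conj_mul_ne_zero ha hz)
  have h1 : 0 < 1 - ‖a‖ ^ 2 := by nlinarith [norm_nonneg a]
  have h2 : 0 < 1 - ‖z‖ ^ 2 := by nlinarith [norm_nonneg z]
  have h3 : 0 < 1 - ‖mobius a z‖ ^ 2 := by
    rw [one_sub_norm_mobius_sq ha hz]; positivity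
  nlinarith [norm_nonneg (mobius a z)]

lemma mobius_neg_mobius {a z : ℂ} (ha : ‖a‖ < 1) (hz : ‖z‖ < 1) :
    mobius (-a) (mobius a z) = z := by
  have h := one_sub_conj_mul_ne_zero ha hz
  have h1 := one_sub_conj_mul_ne_zero ha ha
  have h2 : 1 - conj a * z + conj a * (z - a) = 1 - conj a * a := by ring
  simp only [mobius, map_neg, neg_mul, sub_neg_eq_add]
  rw [mul_div_assoc', div_add' _ _ _ h, one_add_div h, h2, div_div_div_cancel_right₀ h,
    div_eq_iff h1]
  ring

lemma hasDerivAt_mobius {a z : ℂ} (ha : ‖a‖ < 1) (hz : ‖z‖ < 1) :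
    HasDerivAt (mobius a) ((1 - conj a * a) / (1 - conj a * z) ^ 2) z := by
  have h := one_sub_conj_mul_ne_zero ha hz
  refine (((hasDerivAt_id' z).sub_const a).div
    (((hasDerivAt_id' z).const_mul (conj a)).const_sub 1) h).congr_deriv ?_
  congr 1
  ring

lemma contDiffOn_mobius {a : ℂ} (ha : ‖a‖ < 1) : ContDiffOn ℝ ∞ (mobius a) (Metric.ball 0 1) := by
  have h : ContDiffOn ℂ ∞ (mobius a) (Metric.ball 0 1) :=
    ContDiffOn.div (contDiff_id.sub contDiff_const).contDiffOn
      (contDiff_const.sub (contDiff_const.mul contDiff_id)).contDiffOn fun z hz =>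
        one_sub_conj_mul_ne_zero ha (by simpa using hz)
  exact h.restrict_scalars ℝ

/-- The automorphism `mobius a` of the disc, with target the disc of radius `R ≤ 1`. -/
def mobiusHomeomorph (a : ℂ) (R : ℝ) (ha : ‖a‖ < 1) (hR : R ≤ 1) : OpenPartialHomeomorph ℂ ℂ where
  toFun := mobius a
  invFun := mobius (-a)
  source := Metric.ball 0 1 ∩ mobius a ⁻¹' Metric.ball 0 R
  target := Metric.ball 0 R
  map_source' := fun z hz => hz.2
  map_target' := fun w hw => by
    have hw1 : ‖w‖ < 1 := by
      rw [mem_ball_zero_iff] at hw; linarith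
    have h1 : ‖-a‖ < 1 := by rwa [norm_neg]
    have h2 := mobius_neg_mobius h1 hw1
    rw [neg_neg] at h2
    exact ⟨by simpa using norm_mobius_lt_one h1 hw1, by rwa [mem_preimage, h2]⟩
  left_inv' := fun z hz => mobius_neg_mobius ha (by simpa using hz.1)
  right_inv' := fun w hw => by
    have hw1 : ‖w‖ < 1 := by
      rw [mem_ball_zero_iff] at hw; linarith
    have h2 := mobius_neg_mobius (a := -a) (by rwa [norm_neg]) hw1
    rwa [neg_neg] at h2
  open_source := (contDiffOn_mobius ha).continuousOn.isOpen_inter_preimage Metric.isOpen_ball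
    Metric.isOpen_ball
  open_target := Metric.isOpen_ball
  continuousOn_toFun := (contDiffOn_mobius ha).continuousOn.mono inter_subset_left
  continuousOn_invFun := (contDiffOn_mobius (by rwa [norm_neg])).continuousOn.mono
    (Metric.ball_subset_ball hR)

lemma inner_mul_mul (c x y : ℂ) : inner ℝ (c * x) (c * y) = ‖c‖ ^ 2 * inner ℝ x y := by
  simp only [Complex.inner, ← Complex.normSq_eq_norm_sq, Complex.normSq_apply]
  simp
  ring

/-- The identification of the complex plane with `Plane`. -/
def complexIso : ℂ ≃ₗᵢ[ℝ] Plane := Complex.orthonormalBasisOneI.repr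

/-- The disc of radius `ρ` contains the hyperbolic disc of Euclidean radius `ρ / 4`, recentred at a
point of the Euclidean disc of radius `ρ / 4`. -/
lemma norm_mobius_neg_lt {a w : ℂ} {ρ : ℝ} (hρ : ρ ≤ 1) (ha : ‖a‖ < ρ / 4) (hw : ‖w‖ < ρ / 4) :
    ‖mobius (-a) w‖ < ρ := by
  have h0 : 0 < ρ := by linarith [norm_nonneg a]
  have h1 : ‖w - -a‖ < ρ / 2 := by
    rw [sub_neg_eq_add]; linarith [norm_add_le w a]
  have h2 : 1 / 2 < ‖1 - conj (-a) * w‖ := by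
    have h3 := norm_sub_norm_le (1 : ℂ) (conj (-a) * w)
    rw [norm_one, norm_mul, Complex.norm_conj, norm_neg] at h3
    nlinarith [norm_nonneg a, norm_nonneg w]
  rw [mobius, norm_div, div_lt_iff₀ (by linarith)]
  nlinarith

end Mobius

namespace SurfaceMetric

variable {M : Type*} [TopologicalSpace M] [ChartedSpace Plane M] [IsManifold 𝓘(ℝ, Plane) ∞ M]
  {σ : SurfaceMetric M} {e : OpenPartialHomeomorph M Plane} {ρ : ℝ}

/-- A point near the centre of a Poincaré chart is itself the centre of a Poincaré chart. -/
lemma IsPoincareChart.recenter (h : σ.IsPoincareChart e ρ) {q : M} (hq : q ∈ e.source)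
    (hqρ : ‖e q‖ < ρ / 4) :
    ∃ e' : OpenPartialHomeomorph M Plane, σ.IsPoincareChart e' (ρ / 4) ∧ q ∈ e'.source ∧
      e' q = 0 := by
  have hρ0 := h.pos
  have hρ1 := h.le_one
  set ι := complexIso with hι
  set a := ι.symm (e q) with ha
  have haρ : ‖a‖ < ρ / 4 := by rwa [ha, LinearIsometryEquiv.norm_map]
  have ha1 : ‖a‖ < 1 := by linarith
  have hR : ρ / 4 ≤ 1 := by linarith
  set φ := (ι.symm.toHomeomorph.toOpenPartialHomeomorph.trans
    (mobiusHomeomorph a (ρ / 4) ha1 hR)).trans ι.toHomeomorph.toOpenPartialHomeomorph with hφdef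
  have hφt : φ.target = Metric.ball 0 (ρ / 4) := by
    ext y
    simp [hφdef, mobiusHomeomorph]
  have hφs : ∀ y, y ∈ φ.source ↔ ‖y‖ < 1 ∧ ‖mobius a (ι.symm y)‖ < ρ / 4 := fun y => by
    simp [hφdef, mobiusHomeomorph]
  have hφE : ∀ y, φ y = ι (mobius a (ι.symm y)) := fun y => rfl
  have hφE' : ∀ y, φ.symm y = ι (mobius (-a) (ι.symm y)) := fun y => rfl
  have hsmooth : ∀ b : ℂ, ‖b‖ < 1 →
      ContDiffOn ℝ ∞ (fun y => ι (mobius b (ι.symm y))) (Metric.ball 0 1) := fun b hb =>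
    ι.contDiff.comp_contDiffOn ((contDiffOn_mobius hb).comp ι.symm.contDiff.contDiffOn
      fun y hy => by simpa using hy)
  have hsrc : ∀ y ∈ φ.source, ‖y‖ < ρ := fun y hy => by
    obtain ⟨h1, h2⟩ := (hφs y).1 hy
    have h3 := norm_mobius_neg_lt hρ1 haρ h2
    rwa [mobius_neg_mobius ha1 (by rwa [LinearIsometryEquiv.norm_map]),
      LinearIsometryEquiv.norm_map] at h3
  have hqs : e q ∈ φ.source := by
    rw [hφs]
    exact ⟨by linarith, by simp [mobius, ← ha, hρ0]⟩
  refine ⟨e.trans φ, isPoincareChart_trans h.mem ?_ ?_ ?_ (by linarith) hR hφt ?_, ?_, ?_⟩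
  · intro y hy
    rw [h.target_eq, mem_ball_zero_iff]
    exact hsrc y hy
  · exact (hsmooth a ha1).mono fun y hy => by simpa using ((hφs y).1 hy).1
  · rw [hφt]
    exact (hsmooth (-a) (by rwa [norm_neg])).mono (Metric.ball_subset_ball hR)
  · intro y hy v w
    have hy1 : ‖ι.symm y‖ < 1 := by
      rw [LinearIsometryEquiv.norm_map]; exact ((hφs y).1 hy).1
    set z := ι.symm y with hz
    have hd : ∀ u, fderiv ℝ φ y u
        = ι ((1 - starRingEnd ℂ a * a) / (1 - starRingEnd ℂ a * z) ^ 2 * ι.symm u) := fun u => by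
      have h1 := ((hasDerivAt_mobius ha1 hy1).hasFDerivAt.restrictScalars ℝ).comp y
        ι.symm.toContinuousLinearEquiv.hasFDerivAt
      have h2 : fderiv ℝ φ y = _ := (ι.toContinuousLinearEquiv.hasFDerivAt.comp y h1).fderiv
      rw [h2]
      simp [mul_comm]
    have hnz : ‖y‖ = ‖z‖ := (LinearIsometryEquiv.norm_map _ _).symm
    have hc : ‖1 - starRingEnd ℂ a * a‖ = 1 - ‖a‖ ^ 2 := by
      have h1 : (1 : ℂ) - starRingEnd ℂ a * a = ((1 - ‖a‖ ^ 2 : ℝ) : ℂ) := by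
        rw [mul_comm, Complex.mul_conj, Complex.normSq_eq_norm_sq]; push_cast; rfl
      rw [h1, Complex.norm_real, Real.norm_of_nonneg (by nlinarith [norm_nonneg a])]
    have ha0 : 1 - ‖a‖ ^ 2 ≠ 0 := by nlinarith [norm_nonneg a]
    have hz0 : 1 - ‖z‖ ^ 2 ≠ 0 := by nlinarith [norm_nonneg z]
    have hm := norm_ne_zero_iff.2 (one_sub_conj_mul_ne_zero ha1 hy1)
    rw [h.form y (mem_ball_zero_iff.2 (hsrc y hy)), hd, hd, LinearIsometryEquiv.inner_map_map,
      inner_mul_mul, LinearIsometryEquiv.inner_map_map, hφE, LinearIsometryEquiv.norm_map,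
      one_sub_norm_mobius_sq ha1 hy1, norm_div, hc, norm_pow, hnz]
    field_simp
  · rw [OpenPartialHomeomorph.trans_source]
    exact ⟨hq, hqs⟩
  · rw [OpenPartialHomeomorph.coe_trans, Function.comp_apply, hφE, ← ha]
    simp [mobius]

/-- On a compact hyperbolic surface, the radii of the Poincaré charts can be chosen uniformly. -/
lemma exists_forall_isPoincareChart [CompactSpace M] (hσ : σ.IsHyperbolic) :
    ∃ δ : ℝ, 0 < δ ∧ ∀ p : M, ∃ (e : OpenPartialHomeomorph M Plane) (ρ : ℝ),
      δ ≤ ρ ∧ σ.IsPoincareChart e ρ ∧ p ∈ e.source ∧ e p = 0 := by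
  suffices H : ∃ δ : ℝ, 0 < δ ∧ ∀ p ∈ (univ : Set M), ∃ (e : OpenPartialHomeomorph M Plane)
      (ρ : ℝ), δ ≤ ρ ∧ σ.IsPoincareChart e ρ ∧ p ∈ e.source ∧ e p = 0 by simpa using H
  refine isCompact_univ.induction_on (p := fun S => ∃ δ : ℝ, 0 < δ ∧ ∀ p ∈ S,
    ∃ (e : OpenPartialHomeomorph M Plane) (ρ : ℝ),
      δ ≤ ρ ∧ σ.IsPoincareChart e ρ ∧ p ∈ e.source ∧ e p = 0) ⟨1, one_pos, by simp⟩ ?_ ?_ ?_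
  · rintro S T hST ⟨δ, h0, h⟩
    exact ⟨δ, h0, fun p hp => h p (hST hp)⟩
  · rintro S T ⟨δ, h0, h⟩ ⟨δ', h0', h'⟩
    refine ⟨min δ δ', lt_min h0 h0', fun p hp => ?_⟩
    rcases hp with hp | hp
    · obtain ⟨e, ρ, h1, h2⟩ := h p hp
      exact ⟨e, ρ, (min_le_left _ _).trans h1, h2⟩
    · obtain ⟨e, ρ, h1, h2⟩ := h' p hp
      exact ⟨e, ρ, (min_le_right _ _).trans h1, h2⟩
  · intro x _
    obtain ⟨e, ρ, he, hx, hx0⟩ := exists_isPoincareChart hσ x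
    have hρ : 0 < ρ / 4 := by have := he.pos; linarith
    refine ⟨e.source ∩ e ⁻¹' Metric.ball 0 (ρ / 4), mem_nhdsWithin_of_mem_nhds
      ((e.isOpen_inter_preimage Metric.isOpen_ball).mem_nhds ⟨hx, ?_⟩), ρ / 4, hρ, fun q hq => ?_⟩
    · rw [mem_preimage, hx0]; exact Metric.mem_ball_self hρ
    · obtain ⟨e', h1, h2⟩ := he.recenter hq.1 (mem_ball_zero_iff.1 hq.2)
      exact ⟨e', ρ / 4, le_rfl, h1, h2⟩

/-- The injectivity radius of a compact hyperbolic surface is not the supremum of the empty set. -/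
lemma exists_forall_hasNormalBall [CompactSpace M] (hσ : σ.IsHyperbolic) :
    ∃ r : ℝ, 0 < r ∧ ∀ p : M, σ.HasNormalBall p r := by
  obtain ⟨δ, h0, h⟩ := exists_forall_isPoincareChart hσ
  have hm0 : 0 < min δ (1 / 2) := lt_min h0 (by norm_num)
  have hm1 : min δ (1 / 2) < 1 := (min_le_right _ _).trans_lt (by norm_num)
  refine ⟨2 * Real.artanh (min δ (1 / 2)), by
    have := Real.artanh_pos ⟨hm0, hm1⟩; positivity, fun p => ?_⟩
  obtain ⟨e, ρ, h1, h2, hp, hp0⟩ := h p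
  have h3 := h2.hasNormalBall (r := 2 * Real.artanh (min δ (1 / 2))) (by
    rw [mul_div_cancel_left₀ _ two_ne_zero, Real.tanh_artanh ⟨by linarith, hm1⟩]
    exact (min_le_left _ _).trans h1)
  rwa [← hp0, e.left_inv hp] at h3

end SurfaceMetric

/-! ### The mean value inequality -/

section CircleMean

open MeasureTheory

/-- Differentiation under the integral sign, for integrands with jointly continuous derivative. -/
lemma hasDerivAt_integral_of_continuousOn {ρ a b : ℝ} {f f' : ℝ → ℝ → ℝ}
    (hf : ContinuousOn (fun p : ℝ × ℝ => f p.1 p.2) (Ioo (-ρ) ρ ×ˢ univ))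
    (hf' : ContinuousOn (fun p : ℝ × ℝ => f' p.1 p.2) (Ioo (-ρ) ρ ×ˢ univ))
    (hd : ∀ s ∈ Ioo (-ρ) ρ, ∀ θ, HasDerivAt (fun s => f s θ) (f' s θ) s) {s : ℝ}
    (hs : s ∈ Ioo (-ρ) ρ) :
    HasDerivAt (fun s => ∫ θ in a..b, f s θ) (∫ θ in a..b, f' s θ) s := by
  have hline : ∀ {k : ℝ → ℝ → ℝ},
      ContinuousOn (fun p : ℝ × ℝ => k p.1 p.2) (Ioo (-ρ) ρ ×ˢ univ) →
      ∀ x ∈ Ioo (-ρ) ρ, Continuous (k x) := fun hk x hx =>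
    hk.comp_continuous (f := fun θ : ℝ => (x, θ)) (by fun_prop) fun θ => ⟨hx, mem_univ _⟩
  obtain ⟨δ, hδ, hball⟩ := Metric.nhds_basis_closedBall.mem_iff.1 (isOpen_Ioo.mem_nhds hs)
  obtain ⟨C, hC⟩ := ((isCompact_closedBall s δ).prod isCompact_uIcc).exists_bound_of_continuousOn
    (hf'.mono (prod_mono hball (subset_univ (uIcc a b))))
  refine (intervalIntegral.hasDerivAt_integral_of_dominated_loc_of_deriv_le
    (bound := fun _ => C) (Metric.closedBall_mem_nhds s hδ) ?_
    ((hline hf s hs).intervalIntegrable _ _) (hline hf' s hs).aestronglyMeasurable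
    (Eventually.of_forall fun θ hθ x hx => hC (x, θ) ⟨hx, uIoc_subset_uIcc hθ⟩)
    intervalIntegrable_const
    (Eventually.of_forall fun θ _ x hx => hd x (hball hx) θ)).2
  filter_upwards [Metric.closedBall_mem_nhds s hδ] with x hx
  exact (hline hf x (hball hx)).aestronglyMeasurable

/-- The point of the unit circle at the angle `θ`. -/
def circlePoint (θ : ℝ) : Plane := Real.cos θ • Coord.basisVec 0 + Real.sin θ • Coord.basisVec 1

/-- The unit tangent vector of the unit circle at the angle `θ`. -/
def circleTangent (θ : ℝ) : Plane :=
  -Real.sin θ • Coord.basisVec 0 + Real.cos θ • Coord.basisVec 1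

lemma hasDerivAt_circlePoint (θ : ℝ) : HasDerivAt circlePoint (circleTangent θ) θ :=
  ((Real.hasDerivAt_cos θ).smul_const _).add ((Real.hasDerivAt_sin θ).smul_const _)

lemma hasDerivAt_circleTangent (θ : ℝ) : HasDerivAt circleTangent (-circlePoint θ) θ := by
  refine (((Real.hasDerivAt_sin θ).neg.smul_const _).add
    ((Real.hasDerivAt_cos θ).smul_const _)).congr_deriv ?_
  simp only [circlePoint]
  module

lemma continuous_circlePoint : Continuous circlePoint :=
  continuous_iff_continuousAt.2 fun θ => (hasDerivAt_circlePoint θ).continuousAt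

lemma norm_circlePoint (θ : ℝ) : ‖circlePoint θ‖ = 1 := by
  rw [EuclideanSpace.norm_eq, Real.sqrt_eq_one]
  simp [circlePoint, Coord.basisVec]

lemma smul_circlePoint_mem_ball {ρ s : ℝ} (hs : s ∈ Ioo (-ρ) ρ) (θ : ℝ) :
    s • circlePoint θ ∈ Metric.ball (0 : Plane) ρ := by
  rw [mem_ball_zero_iff, norm_smul, norm_circlePoint, mul_one]
  exact abs_lt.2 hs

lemma hasDerivAt_apply_comp {D : Plane → Plane →L[ℝ] ℝ} {D2 : Plane →L[ℝ] Plane →L[ℝ] ℝ}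
    {c v : ℝ → Plane} {c' v' : Plane} {t : ℝ} (hD : HasFDerivAt D D2 (c t))
    (hc : HasDerivAt c c' t) (hv : HasDerivAt v v' t) :
    HasDerivAt (fun τ => D (c τ) (v τ)) (D2 c' (v t) + D (c t) v') t :=
  (hD.comp_hasDerivAt t hc).clm_apply hv

/-- The mean value inequality for subharmonic functions of the disc, `D` and `D2` being the first
two derivatives of `h`: the integral `m` of `h` over the circles of radius `s` satisfies
`(s m')' = s * ∫ Δ h ≥ 0`. -/
lemma two_pi_mul_le_integral_circle_of_hasFDerivAt {ρ : ℝ} {h : Plane → ℝ}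
    {D : Plane → Plane →L[ℝ] ℝ} {D2 : Plane → Plane →L[ℝ] Plane →L[ℝ] ℝ}
    (hhd : ∀ y ∈ Metric.ball (0 : Plane) ρ, HasFDerivAt h (D y) y)
    (hDd : ∀ y ∈ Metric.ball (0 : Plane) ρ, HasFDerivAt D (D2 y) y)
    (hD2c : ContinuousOn D2 (Metric.ball 0 ρ))
    (hΔ : ∀ y ∈ Metric.ball (0 : Plane) ρ, 0 ≤ D2 y (Coord.basisVec 0) (Coord.basisVec 0)
        + D2 y (Coord.basisVec 1) (Coord.basisVec 1))
    {s : ℝ} (hs0 : 0 ≤ s) (hs : s < ρ) :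
    2 * Real.pi * h 0 ≤ ∫ θ in (-Real.pi)..Real.pi, h (s • circlePoint θ) := by
  have hhc : ContinuousOn h (Metric.ball 0 ρ) := fun y hy =>
    (hhd y hy).continuousAt.continuousWithinAt
  have hDc : ContinuousOn D (Metric.ball 0 ρ) := fun y hy =>
    (hDd y hy).continuousAt.continuousWithinAt
  have hcirc : Continuous fun p : ℝ × ℝ => circlePoint p.2 :=
    continuous_circlePoint.comp continuous_snd
  have hpol : Continuous fun p : ℝ × ℝ => p.1 • circlePoint p.2 := continuous_fst.smul hcirc
  have hmaps : MapsTo (fun p : ℝ × ℝ => p.1 • circlePoint p.2) (Ioo (-ρ) ρ ×ˢ univ)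
      (Metric.ball 0 ρ) := fun p hp => smul_circlePoint_mem_ball hp.1 p.2
  have c0 : ContinuousOn (fun p : ℝ × ℝ => h (p.1 • circlePoint p.2)) (Ioo (-ρ) ρ ×ˢ univ) :=
    hhc.comp hpol.continuousOn hmaps
  have c1 : ContinuousOn (fun p : ℝ × ℝ => D (p.1 • circlePoint p.2) (circlePoint p.2))
      (Ioo (-ρ) ρ ×ˢ univ) :=
    (hDc.comp hpol.continuousOn hmaps).clm_apply hcirc.continuousOn
  have c2 : ContinuousOn (fun p : ℝ × ℝ =>
      D2 (p.1 • circlePoint p.2) (circlePoint p.2) (circlePoint p.2)) (Ioo (-ρ) ρ ×ˢ univ) :=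
    ((hD2c.comp hpol.continuousOn hmaps).clm_apply hcirc.continuousOn).clm_apply
      hcirc.continuousOn
  have hray : ∀ (s θ : ℝ), HasDerivAt (fun s : ℝ => s • circlePoint θ) (circlePoint θ) s :=
    fun s θ => by simpa using (hasDerivAt_id s).smul_const (circlePoint θ)
  have d0 : ∀ s ∈ Ioo (-ρ) ρ, ∀ θ, HasDerivAt (fun s => h (s • circlePoint θ))
      (D (s • circlePoint θ) (circlePoint θ)) s := fun s hs θ =>
    (hhd _ (smul_circlePoint_mem_ball hs θ)).comp_hasDerivAt s (hray s θ)
  have d1 : ∀ s ∈ Ioo (-ρ) ρ, ∀ θ, HasDerivAt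
      (fun s => s * D (s • circlePoint θ) (circlePoint θ))
      (D (s • circlePoint θ) (circlePoint θ)
        + s * D2 (s • circlePoint θ) (circlePoint θ) (circlePoint θ)) s := fun s hs θ => by
    have h1 := hasDerivAt_apply_comp (c := fun s => s • circlePoint θ)
      (v := fun _ => circlePoint θ) (hDd _ (smul_circlePoint_mem_ball hs θ)) (hray s θ)
      (hasDerivAt_const s (circlePoint θ))
    refine ((hasDerivAt_id' s).fun_mul h1).congr_deriv ?_
    rw [map_zero, add_zero, one_mul]
  have m1 := fun s hs => hasDerivAt_integral_of_continuousOn (a := -Real.pi) (b := Real.pi)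
    (f := fun s θ => h (s • circlePoint θ)) (f' := fun s θ => D (s • circlePoint θ) (circlePoint θ))
    c0 c1 d0 (s := s) hs
  have m2 := fun s hs => hasDerivAt_integral_of_continuousOn (a := -Real.pi) (b := Real.pi)
    (f := fun s θ => s * D (s • circlePoint θ) (circlePoint θ))
    (f' := fun s θ => D (s • circlePoint θ) (circlePoint θ)
        + s * D2 (s • circlePoint θ) (circlePoint θ) (circlePoint θ))
    (continuous_fst.continuousOn.mul c1) (c1.add (continuous_fst.continuousOn.mul c2)) d1
    (s := s) hs
  have hsub : Icc 0 s ⊆ Ioo (-ρ) ρ := fun x hx => ⟨by linarith [hx.1], by linarith [hx.2]⟩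
  -- the angular part of the Laplacian is a total derivative along the circle
  have m2_nonneg : ∀ x ∈ Icc 0 s, 0 ≤ ∫ θ in (-Real.pi)..Real.pi,
      (D (x • circlePoint θ) (circlePoint θ)
        + x * D2 (x • circlePoint θ) (circlePoint θ) (circlePoint θ)) := by
    intro x hx
    have hxρ := hsub hx
    have hw : ∀ θ, HasDerivAt (fun θ => D (x • circlePoint θ) (circleTangent θ))
        (x * D2 (x • circlePoint θ) (circleTangent θ) (circleTangent θ)
          - D (x • circlePoint θ) (circlePoint θ)) θ := fun θ => by
      have h1 := hasDerivAt_apply_comp (c := fun θ => x • circlePoint θ) (v := circleTangent)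
        (hDd _ (smul_circlePoint_mem_ball hxρ θ))
        ((hasDerivAt_circlePoint θ).const_smul x) (hasDerivAt_circleTangent θ)
      refine h1.congr_deriv ?_
      rw [map_neg, ← sub_eq_add_neg, map_smul, smul_apply, smul_eq_mul]
    have hct : Continuous circleTangent :=
      continuous_iff_continuousAt.2 fun θ => (hasDerivAt_circleTangent θ).continuousAt
    have hcx : Continuous fun θ => x • circlePoint θ := continuous_circlePoint.const_smul x
    have hDx : Continuous fun θ => D (x • circlePoint θ) :=
      hDc.comp_continuous hcx fun θ => smul_circlePoint_mem_ball hxρ θ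
    have hD2x : Continuous fun θ => D2 (x • circlePoint θ) :=
      hD2c.comp_continuous hcx fun θ => smul_circlePoint_mem_ball hxρ θ
    have hwc : Continuous fun θ => x * D2 (x • circlePoint θ) (circleTangent θ) (circleTangent θ)
          - D (x • circlePoint θ) (circlePoint θ) :=
      (continuous_const.mul ((hD2x.clm_apply hct).clm_apply hct)).sub
        (hDx.clm_apply continuous_circlePoint)
    have hI : Continuous fun θ => D (x • circlePoint θ) (circlePoint θ)
        + x * D2 (x • circlePoint θ) (circlePoint θ) (circlePoint θ) :=
      (hDx.clm_apply continuous_circlePoint).add (continuous_const.mul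
        ((hD2x.clm_apply continuous_circlePoint).clm_apply continuous_circlePoint))
    have h0 : ∫ θ in (-Real.pi)..Real.pi,
        (x * D2 (x • circlePoint θ) (circleTangent θ) (circleTangent θ)
          - D (x • circlePoint θ) (circlePoint θ)) = 0 := by
      rw [intervalIntegral.integral_eq_sub_of_hasDerivAt (fun θ _ => hw θ)
        (hwc.intervalIntegrable _ _)]
      simp [circlePoint, circleTangent]
    have hsum := intervalIntegral.integral_add (hI.intervalIntegrable (μ := volume) (-Real.pi)
      Real.pi) (hwc.intervalIntegrable (-Real.pi) Real.pi)
    rw [h0, add_zero] at hsum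
    rw [← hsum]
    refine intervalIntegral.integral_nonneg (by linarith [Real.pi_pos]) fun θ _ => ?_
    have h1 := mul_nonneg hx.1 (hΔ _ (smul_circlePoint_mem_ball hxρ θ))
    have h2 := Real.sin_sq_add_cos_sq θ
    refine h1.trans_eq ?_
    generalize D2 (x • circlePoint θ) = B
    generalize D (x • circlePoint θ) (circlePoint θ) = b
    simp only [circlePoint, circleTangent, map_add, map_smul, add_apply, smul_apply, smul_eq_mul]
    linear_combination (-x * (B (Coord.basisVec 0) (Coord.basisVec 0)
      + B (Coord.basisVec 1) (Coord.basisVec 1))) * h2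
  have n_mono : MonotoneOn (fun s => ∫ θ in (-Real.pi)..Real.pi,
      s * D (s • circlePoint θ) (circlePoint θ)) (Icc 0 s) := by
    refine monotoneOn_of_deriv_nonneg (convex_Icc 0 s)
      (fun x hx => (m2 x (hsub hx)).continuousAt.continuousWithinAt)
      (fun x hx => (m2 x (hsub (interior_subset hx))).differentiableAt.differentiableWithinAt)
      fun x hx => ?_
    rw [(m2 x (hsub (interior_subset hx))).deriv]
    exact m2_nonneg x (interior_subset hx)
  have m_mono : MonotoneOn (fun s => ∫ θ in (-Real.pi)..Real.pi, h (s • circlePoint θ))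
      (Icc 0 s) := by
    refine monotoneOn_of_deriv_nonneg (convex_Icc 0 s)
      (fun x hx => (m1 x (hsub hx)).continuousAt.continuousWithinAt)
      (fun x hx => (m1 x (hsub (interior_subset hx))).differentiableAt.differentiableWithinAt)
      fun x hx => ?_
    rw [(m1 x (hsub (interior_subset hx))).deriv]
    rw [interior_Icc] at hx
    have h1 := n_mono (left_mem_Icc.2 hs0) (Ioo_subset_Icc_self hx) hx.1.le
    simp only [zero_mul, intervalIntegral.integral_zero, intervalIntegral.integral_const_mul] at h1
    exact nonneg_of_mul_nonneg_right h1 hx.1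
  have := m_mono (left_mem_Icc.2 hs0) (right_mem_Icc.2 hs0) hs0
  simp only [zero_smul, intervalIntegral.integral_const, smul_eq_mul] at this
  linarith

lemma two_pi_mul_le_integral_circle {ρ : ℝ} {h : Plane → ℝ}
    (hh : ContDiffOn ℝ ∞ h (Metric.ball 0 ρ))
    (hΔ : ∀ y ∈ Metric.ball (0 : Plane) ρ,
      0 ≤ fderiv ℝ (fderiv ℝ h) y (Coord.basisVec 0) (Coord.basisVec 0)
        + fderiv ℝ (fderiv ℝ h) y (Coord.basisVec 1) (Coord.basisVec 1))
    {s : ℝ} (hs0 : 0 ≤ s) (hs : s < ρ) :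
    2 * Real.pi * h 0 ≤ ∫ θ in (-Real.pi)..Real.pi, h (s • circlePoint θ) := by
  have hDc : ContDiffOn ℝ ∞ (fderiv ℝ h) (Metric.ball 0 ρ) :=
    hh.fderiv_of_isOpen Metric.isOpen_ball (by simp)
  exact two_pi_mul_le_integral_circle_of_hasFDerivAt (fun y hy => ((hh.contDiffAt
    (Metric.isOpen_ball.mem_nhds hy)).differentiableAt (by simp)).hasFDerivAt)
    (fun y hy => ((hDc.contDiffAt
    (Metric.isOpen_ball.mem_nhds hy)).differentiableAt (by simp)).hasFDerivAt)
    (hDc.fderiv_of_isOpen Metric.isOpen_ball (m := ∞) (by simp)).continuousOn hΔ hs0 hs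

end CircleMean

/-! ### Curvature and area in a Poincaré chart -/

namespace Coord

variable {G : Plane → Matrix (Fin 2) (Fin 2) ℝ} {U : Set Plane} {φ : Plane → ℝ} {y : Plane}

/-- The Christoffel symbols of the metric `φ (dx² + dy²)`. -/
lemma christoffel_of_isothermal (hU : IsOpen U) (hpos : ∀ y ∈ U, 0 < φ y)
    (hG : ∀ y ∈ U, ∀ i j, G y i j = if i = j then φ y else 0) (hy : y ∈ U) (k i j : Fin 2) :
    christoffel G k i j y = (φ y)⁻¹ * (1 / 2 * ((if j = k then partialDeriv i φ y else 0)
      + (if i = k then partialDeriv j φ y else 0) - if i = j then partialDeriv k φ y else 0)) := by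
  have hd : ∀ a i j, partialDeriv a (fun z => G z i j) y
      = if i = j then partialDeriv a φ y else 0 := fun a i j => by
    rw [partialDeriv_congr hU hy (fun z hz => hG z hz i j) a]
    split_ifs
    · rfl
    · exact partialDeriv_const _ _ _
  have h1 : G y = φ y • (1 : Matrix (Fin 2) (Fin 2) ℝ) := by
    ext i j
    rw [hG y hy, Matrix.smul_apply, Matrix.one_apply]
    simp
  have hinv : (G y)⁻¹ = (φ y)⁻¹ • (1 : Matrix (Fin 2) (Fin 2) ℝ) := by
    refine Matrix.inv_eq_right_inv ?_
    rw [h1, smul_mul_smul_comm, mul_one, mul_inv_cancel₀ (hpos y hy).ne', one_smul]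
  simp only [christoffel, hd, hinv, Matrix.smul_apply, Matrix.one_apply, smul_eq_mul, mul_ite,
    mul_one, mul_zero, ite_mul, zero_mul, Finset.sum_ite_eq, Finset.mem_univ, if_true]
  ring

lemma partialDeriv_inv_mul {f g : Plane → ℝ} (i : Fin 2) (hf : DifferentiableAt ℝ f y)
    (hg : DifferentiableAt ℝ g y) (h0 : f y ≠ 0) :
    partialDeriv i (fun z => (f z)⁻¹ * g z) y
      = -(f y ^ 2)⁻¹ * partialDeriv i f y * g y + (f y)⁻¹ * partialDeriv i g y := by
  have h1 : HasFDerivAt (fun z => (f z)⁻¹) (-(f y ^ 2)⁻¹ • fderiv ℝ f y) y :=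
    (hasDerivAt_inv h0).comp_hasFDerivAt y hf.hasFDerivAt
  rw [partialDeriv_mul i h1.differentiableAt hg]
  congr 2
  rw [partialDeriv, h1.fderiv]
  rfl

/-- In isothermal coordinates, the conformal factor of a metric of nonpositive curvature is
subharmonic: `φ Δ φ = |∇ φ|² - 2 φ³ K`. -/
lemma laplacian_nonneg_of_gaussianCurvature_nonpos (hU : IsOpen U) (hφ : ContDiffOn ℝ ∞ φ U)
    (hpos : ∀ y ∈ U, 0 < φ y) (hG : ∀ y ∈ U, ∀ i j, G y i j = if i = j then φ y else 0)
    (hy : y ∈ U) (hK : gaussianCurvature G y ≤ 0) :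
    0 ≤ partialDeriv 0 (partialDeriv 0 φ) y + partialDeriv 1 (partialDeriv 1 φ) y := by
  have hΓ := fun {z} (hz : z ∈ U) => christoffel_of_isothermal hU hpos hG hz
  have hp := hpos y hy
  have hφd := (hφ.contDiffAt (hU.mem_nhds hy)).differentiableAt (by simp)
  have hφd2 : ∀ i, DifferentiableAt ℝ (partialDeriv i φ) y := fun i =>
    ((contDiffOn_partialDeriv hU hφ i).contDiffAt (hU.mem_nhds hy)).differentiableAt (by simp)
  have h1 : partialDeriv 0 (christoffel G 0 1 1) y
      = -(1 / 2) * (-(φ y ^ 2)⁻¹ * partialDeriv 0 φ y * partialDeriv 0 φ y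
        + (φ y)⁻¹ * partialDeriv 0 (partialDeriv 0 φ) y) := by
    rw [← partialDeriv_inv_mul 0 hφd (hφd2 0) hp.ne',
      partialDeriv_congr hU hy (f := christoffel G 0 1 1)
        (g := fun z => -(1 / 2) * ((φ z)⁻¹ * partialDeriv 0 φ z)) fun z hz => by
          simp only [hΓ hz]; simp; ring,
      partialDeriv_mul 0 (differentiableAt_const _) ((hφd.fun_inv hp.ne').fun_mul (hφd2 0)),
      partialDeriv_const, zero_mul, zero_add]
  have h2 : partialDeriv 1 (christoffel G 0 0 1) y
      = 1 / 2 * (-(φ y ^ 2)⁻¹ * partialDeriv 1 φ y * partialDeriv 1 φ y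
        + (φ y)⁻¹ * partialDeriv 1 (partialDeriv 1 φ) y) := by
    rw [← partialDeriv_inv_mul 1 hφd (hφd2 1) hp.ne',
      partialDeriv_congr hU hy (f := christoffel G 0 0 1)
        (g := fun z => 1 / 2 * ((φ z)⁻¹ * partialDeriv 1 φ z)) fun z hz => by
          simp only [hΓ hz]; simp; ring,
      partialDeriv_mul 1 (differentiableAt_const _) ((hφd.fun_inv hp.ne').fun_mul (hφd2 1)),
      partialDeriv_const, zero_mul, zero_add]
  have hdet : (G y).det = φ y ^ 2 := by
    rw [Matrix.det_fin_two]; simp [hG y hy]; ring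
  rw [gaussianCurvature, hdet, div_le_iff₀ (by positivity), zero_mul] at hK
  simp only [Fin.sum_univ_two, hG y hy, riemann, h1, h2, hΓ hy] at hK
  simp at hK
  have e : partialDeriv 0 (partialDeriv 0 φ) y + partialDeriv 1 (partialDeriv 1 φ) y
      - (partialDeriv 0 φ y ^ 2 + partialDeriv 1 φ y ^ 2) / φ y ≥ 0 := by
    field_simp at hK
    rw [ge_iff_le, sub_nonneg, div_le_iff₀ hp]
    nlinarith
  have : 0 ≤ (partialDeriv 0 φ y ^ 2 + partialDeriv 1 φ y ^ 2) / φ y := by positivity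
  linarith

end Coord

section Area

open MeasureTheory

lemma complexIso_polarCoord_symm (p : ℝ × ℝ) :
    complexIso (Complex.polarCoord.symm p) = p.1 • circlePoint p.2 := by
  rw [Complex.polarCoord_symm_apply]
  ext i
  fin_cases i <;>
    simp [complexIso, circlePoint, Coord.basisVec, Complex.cos_ofReal_re, Complex.sin_ofReal_re]

/-- Integration in polar coordinates: a lower bound of the integral over a disc by lower bounds of
the integrals over circles. -/
lemma lintegral_le_lintegral_ball {ρ : ℝ} {φ : Plane → ℝ} {c : ℝ → ℝ}
    (hφ : ContinuousOn φ (Metric.ball 0 ρ)) (hpos : ∀ y ∈ Metric.ball (0 : Plane) ρ, 0 ≤ φ y)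
    (hc : ∀ s ∈ Ioo 0 ρ, c s ≤ ∫ θ in (-Real.pi)..Real.pi, φ (s • circlePoint θ)) :
    ∫⁻ s in Ioo 0 ρ, ENNReal.ofReal (s * c s)
      ≤ ∫⁻ y in Metric.ball (0 : Plane) ρ, ENNReal.ofReal (φ y) := by
  set f : Plane → ENNReal := (Metric.ball (0 : Plane) ρ).indicator fun y => ENNReal.ofReal (φ y)
    with hf
  have hfm : Measurable f := by
    classical
    rw [hf, ← piecewise_eq_indicator]
    exact ContinuousOn.measurable_piecewise (ENNReal.continuous_ofReal.comp_continuousOn hφ)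
      continuousOn_const Metric.isOpen_ball.measurableSet
  have hpolc : Continuous fun p : ℝ × ℝ => p.1 • circlePoint p.2 :=
    continuous_fst.smul (continuous_circlePoint.comp continuous_snd)
  rw [← lintegral_indicator Metric.isOpen_ball.measurableSet, ← hf,
    ← complexIso.measurePreserving.lintegral_comp hfm,
    ← Complex.lintegral_comp_polarCoord_symm, polarCoord_target, Measure.volume_eq_prod,
    ← Measure.prod_restrict]
  simp only [complexIso_polarCoord_symm, smul_eq_mul]
  have hm : Measurable fun p : ℝ × ℝ => ENNReal.ofReal p.1 * f (p.1 • circlePoint p.2) :=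
    (ENNReal.measurable_ofReal.comp measurable_fst).mul (hfm.comp hpolc.measurable)
  rw [lintegral_prod _ hm.aemeasurable]
  refine le_trans ?_ (lintegral_mono_set (s := Ioo 0 ρ) fun _ hx => hx.1)
  refine setLIntegral_mono' measurableSet_Ioo fun s hs => ?_
  have hs' : s ∈ Ioo (-ρ) ρ := ⟨by linarith [hs.1, hs.2], hs.2⟩
  have hline : Continuous fun θ => φ (s • circlePoint θ) :=
    hφ.comp_continuous (continuous_circlePoint.const_smul s) (smul_circlePoint_mem_ball hs')
  have hfs : ∀ θ, f (s • circlePoint θ) = ENNReal.ofReal (φ (s • circlePoint θ)) := fun θ =>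
    indicator_of_mem (smul_circlePoint_mem_ball hs' θ) _
  simp only [hfs]
  rw [lintegral_const_mul' _ _ ENNReal.ofReal_ne_top,
    ENNReal.ofReal_mul hs.1.le]
  gcongr
  rw [← ofReal_integral_eq_lintegral_ofReal
    ((hline.integrableOn_Icc (a := -Real.pi) (b := Real.pi)).mono_set Ioo_subset_Icc_self)
    (Eventually.of_forall fun θ => hpos _ (smul_circlePoint_mem_ball hs' θ)),
    ← integral_Ioc_eq_integral_Ioo, ← intervalIntegral.integral_of_le (by linarith [Real.pi_pos])]
  exact ENNReal.ofReal_le_ofReal (hc s hs)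

lemma lintegral_Ioo_eq_of_hasDerivAt {ρ : ℝ} (hρ : 0 ≤ ρ) {f f' : ℝ → ℝ}
    (hf : ∀ s ∈ Icc 0 ρ, HasDerivAt f (f' s) s) (hc : ContinuousOn f' (Icc 0 ρ))
    (hpos : ∀ s ∈ Ioo 0 ρ, 0 ≤ f' s) :
    ∫⁻ s in Ioo 0 ρ, ENNReal.ofReal (f' s) = ENNReal.ofReal (f ρ - f 0) := by
  rw [← intervalIntegral.integral_eq_sub_of_hasDerivAt
    (fun s hs => hf s (by rwa [uIcc_of_le hρ] at hs))
    ((by rwa [uIcc_of_le hρ] : ContinuousOn f' (uIcc 0 ρ)).intervalIntegrable),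
    intervalIntegral.integral_of_le hρ, integral_Ioc_eq_integral_Ioo,
    ofReal_integral_eq_lintegral_ofReal (hc.integrableOn_Icc.mono_set Ioo_subset_Icc_self)
      ((ae_restrict_iff' measurableSet_Ioo).2 (Eventually.of_forall hpos))]

end Area

namespace SurfaceMetric

variable {M : Type*} [TopologicalSpace M] [ChartedSpace Plane M] [IsManifold 𝓘(ℝ, Plane) ∞ M]
  {σ g : SurfaceMetric M} {e : OpenPartialHomeomorph M Plane} {ρ : ℝ}

lemma lintegral_le_area [MeasurableSpace M] [BorelSpace M]
    (he : e ∈ IsManifold.maximalAtlas 𝓘(ℝ, Plane) ∞ M) :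
    ∫⁻ y in e.target, ENNReal.ofReal √(g.coordMatrix e y).det ≤ g.area := by
  have h1 : g.chartMeasure e ≤ g.riemannianMeasure := le_iSup₂_of_le e he le_rfl
  refine le_trans (le_of_eq ?_) (h1 univ)
  have hm : AEMeasurable e.symm ((MeasureTheory.volume.restrict e.target).withDensity
      fun y => ENNReal.ofReal √(g.coordMatrix e y).det) :=
    (e.continuousOn_symm.aemeasurable e.open_target.measurableSet).mono_ac
      (MeasureTheory.withDensity_absolutelyContinuous _ _)
  rw [chartMeasure, MeasureTheory.Measure.map_apply_of_aemeasurable hm MeasurableSet.univ,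
    preimage_univ, MeasureTheory.withDensity_apply _ MeasurableSet.univ,
    MeasureTheory.Measure.restrict_univ]

lemma coordForm_conformal (u : M → ℝ) (hu : ContMDiff 𝓘(ℝ, Plane) 𝓘(ℝ, ℝ) ∞ u) (y v w : Plane) :
    (g.conformal u hu).coordForm e y v w
      = Real.exp (2 * u (e.symm y)) * g.coordForm e y v w := rfl

lemma one_sub_norm_sq_pos {y : Plane} (hρ : ρ ≤ 1) (hy : y ∈ Metric.ball (0 : Plane) ρ) :
    0 < 1 - ‖y‖ ^ 2 := by
  rw [mem_ball_zero_iff] at hy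
  nlinarith [norm_nonneg y]

lemma inner_basisVec (i j : Fin 2) :
    inner ℝ (Coord.basisVec i) (Coord.basisVec j) = if i = j then (1 : ℝ) else 0 := by
  simp [Coord.basisVec, EuclideanSpace.inner_single_left]

lemma IsPoincareChart.coordMatrix_eq (h : σ.IsPoincareChart e ρ) {y : Plane}
    (hy : y ∈ Metric.ball (0 : Plane) ρ) (i j : Fin 2) :
    σ.coordMatrix e y i j = if i = j then 4 / (1 - ‖y‖ ^ 2) ^ 2 else 0 := by
  rw [coordMatrix_apply, h.form y hy, inner_basisVec]
  simp

lemma IsPoincareChart.coordMatrix_conformal_eq (h : σ.IsPoincareChart e ρ) (u : M → ℝ)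
    (hu : ContMDiff 𝓘(ℝ, Plane) 𝓘(ℝ, ℝ) ∞ u) {y : Plane}
    (hy : y ∈ Metric.ball (0 : Plane) ρ) (i j : Fin 2) :
    (σ.conformal u hu).coordMatrix e y i j
      = if i = j then Real.exp (2 * u (e.symm y)) * (4 / (1 - ‖y‖ ^ 2) ^ 2) else 0 := by
  rw [coordMatrix_apply, coordForm_conformal, h.form y hy, inner_basisVec]
  simp

/-- The area of the surface is at least that of an isothermal chart with conformal factor `φ`. -/
lemma lintegral_ball_le_area [MeasurableSpace M] [BorelSpace M]
    (he : e ∈ IsManifold.maximalAtlas 𝓘(ℝ, Plane) ∞ M) (ht : e.target = Metric.ball 0 ρ)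
    {φ : Plane → ℝ} (hφ : ∀ y ∈ Metric.ball (0 : Plane) ρ, 0 ≤ φ y)
    (hG : ∀ y ∈ Metric.ball (0 : Plane) ρ, ∀ i j,
      g.coordMatrix e y i j = if i = j then φ y else 0) :
    ∫⁻ y in Metric.ball (0 : Plane) ρ, ENNReal.ofReal (φ y) ≤ g.area := by
  refine le_trans (le_of_eq ?_) (lintegral_le_area he)
  rw [ht]
  refine MeasureTheory.setLIntegral_congr_fun Metric.isOpen_ball.measurableSet fun y hy => ?_
  have hdet : (g.coordMatrix e y).det = φ y ^ 2 := by
    rw [Matrix.det_fin_two]; simp [hG y hy]; ring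
  simp only [hdet, Real.sqrt_sq (hφ y hy)]

/-- The area of the surface is at least that of an embedded hyperbolic disc. -/
lemma IsPoincareChart.ofReal_le_area [MeasurableSpace M] [BorelSpace M]
    (h : σ.IsPoincareChart e ρ) (hρ : ρ < 1) :
    ENNReal.ofReal (4 * Real.pi * ρ ^ 2 / (1 - ρ ^ 2)) ≤ σ.area := by
  have hpos := h.pos
  have hsub : ∀ s ∈ Icc 0 ρ, 0 < 1 - s ^ 2 := fun s hs => by nlinarith [hs.1, hs.2]
  refine le_trans ?_ (lintegral_ball_le_area h.mem h.target_eq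
    (φ := fun y => 4 / (1 - ‖y‖ ^ 2) ^ 2) (fun y hy => by positivity)
    fun y hy => h.coordMatrix_eq hy)
  refine le_trans (le_of_eq ?_) (lintegral_le_lintegral_ball
    (c := fun s => 2 * Real.pi * (4 / (1 - s ^ 2) ^ 2)) ?_ (fun y _ => by positivity) ?_)
  · rw [lintegral_Ioo_eq_of_hasDerivAt (f := fun s => 4 * Real.pi / (1 - s ^ 2)) hpos.le]
    · congr 1
      have := (hsub ρ ⟨hpos.le, le_rfl⟩).ne'
      field_simp
      ring
    · intro s hs
      have h1 := (hsub s hs).ne'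
      refine (((hasDerivAt_pow 2 s).const_sub 1).fun_inv h1 |>.const_mul (4 * Real.pi)).congr_deriv
        ?_ |>.congr_of_eventuallyEq (Eventually.of_forall fun _ => div_eq_mul_inv _ _)
      simp
      field_simp
    · refine continuousOn_id.mul (continuousOn_const.mul (continuousOn_const.div (by fun_prop) ?_))
      exact fun s hs => pow_ne_zero 2 (hsub s hs).ne'
    · intro s hs
      have := Real.pi_pos
      have := hs.1
      positivity
  · refine continuousOn_const.div (by fun_prop) fun y hy => ?_
    exact pow_ne_zero 2 (one_sub_norm_sq_pos hρ.le hy).ne'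
  · intro s hs
    simp only [norm_smul, norm_circlePoint, mul_one, Real.norm_eq_abs, sq_abs,
      intervalIntegral.integral_const, smul_eq_mul]
    exact le_of_eq (by ring)

/-- The mean value inequality for the conformal factor of a nonpositively curved metric, integrated
over a Poincaré disc. -/
lemma IsPoincareChart.ofReal_exp_le_area [MeasurableSpace M] [BorelSpace M]
    (h : σ.IsPoincareChart e ρ) {u : M → ℝ} (hu : ContMDiff 𝓘(ℝ, Plane) 𝓘(ℝ, ℝ) ∞ u)
    (hK : (σ.conformal u hu).IsNonpositivelyCurved) :
    ENNReal.ofReal (4 * Real.pi * ρ ^ 2 * Real.exp (2 * u (e.symm 0)))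
      ≤ (σ.conformal u hu).area := by
  have hρ0 := h.pos
  set φ : Plane → ℝ := fun y => Real.exp (2 * u (e.symm y)) * (4 / (1 - ‖y‖ ^ 2) ^ 2) with hφdef
  have hpos : ∀ y ∈ Metric.ball (0 : Plane) ρ, 0 < φ y := fun y hy => by
    have := one_sub_norm_sq_pos h.le_one hy
    positivity
  have hφ : ContDiffOn ℝ ∞ φ (Metric.ball 0 ρ) := by
    have h1 : ContDiffOn ℝ ∞ (fun y => u (e.symm y)) (Metric.ball 0 ρ) := by
      rw [← contMDiffOn_iff_contDiffOn, ← h.target_eq]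
      exact hu.comp_contMDiffOn (contMDiffOn_symm_of_mem_maximalAtlas h.mem)
    refine (Real.contDiff_exp.comp_contDiffOn (contDiffOn_const.mul h1)).mul
      (contDiffOn_const.div ?_ fun y hy => pow_ne_zero 2 (one_sub_norm_sq_pos h.le_one hy).ne')
    exact ((contDiff_const.sub (contDiff_norm_sq ℝ)).pow 2).contDiffOn
  have hG := fun y (hy : y ∈ Metric.ball (0 : Plane) ρ) => h.coordMatrix_conformal_eq u hu hy
  refine le_trans ?_ (lintegral_ball_le_area h.mem h.target_eq (fun y hy => (hpos y hy).le) hG)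
  refine le_trans (le_of_eq ?_) (lintegral_le_lintegral_ball (c := fun _ => 2 * Real.pi * φ 0)
    hφ.continuousOn (fun y hy => (hpos y hy).le) fun s hs => ?_)
  · have h0 : φ 0 = 4 * Real.exp (2 * u (e.symm 0)) := by simp [hφdef]; ring
    rw [lintegral_Ioo_eq_of_hasDerivAt (f := fun s => Real.pi * φ 0 * s ^ 2) hρ0.le]
    · congr 1
      rw [h0]
      ring
    · intro s _
      refine ((hasDerivAt_pow 2 s).const_mul (Real.pi * φ 0)).congr_deriv ?_
      simp
      ring
    · fun_prop
    · intro s hs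
      have := Real.pi_pos
      have := hs.1
      rw [h0]
      positivity
  · refine two_pi_mul_le_integral_circle hφ (fun y hy => ?_) hs.1.le hs.2
    rw [← Coord.partialDeriv_partialDeriv Metric.isOpen_ball hφ hy,
      ← Coord.partialDeriv_partialDeriv Metric.isOpen_ball hφ hy]
    refine Coord.laplacian_nonneg_of_gaussianCurvature_nonpos Metric.isOpen_ball hφ hpos hG hy ?_
    rw [← h.target_eq] at hy
    have := hK e h.mem (e.symm y) (e.map_target hy)
    rwa [curvatureIn, e.right_inv hy] at this

end SurfaceMetric

/-! ### The bound on the conformal factor -/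

lemma continuous_tanh_half : Continuous fun r : ℝ => Real.tanh (r / 2) := by
  have h : Continuous Real.tanh := continuous_iff_continuousAt.2 fun x =>
    (hasDerivAt_tanh x).continuousAt
  fun_prop

lemma one_sub_tanh_sq_pos (x : ℝ) : 0 < 1 - Real.tanh x ^ 2 := by
  have := tanh_mem_Ioo x
  nlinarith [this.1, this.2]

lemma tanh_sq_div_one_sub (x : ℝ) :
    Real.tanh x ^ 2 / (1 - Real.tanh x ^ 2) = Real.sinh x ^ 2 := by
  have h := Real.cosh_sq x
  have hc := (Real.cosh_pos x).ne'
  rw [div_eq_iff (one_sub_tanh_sq_pos x).ne', Real.tanh_eq_sinh_div_cosh]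
  field_simp
  rw [h]
  ring

theorem theoremA {M : Type*} [TopologicalSpace M] [T2Space M] [CompactSpace M] [ConnectedSpace M]
    [ChartedSpace Plane M] [IsManifold 𝓘(ℝ, Plane) ∞ M] [MeasurableSpace M] [BorelSpace M]
    (σ : SurfaceMetric M) (hσ : SurfaceMetric.IsHyperbolic σ)
    (A : ℝ) (hA : SurfaceMetric.area σ = ENNReal.ofReal A) :
    0 < SurfaceMetric.injectivityRadius σ ∧
    ∃ C : ℝ, 0 < C ∧
      C = 1 / 2 * Real.log
        (A / (4 * Real.pi * Real.tanh (SurfaceMetric.injectivityRadius σ / 2) ^ 2)) ∧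
      ∀ (u : M → ℝ) (hu : ContMDiff 𝓘(ℝ, Plane) 𝓘(ℝ, ℝ) ∞ u),
        SurfaceMetric.IsNonpositivelyCurved (SurfaceMetric.conformal σ u hu) →
        SurfaceMetric.area (SurfaceMetric.conformal σ u hu) = ENNReal.ofReal A →
        ∀ x : M, u x ≤ C := by
  have hπ := Real.pi_pos
  obtain ⟨p₀⟩ := (inferInstance : Nonempty M)
  set S : Set ℝ := {r : ℝ | 0 < r ∧ ∀ p : M, σ.HasNormalBall p r} with hS
  set R := σ.injectivityRadius with hR
  obtain ⟨r₀, hr₀⟩ := SurfaceMetric.exists_forall_hasNormalBall hσ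
  have hSne : S.Nonempty := ⟨r₀, hr₀⟩
  -- comparison of the area of the surface with that of the disc of radius `r`
  have hSarea : ∀ r ∈ S, 4 * Real.pi * Real.sinh (r / 2) ^ 2 ≤ A := by
    rintro r ⟨hr, hball⟩
    obtain ⟨e, he, -, -⟩ := (hball p₀).exists_isPoincareChart hσ hr
    have h1 := he.ofReal_le_area (tanh_mem_Ioo (r / 2)).2
    rw [hA, mul_div_assoc, tanh_sq_div_one_sub] at h1
    have h2 := Real.sinh_pos_iff.2 (half_pos hr)
    have h3 : 0 < 4 * Real.pi * Real.sinh (r / 2) ^ 2 := by positivity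
    exact (ENNReal.ofReal_le_ofReal_iff'.1 h1).resolve_right (not_le.2 h3)
  have hSbdd : BddAbove S := by
    refine ⟨A + 1, fun r hr => ?_⟩
    have h1 := hSarea r hr
    have h2 : r / 2 ≤ Real.sinh (r / 2) := Real.self_le_sinh_iff.2 (half_pos hr.1).le
    have h3 : (r / 2) ^ 2 ≤ Real.sinh (r / 2) ^ 2 := pow_le_pow_left₀ (half_pos hr.1).le h2 2
    nlinarith [Real.pi_gt_three, sq_nonneg (r - 1), sq_nonneg (r / 2)]
  have hRpos : 0 < R := hr₀.1.trans_le (le_csSup hSbdd hr₀)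
  have hRcl : R ∈ closure S := csSup_mem_closure hSne hSbdd
  -- inequalities which hold for all radii in `S` pass to the supremum
  have hclosed : ∀ {f : ℝ → ℝ} {b : ℝ}, Continuous f → (∀ r ∈ S, f r ≤ b) → f R ≤ b :=
    fun hf h => closure_minimal h (isClosed_le hf continuous_const) hRcl
  have hAR : 4 * Real.pi * Real.sinh (R / 2) ^ 2 ≤ A :=
    hclosed (f := fun r => 4 * Real.pi * Real.sinh (r / 2) ^ 2) (by fun_prop) hSarea
  set T := Real.tanh (R / 2) with hT
  have hTpos : 0 < T := tanh_pos (half_pos hRpos)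
  have hTA : 4 * Real.pi * T ^ 2 < A := by
    refine lt_of_lt_of_le ?_ hAR
    rw [← tanh_sq_div_one_sub, ← hT]
    have h1 : 0 < 1 - T ^ 2 := one_sub_tanh_sq_pos _
    have h2 : T ^ 2 < T ^ 2 / (1 - T ^ 2) := by
      rw [lt_div_iff₀ h1]
      nlinarith [pow_pos hTpos 2, pow_pos hTpos 4]
    have h3 : 0 < 4 * Real.pi := by positivity
    exact mul_lt_mul_of_pos_left h2 h3
  have hD : 0 < 4 * Real.pi * T ^ 2 := by positivity
  refine ⟨hRpos, _, ?_, rfl, fun u hu hK harea x => ?_⟩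
  · have := Real.log_pos ((one_lt_div hD).2 hTA)
    positivity
  · have h1 : ∀ r ∈ S, 4 * Real.pi * Real.tanh (r / 2) ^ 2 * Real.exp (2 * u x) ≤ A := by
      rintro r ⟨hr, hball⟩
      obtain ⟨e, he, hx, hx0⟩ := (hball x).exists_isPoincareChart hσ hr
      have h1 := he.ofReal_exp_le_area hu hK
      rw [harea, ← hx0, e.left_inv hx] at h1
      have := tanh_pos (half_pos hr)
      have h3 : 0 < 4 * Real.pi * Real.tanh (r / 2) ^ 2 * Real.exp (2 * u x) := by positivity
      exact (ENNReal.ofReal_le_ofReal_iff'.1 h1).resolve_right (not_le.2 h3)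
    have h2 : 4 * Real.pi * T ^ 2 * Real.exp (2 * u x) ≤ A :=
      hclosed (f := fun r => 4 * Real.pi * Real.tanh (r / 2) ^ 2 * Real.exp (2 * u x))
        ((continuous_const.mul (continuous_tanh_half.pow 2)).mul continuous_const) h1
    have h3 : 2 * u x ≤ Real.log (A / (4 * Real.pi * T ^ 2)) := by
      rw [Real.le_log_iff_exp_le (div_pos (hD.trans hTA) hD), le_div_iff₀ hD]
      linarith
    linarith

end
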